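/- For every $\gamma>0$ there is a constant $\delta=\delta(\gamma)>0$ such that for every integer $r\ge 3$ the following holds. If $k$-HyperPath in undirected $r$-uniform hypergraphs can be solved in time $O^*\big(2^{(1-\frac1{r-1}-\gamma)k}\big)$, then Exact Cover on $n$ elements can be solved in time $O^*\big(2^{(1-\delta)n}\big)$. Here $k$-HyperPath is the following decision problem: given an $r$-uniform hypergraph $H=(V,E)$ and an integer $k\geq 0$, is there a tight path on $k$ nodes, i.e. a sequence of $k$ distinct nodes of $H$ such that every $r$ consecutive ones constitute a hyperedge? Exact Cover is the following decision problem: given a ground set $U$ with $n$ elements and a family $\mathcal S\subseteq 2^U$ of $m$ sets, is there a subfamily of $\mathcal S$ that consists of pairwise disjoint sets and has union $U$? "Solved" means by a deterministic algorithm on a random access machine with logarithmic cost, and $O^*$ suppresses factors that are polynomial in the size of the instance, which is $|V|+|E|+k$ for $k$-HyperPath and $n+m$ for Exact Cover (the degree of the polynomial may depend on $\gamma$, on $r$ and on the algorithm). -/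

import Mathlib

/-! ## Random access machines with logarithmic cost

Since running times `O*(2 ^ (α k))` with exact constants `α` in the exponent are compared, the model
has to be a random access machine: passing from a random access machine to a Turing machine costs
more than a factor polynomial in the input size.  The model is the usual one with logarithmic cost:
registers and array cells hold natural numbers, arrays are addressed indirectly, and an operation is
charged the bit lengths of all numbers (addresses included) that it touches.  A program mentions
only finitely many registers and arrays; control flow is written with `if` and `while`. -/

namespace RAM

/-- The memory: registers `reg x` and arrays `arr a`, each cell holding a natural number. -/
structure State where
  reg : ℕ → ℕ
  arr : ℕ → ℕ → ℕ

/-- Expressions.  Subtraction is truncated at `0`, division is integer division (and `x / 0 = 0`). -/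
inductive Expr where
  | const (c : ℕ)
  | var (x : ℕ)
  | load (a : ℕ) (i : Expr)
  | add (e₁ e₂ : Expr)
  | sub (e₁ e₂ : Expr)
  | mul (e₁ e₂ : Expr)
  | div (e₁ e₂ : Expr)

/-- Programs. -/
inductive Prog where
  | skip
  | assign (x : ℕ) (e : Expr)
  | store (a : ℕ) (i e : Expr)
  | seq (p q : Prog)
  | ite (e : Expr) (p q : Prog)
  | while (e : Expr) (p : Prog)

/-- The charge for handling the number `v`: its bit length plus one. -/
def logCost (v : ℕ) : ℕ := Nat.size v + 1

/-- The value of an expression. -/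
def Expr.eval (s : State) : Expr → ℕ
  | .const c => c
  | .var x => s.reg x
  | .load a i => s.arr a (i.eval s)
  | .add e₁ e₂ => e₁.eval s + e₂.eval s
  | .sub e₁ e₂ => e₁.eval s - e₂.eval s
  | .mul e₁ e₂ => e₁.eval s * e₂.eval s
  | .div e₁ e₂ => e₁.eval s / e₂.eval s

/-- The time needed to evaluate an expression: every number that occurs is charged. -/
def Expr.cost (s : State) : Expr → ℕ
  | .const c => logCost c
  | .var x => logCost (s.reg x)
  | .load a i => i.cost s + logCost (s.arr a (i.eval s))
  | .add e₁ e₂ => e₁.cost s + e₂.cost s + logCost (e₁.eval s + e₂.eval s)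
  | .sub e₁ e₂ => e₁.cost s + e₂.cost s + logCost (e₁.eval s - e₂.eval s)
  | .mul e₁ e₂ => e₁.cost s + e₂.cost s + logCost (e₁.eval s * e₂.eval s)
  | .div e₁ e₂ => e₁.cost s + e₂.cost s + logCost (e₁.eval s / e₂.eval s)

/-- Write the value `v` into register `x`. -/
def State.setReg (s : State) (x v : ℕ) : State :=
  { s with reg := Function.update s.reg x v }

/-- Write the value `v` into cell `i` of array `a`. -/
def State.setArr (s : State) (a i v : ℕ) : State :=
  { s with arr := Function.update s.arr a (Function.update (s.arr a) i v) }

/-- `Exec p s s' t`: started in memory state `s`, the program `p` halts in memory state `s'` after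
exactly `t` units of time. -/
inductive Exec : Prog → State → State → ℕ → Prop where
  | skip (s : State) : Exec .skip s s 1
  | assign (s : State) (x : ℕ) (e : Expr) :
      Exec (.assign x e) s (s.setReg x (e.eval s)) (e.cost s + 1)
  | store (s : State) (a : ℕ) (i e : Expr) :
      Exec (.store a i e) s (s.setArr a (i.eval s) (e.eval s)) (i.cost s + e.cost s + 1)
  | seq {p q : Prog} {s s₁ s₂ : State} {t₁ t₂ : ℕ} (hp : Exec p s s₁ t₁) (hq : Exec q s₁ s₂ t₂) :
      Exec (.seq p q) s s₂ (t₁ + t₂)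
  | ite_true {e : Expr} {p q : Prog} {s s' : State} {t : ℕ} (he : e.eval s ≠ 0)
      (hp : Exec p s s' t) : Exec (.ite e p q) s s' (e.cost s + t)
  | ite_false {e : Expr} {p q : Prog} {s s' : State} {t : ℕ} (he : e.eval s = 0)
      (hq : Exec q s s' t) : Exec (.ite e p q) s s' (e.cost s + t)
  | while_done {e : Expr} {p : Prog} {s : State} (he : e.eval s = 0) :
      Exec (.while e p) s s (e.cost s)
  | while_step {e : Expr} {p : Prog} {s s₁ s₂ : State} {t₁ t₂ : ℕ} (he : e.eval s ≠ 0)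
      (hp : Exec p s s₁ t₁) (hw : Exec (.while e p) s₁ s₂ t₂) :
      Exec (.while e p) s s₂ (e.cost s + t₁ + t₂)

/-- The initial memory on input `w`: array `0` holds `w`, everything else is `0`. -/
def State.init (w : List ℕ) : State where
  reg := fun _ => 0
  arr := fun a i => if a = 0 then w.getD i 0 else 0

end RAM

/-- The decision problem with instances `ι`, encodings `enc w x` ("the word `w` is a presentation of
the instance `x`") and yes-instances `yes` can be solved in time `O*(f)`: a fixed program halts on
each presentation of each instance `x` within time `C * (size x + 1) ^ c * f x`, with constants `C`
and `c`, and then register `0` is nonzero exactly if `x` is a yes-instance. -/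
def SolvableInOStar {ι : Type} (enc : List ℕ → ι → Prop) (yes : ι → Prop) (size : ι → ℕ)
    (f : ι → ℝ) : Prop :=
  ∃ (p : RAM.Prog) (C c : ℕ), ∀ (x : ι) (w : List ℕ), enc w x →
    ∃ (s : RAM.State) (t : ℕ), RAM.Exec p (RAM.State.init w) s t ∧
      (s.reg 0 ≠ 0 ↔ yes x) ∧ (t : ℝ) ≤ C * ((size x : ℝ) + 1) ^ c * f x

/-! ## Tight paths in uniform hypergraphs -/

/-- An undirected `r`-uniform hypergraph on the vertex set `V`. -/
structure UniformHypergraph (V : Type) (r : ℕ) where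
  edges : Finset (Finset V)
  card_eq : ∀ e ∈ edges, e.card = r

/-- `v 0, …, v (k - 1)` is a tight path: the nodes are distinct and every `r` consecutive ones
constitute a hyperedge. -/
def UniformHypergraph.IsTightPath {V : Type} [DecidableEq V] {r k : ℕ} (H : UniformHypergraph V r)
    (v : Fin k → V) : Prop :=
  Function.Injective v ∧ ∀ (i : ℕ) (hi : i + r ≤ k),
    (Finset.univ.image fun j : Fin r => v ⟨i + j, by have := j.isLt; omega⟩) ∈ H.edges

/-- An instance of the `k`-HyperPath problem: an `r`-uniform hypergraph on `numVerts` nodes, and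
the number `k`. -/
structure HyperPathInstance (r : ℕ) where
  numVerts : ℕ
  graph : UniformHypergraph (Fin numVerts) r
  k : ℕ

namespace HyperPathInstance

variable {r : ℕ}

/-- Yes-instances: there is a tight path on `k` nodes. -/
def Yes (I : HyperPathInstance r) : Prop :=
  ∃ v : Fin I.k → Fin I.numVerts, I.graph.IsTightPath v

/-- Number of nodes plus number of hyperedges plus `k`. -/
def size (I : HyperPathInstance r) : ℕ := I.numVerts + I.graph.edges.card + I.k

/-- Presentations: the number of nodes, the number of hyperedges, `k`, and then the hyperedges,
each given once by its `r` nodes, in any order. -/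
def Enc (w : List ℕ) (I : HyperPathInstance r) : Prop :=
  ∃ L : List (List (Fin I.numVerts)), (∀ l ∈ L, l.Nodup) ∧ (L.map List.toFinset).Nodup ∧
    (L.map List.toFinset).toFinset = I.graph.edges ∧
    w = [I.numVerts, L.length, I.k] ++ L.flatten.map Fin.val

end HyperPathInstance

/-- `k`-HyperPath in undirected `r`-uniform hypergraphs can be solved in time `O*(2 ^ (α k))`. -/
def HyperPathSolvable (r : ℕ) (α : ℝ) : Prop :=
  SolvableInOStar (ι := HyperPathInstance r) HyperPathInstance.Enc HyperPathInstance.Yes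
    HyperPathInstance.size (fun I => (2 : ℝ) ^ (α * (I.k : ℝ)))

/-! ## Exact Cover -/

/-- An instance of Exact Cover: a ground set of `n` elements and a family of subsets of it. -/
structure ExactCoverInstance where
  n : ℕ
  family : Finset (Finset (Fin n))

namespace ExactCoverInstance

/-- Yes-instances: some subfamily consists of pairwise disjoint sets whose union is the whole
ground set. -/
def Yes (I : ExactCoverInstance) : Prop :=
  ∃ T ⊆ I.family, (∀ A ∈ T, ∀ B ∈ T, A ≠ B → Disjoint A B) ∧ ∀ x : Fin I.n, ∃ A ∈ T, x ∈ A

/-- Number of elements plus number of sets. -/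
def size (I : ExactCoverInstance) : ℕ := I.n + I.family.card

/-- Presentations: the number of elements, the number of sets, and then the sets, each given once,
by its cardinality followed by its elements, in any order. -/
def Enc (w : List ℕ) (I : ExactCoverInstance) : Prop :=
  ∃ L : List (List (Fin I.n)), (∀ l ∈ L, l.Nodup) ∧ (L.map List.toFinset).Nodup ∧
    (L.map List.toFinset).toFinset = I.family ∧
    w = [I.n, L.length] ++ (L.map fun l => l.length :: l.map Fin.val).flatten

end ExactCoverInstance

/-- Exact Cover on `n` elements can be solved in time `O*(2 ^ (β n))`. -/
def ExactCoverSolvable (β : ℝ) : Prop :=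
  SolvableInOStar ExactCoverInstance.Enc ExactCoverInstance.Yes ExactCoverInstance.size
    (fun I => (2 : ℝ) ^ (β * (I.n : ℝ)))

/-! Put `r = d + 2`. The sets of an Exact Cover instance are listed one after the other, which gives
`T` tokens labelled by elements. An exact cover amounts to a walk of `n` tokens with pairwise
distinct labels in which every set that is entered is traversed from its first token to its last
(`HasExactCover.hasWalk`, `HasWalk.hasExactCover`).

The walk is cut into blocks of `d` tokens, and between consecutive blocks a state node is inserted.
It names its time and the `2 * d` tokens around it. As `d` is constant, there are only polynomially
many states, and everything local about the walk is built into their validity. The tokens themselves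
appear on the path only as element nodes, that is, by their labels. So the requirement that the
nodes of a path are distinct forces the labels to be distinct globally. A window of `d + 2` nodes of
the intended path holds either one state and `d + 1` elements or two states and the `d` elements
between them; the hyperedges are exactly the sets of these two forms.

The intended path has `k = n * (d + 1) / d + O(d)` nodes. Since `1 - 1 / (r - 1) = d / (d + 1)`, the
exponent `(1 - 1 / (r - 1)) * k` is at most `n + 9 * d`, and the saving `γ * k` is at least `γ * n`.
Hence `δ = min γ 1` works for all `r`.

That a walk gives a path is direct (`HasWalk.exists_isPath`). For the converse the hyperedges are
unordered and the path is arbitrary. Away from its ends, two states are never within distance `d`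
(`states_far`), and each state is followed by another one at distance exactly `d + 1`
(`next_state`). The direction of time cannot flip, because a block would be repeated
(`exists_states`). So the path shows all times except a few at either extreme, where only padding
sits, and the walk can be read off (`IsPath.hasWalk`).

On the machine side, a weakest precondition calculus with one bound `B` for all numbers and all loop
counts yields polynomial time. The assumed algorithm is then run, with renamed registers and arrays,
on memory that the reduction leaves untouched apart from the output array. -/

/-! ## Polynomially bounded functions -/

/-- `f` is bounded by a polynomial in `size`. -/
def PolyBounded {ι : Type} (size f : ι → ℕ) : Prop :=
  ∃ K c : ℕ, ∀ x, f x ≤ K * (size x + 1) ^ c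

namespace PolyBounded

variable {ι : Type} {size f g : ι → ℕ}

theorem const (size : ι → ℕ) (a : ℕ) : PolyBounded size fun _ => a :=
  ⟨a, 0, fun x => by simp⟩

theorem self (size : ι → ℕ) : PolyBounded size size :=
  ⟨1, 1, fun x => by simp⟩

theorem mono (hg : PolyBounded size g) (h : ∀ x, f x ≤ g x) : PolyBounded size f := by
  obtain ⟨K, c, H⟩ := hg
  exact ⟨K, c, fun x => (h x).trans (H x)⟩

theorem add (hf : PolyBounded size f) (hg : PolyBounded size g) :
    PolyBounded size fun x => f x + g x := by
  obtain ⟨K, c, H⟩ := hf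
  obtain ⟨K', c', H'⟩ := hg
  refine ⟨K + K', c + c', fun x => ?_⟩
  have h1 : (size x + 1) ^ c ≤ (size x + 1) ^ (c + c') :=
    Nat.pow_le_pow_right (Nat.succ_pos _) (by omega)
  have h2 : (size x + 1) ^ c' ≤ (size x + 1) ^ (c + c') :=
    Nat.pow_le_pow_right (Nat.succ_pos _) (by omega)
  calc f x + g x ≤ K * (size x + 1) ^ c + K' * (size x + 1) ^ c' := Nat.add_le_add (H x) (H' x)
    _ ≤ K * (size x + 1) ^ (c + c') + K' * (size x + 1) ^ (c + c') := by gcongr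
    _ = _ := by ring

theorem mul (hf : PolyBounded size f) (hg : PolyBounded size g) :
    PolyBounded size fun x => f x * g x := by
  obtain ⟨K, c, H⟩ := hf
  obtain ⟨K', c', H'⟩ := hg
  refine ⟨K * K', c + c', fun x => ?_⟩
  calc f x * g x ≤ (K * (size x + 1) ^ c) * (K' * (size x + 1) ^ c') := Nat.mul_le_mul (H x) (H' x)
    _ = _ := by ring

theorem pow (hf : PolyBounded size f) (a : ℕ) : PolyBounded size fun x => f x ^ a := by
  induction a with
  | zero => simpa using const size 1
  | succ a ih => simpa [pow_succ] using ih.mul hf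

theorem comp {h : ℕ → ℕ} (hh : PolyBounded id h) (hf : PolyBounded size f) :
    PolyBounded size fun x => h (f x) := by
  obtain ⟨K, c, H⟩ := hh
  exact mono ((const size K).mul ((hf.add (const size 1)).pow c)) fun x => by simpa using H (f x)

end PolyBounded

/-! ### Bounds for the values and costs of expressions -/

namespace RAM

/-- This is far from sharp, but the reduction only has to be polynomial, and all numbers in it are
polynomially bounded themselves. -/
theorem logCost_le (v : ℕ) : logCost v ≤ v + 1 := by
  have : Nat.size v ≤ v := Nat.size_le.2 v.lt_two_pow_self
  unfold logCost; omega

/-- All registers and all array cells hold numbers that are at most `B`. -/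
def State.BoundedBy (B : ℕ) (s : State) : Prop :=
  (∀ x, s.reg x ≤ B) ∧ ∀ a i, s.arr a i ≤ B

/-- A bound for the value of an expression in a memory bounded by `B`. -/
def Expr.valueBound (B : ℕ) : Expr → ℕ
  | .const c => c
  | .var _ => B
  | .load _ _ => B
  | .add e₁ e₂ => e₁.valueBound B + e₂.valueBound B
  | .sub e₁ _ => e₁.valueBound B
  | .mul e₁ e₂ => e₁.valueBound B * e₂.valueBound B
  | .div e₁ _ => e₁.valueBound B

/-- A bound for the cost of an expression in a memory bounded by `B`. -/
def Expr.costBound (B : ℕ) : Expr → ℕ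
  | .const c => c + 1
  | .var _ => B + 1
  | .load _ i => i.costBound B + (B + 1)
  | .add e₁ e₂ => e₁.costBound B + e₂.costBound B + (e₁.valueBound B + e₂.valueBound B + 1)
  | .sub e₁ e₂ => e₁.costBound B + e₂.costBound B + (e₁.valueBound B + 1)
  | .mul e₁ e₂ => e₁.costBound B + e₂.costBound B + (e₁.valueBound B * e₂.valueBound B + 1)
  | .div e₁ e₂ => e₁.costBound B + e₂.costBound B + (e₁.valueBound B + 1)

theorem Expr.eval_le_valueBound {B : ℕ} {s : State} (hs : s.BoundedBy B) (e : Expr) :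
    e.eval s ≤ e.valueBound B := by
  induction e with
  | const c => exact le_rfl
  | var x => exact hs.1 x
  | load a i _ => exact hs.2 a _
  | add e₁ e₂ h₁ h₂ => exact Nat.add_le_add h₁ h₂
  | sub e₁ e₂ h₁ _ => exact (Nat.sub_le _ _).trans h₁
  | mul e₁ e₂ h₁ h₂ => exact Nat.mul_le_mul h₁ h₂
  | div e₁ e₂ h₁ _ => exact (Nat.div_le_self _ _).trans h₁

theorem Expr.cost_le_costBound {B : ℕ} {s : State} (hs : s.BoundedBy B) (e : Expr) :
    e.cost s ≤ e.costBound B := by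
  have key : ∀ {v b : ℕ}, v ≤ b → logCost v ≤ b + 1 := fun h => (logCost_le _).trans (by omega)
  induction e with
  | const c => exact key le_rfl
  | var x => exact key (hs.1 x)
  | load a i h => exact Nat.add_le_add h (key (hs.2 a _))
  | add e₁ e₂ h₁ h₂ =>
    exact Nat.add_le_add (Nat.add_le_add h₁ h₂) (key ((Expr.add e₁ e₂).eval_le_valueBound hs))
  | sub e₁ e₂ h₁ h₂ =>
    exact Nat.add_le_add (Nat.add_le_add h₁ h₂) (key ((Expr.sub e₁ e₂).eval_le_valueBound hs))
  | mul e₁ e₂ h₁ h₂ =>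
    exact Nat.add_le_add (Nat.add_le_add h₁ h₂) (key ((Expr.mul e₁ e₂).eval_le_valueBound hs))
  | div e₁ e₂ h₁ h₂ =>
    exact Nat.add_le_add (Nat.add_le_add h₁ h₂) (key ((Expr.div e₁ e₂).eval_le_valueBound hs))

theorem Expr.polyBounded_valueBound (e : Expr) : PolyBounded id fun B => e.valueBound B := by
  induction e with
  | const c => exact .const _ c
  | var x => exact .self _
  | load a i _ => exact .self _
  | add e₁ e₂ h₁ h₂ => exact h₁.add h₂
  | sub e₁ e₂ h₁ _ => exact h₁
  | mul e₁ e₂ h₁ h₂ => exact h₁.mul h₂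
  | div e₁ e₂ h₁ _ => exact h₁

theorem Expr.polyBounded_costBound (e : Expr) : PolyBounded id fun B => e.costBound B := by
  have one : PolyBounded (id : ℕ → ℕ) fun _ => 1 := .const _ 1
  induction e with
  | const c => exact .const _ (c + 1)
  | var x => exact (PolyBounded.self _).add one
  | load a i h => exact h.add ((PolyBounded.self _).add one)
  | add e₁ e₂ h₁ h₂ =>
    exact (h₁.add h₂).add ((e₁.polyBounded_valueBound.add e₂.polyBounded_valueBound).add one)
  | sub e₁ e₂ h₁ h₂ => exact (h₁.add h₂).add (e₁.polyBounded_valueBound.add one)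
  | mul e₁ e₂ h₁ h₂ =>
    exact (h₁.add h₂).add ((e₁.polyBounded_valueBound.mul e₂.polyBounded_valueBound).add one)
  | div e₁ e₂ h₁ h₂ => exact (h₁.add h₂).add (e₁.polyBounded_valueBound.add one)

/-! ## Total correctness with polynomial running time -/

/-- A predicate transformer: from memory `s`, the program halts in a memory that satisfies `Q`,
every number written is at most `B`, and every loop is run at most `B` times. -/
def Prog.WP (B : ℕ) : Prog → (State → Prop) → State → Prop
  | .skip, Q, s => Q s
  | .assign x e, Q, s => e.eval s ≤ B ∧ Q (s.setReg x (e.eval s))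
  | .store a i e, Q, s => e.eval s ≤ B ∧ Q (s.setArr a (i.eval s) (e.eval s))
  | .seq p q, Q, s => p.WP B (q.WP B Q) s
  | .ite e p q, Q, s => (e.eval s ≠ 0 → p.WP B Q s) ∧ (e.eval s = 0 → q.WP B Q s)
  | .while e p, Q, s => ∃ N ≤ B, ∃ I : ℕ → State → Prop, I 0 s ∧
      (∀ i < N, ∀ s', I i s' → e.eval s' ≠ 0 ∧ p.WP B (I (i + 1)) s') ∧
      ∀ s', I N s' → e.eval s' = 0 ∧ Q s'

/-- A bound for the running time of a program with `WP B`. -/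
def Prog.timeBound (B : ℕ) : Prog → ℕ
  | .skip => 1
  | .assign _ e => e.costBound B + 1
  | .store _ i e => i.costBound B + e.costBound B + 1
  | .seq p q => p.timeBound B + q.timeBound B
  | .ite e p q => e.costBound B + (p.timeBound B + q.timeBound B)
  | .while e p => B * (e.costBound B + p.timeBound B) + e.costBound B

/-- The program is fixed, so the degree may grow with its syntax: each nested loop contributes one
more factor `B`. -/
theorem Prog.polyBounded_timeBound (p : Prog) : PolyBounded id fun B => p.timeBound B := by
  have one : PolyBounded (id : ℕ → ℕ) fun _ => 1 := .const _ 1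
  induction p with
  | skip => exact one
  | assign x e => exact e.polyBounded_costBound.add one
  | store a i e => exact (i.polyBounded_costBound.add e.polyBounded_costBound).add one
  | seq p q hp hq => exact hp.add hq
  | ite e p q hp hq => exact e.polyBounded_costBound.add (hp.add hq)
  | _ e p hp =>
    exact ((PolyBounded.self _).mul (e.polyBounded_costBound.add hp)).add e.polyBounded_costBound

theorem State.BoundedBy.setReg {B : ℕ} {s : State} (hs : s.BoundedBy B) {v : ℕ} (x : ℕ)
    (hv : v ≤ B) : (s.setReg x v).BoundedBy B := by
  refine ⟨fun y => ?_, hs.2⟩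
  by_cases h : y = x
  · subst h; simpa [State.setReg] using hv
  · simpa [State.setReg, h] using hs.1 y

theorem State.BoundedBy.setArr {B : ℕ} {s : State} (hs : s.BoundedBy B) {v : ℕ} (a i : ℕ)
    (hv : v ≤ B) : (s.setArr a i v).BoundedBy B := by
  refine ⟨hs.1, fun b j => ?_⟩
  by_cases h : b = a
  · subst h
    by_cases h' : j = i
    · subst h'; simpa [State.setArr] using hv
    · simpa [State.setArr, h'] using hs.2 b j
  · simpa [State.setArr, h] using hs.2 b j

/-- Soundness of the calculus. Memory stays bounded by `B` because every write is checked against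
`B`; this in turn keeps the cost of each expression below `costBound B`. -/
theorem Prog.WP.exec {B : ℕ} (p : Prog) : ∀ {Q : State → Prop} {s : State}, s.BoundedBy B →
    p.WP B Q s → ∃ s' t, Exec p s s' t ∧ Q s' ∧ s'.BoundedBy B ∧ t ≤ p.timeBound B := by
  induction p with
  | skip => exact fun {Q s} hs h => ⟨s, 1, .skip s, h, hs, le_rfl⟩
  | assign x e =>
    exact fun {Q s} hs h => ⟨_, _, .assign s x e, h.2, hs.setReg x h.1,
      Nat.add_le_add_right (e.cost_le_costBound hs) 1⟩
  | store a i e =>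
    exact fun {Q s} hs h => ⟨_, _, .store s a i e, h.2, hs.setArr a _ h.1,
      Nat.add_le_add_right (Nat.add_le_add (i.cost_le_costBound hs) (e.cost_le_costBound hs)) 1⟩
  | seq p q hp hq =>
    intro Q s hs h
    obtain ⟨s₁, t₁, E₁, h₁, b₁, l₁⟩ := hp hs h
    obtain ⟨s₂, t₂, E₂, h₂, b₂, l₂⟩ := hq b₁ h₁
    exact ⟨s₂, _, .seq E₁ E₂, h₂, b₂, Nat.add_le_add l₁ l₂⟩
  | ite e p q hp hq =>
    intro Q s hs h
    have hc := e.cost_le_costBound hs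
    by_cases he : e.eval s = 0
    · obtain ⟨s₁, t₁, E₁, h₁, b₁, l₁⟩ := hq hs (h.2 he)
      exact ⟨s₁, _, .ite_false he E₁, h₁, b₁, by simp only [Prog.timeBound]; omega⟩
    · obtain ⟨s₁, t₁, E₁, h₁, b₁, l₁⟩ := hp hs (h.1 he)
      exact ⟨s₁, _, .ite_true he E₁, h₁, b₁, by simp only [Prog.timeBound]; omega⟩
  | _ e p hp =>
    intro Q s hs ⟨N, hN, I, h0, hstep, hend⟩
    -- Here `m` is the number of iterations still to come.
    have main : ∀ m i s, i + m = N → s.BoundedBy B → I i s → ∃ s' t,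
        Exec (.while e p) s s' t ∧ Q s' ∧ s'.BoundedBy B ∧
          t ≤ m * (e.costBound B + p.timeBound B) + e.costBound B := by
      intro m
      induction m with
      | zero =>
        intro i s hi hs hI
        obtain rfl : i = N := hi
        obtain ⟨he, hQ⟩ := hend s hI
        exact ⟨s, _, .while_done he, hQ, hs, by have := e.cost_le_costBound hs; omega⟩
      | succ m ih =>
        intro i s hi hs hI
        obtain ⟨he, hb⟩ := hstep i (by omega) s hI
        obtain ⟨s₁, t₁, E₁, h₁, b₁, l₁⟩ := hp hs hb
        obtain ⟨s₂, t₂, E₂, h₂, b₂, l₂⟩ := ih (i + 1) s₁ (by omega) b₁ h₁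
        refine ⟨s₂, _, .while_step he E₁ E₂, h₂, b₂, ?_⟩
        have := e.cost_le_costBound hs
        rw [Nat.succ_mul]; omega
    obtain ⟨s', t, E, hQ, b, l⟩ := main N 0 s (by omega) hs h0
    refine ⟨s', t, E, hQ, b, l.trans ?_⟩
    exact Nat.add_le_add_right (Nat.mul_le_mul_right _ hN) _

theorem Prog.WP.mono {B : ℕ} (p : Prog) : ∀ {Q R : State → Prop} {s : State},
    (∀ s, Q s → R s) → p.WP B Q s → p.WP B R s := by
  induction p with
  | skip => exact fun h hs => h _ hs
  | assign x e => exact fun h hs => ⟨hs.1, h _ hs.2⟩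
  | store a i e => exact fun h hs => ⟨hs.1, h _ hs.2⟩
  | seq p q hp hq => exact fun h hs => hp (fun _ => hq h) hs
  | ite e p q hp hq => exact fun h hs => ⟨fun he => hp h (hs.1 he), fun he => hq h (hs.2 he)⟩
  | _ e p hp =>
    exact fun h ⟨N, hN, I, h0, h1, h2⟩ =>
      ⟨N, hN, I, h0, h1, fun s' hs' => ⟨(h2 s' hs').1, h _ (h2 s' hs').2⟩⟩

/-- Run `p` with register `x` equal to `0`, …, `N - 1`, where `N` is the value of `e`. -/
def Prog.for (x : ℕ) (e : Expr) (p : Prog) : Prog :=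
  .seq (.assign x (.const 0)) (.while (.sub e (.var x))
    (.seq p (.assign x (.add (.var x) (.const 1)))))

/-- The loop test is the truncated difference of `e` and the counter, so the invariant has to
preserve the value `N` of `e`, and the body must hand back the counter unchanged before it is
increased. -/
theorem Prog.WP.for {B N x : ℕ} {e : Expr} {p : Prog} {Q : State → Prop} {s : State}
    (I : ℕ → State → Prop) (hN : N ≤ B) (h0 : I 0 (s.setReg x 0))
    (hI : ∀ i s, I i s → s.reg x = i ∧ e.eval s = N)
    (hstep : ∀ i < N, ∀ s, I i s → p.WP B (fun s' => s'.reg x = i ∧ I (i + 1) (s'.setReg x (i + 1))) s)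
    (hend : ∀ s, I N s → Q s) : (Prog.for x e p).WP B Q s := by
  refine ⟨Nat.zero_le _, N, hN, I, h0, fun i hi s hs => ?_, fun s hs => ?_⟩
  · obtain ⟨h1, h2⟩ := hI i s hs
    refine ⟨by simp only [Expr.eval]; omega, Prog.WP.mono p ?_ (hstep i hi s hs)⟩
    rintro s' ⟨h3, h4⟩
    simp only [Prog.WP, Expr.eval, h3]
    exact ⟨by omega, h4⟩
  · obtain ⟨h1, h2⟩ := hI N s hs
    exact ⟨by simp only [Expr.eval]; omega, hend s hs⟩

/-! ## Programs that leave part of the memory alone -/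

/-- The registers and arrays that a program writes satisfy `R` and `A`. -/
def Prog.WritesOnly (R A : ℕ → Prop) : Prog → Prop
  | .skip => True
  | .assign x _ => R x
  | .store a _ _ => A a
  | .seq p q => p.WritesOnly R A ∧ q.WritesOnly R A
  | .ite _ p q => p.WritesOnly R A ∧ q.WritesOnly R A
  | .while _ p => p.WritesOnly R A

theorem Exec.frame {R A : ℕ → Prop} {p : Prog} {s s' : State} {t : ℕ} (h : Exec p s s' t)
    (hp : p.WritesOnly R A) :
    (∀ x, ¬ R x → s'.reg x = s.reg x) ∧ ∀ a, ¬ A a → s'.arr a = s.arr a := by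
  induction h with
  | skip s => exact ⟨fun _ _ => rfl, fun _ _ => rfl⟩
  | assign s x e =>
    refine ⟨fun y hy => ?_, fun _ _ => rfl⟩
    have : y ≠ x := fun h => hy (h ▸ hp)
    simp [State.setReg, this]
  | store s a i e =>
    refine ⟨fun _ _ => rfl, fun b hb => ?_⟩
    have : b ≠ a := fun h => hb (h ▸ hp)
    simp [State.setArr, this]
  | seq _ _ h₁ h₂ =>
    obtain ⟨a, b⟩ := h₁ hp.1
    obtain ⟨c, d⟩ := h₂ hp.2
    exact ⟨fun x hx => (c x hx).trans (a x hx), fun x hx => (d x hx).trans (b x hx)⟩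
  | ite_true _ _ h => exact h hp.1
  | ite_false _ _ h => exact h hp.2
  | while_done _ => exact ⟨fun _ _ => rfl, fun _ _ => rfl⟩
  | while_step _ _ _ h₁ h₂ =>
    obtain ⟨a, b⟩ := h₁ hp
    obtain ⟨c, d⟩ := h₂ hp
    exact ⟨fun x hx => (c x hx).trans (a x hx), fun x hx => (d x hx).trans (b x hx)⟩

/-! ## Renaming registers and arrays -/

/-- Rename registers along `ρ` and arrays along `σ`. -/
def Expr.rename (ρ σ : ℕ → ℕ) : Expr → Expr
  | .const c => .const c
  | .var x => .var (ρ x)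
  | .load a i => .load (σ a) (i.rename ρ σ)
  | .add e₁ e₂ => .add (e₁.rename ρ σ) (e₂.rename ρ σ)
  | .sub e₁ e₂ => .sub (e₁.rename ρ σ) (e₂.rename ρ σ)
  | .mul e₁ e₂ => .mul (e₁.rename ρ σ) (e₂.rename ρ σ)
  | .div e₁ e₂ => .div (e₁.rename ρ σ) (e₂.rename ρ σ)

/-- Rename registers along `ρ` and arrays along `σ`. -/
def Prog.rename (ρ σ : ℕ → ℕ) : Prog → Prog
  | .skip => .skip
  | .assign x e => .assign (ρ x) (e.rename ρ σ)
  | .store a i e => .store (σ a) (i.rename ρ σ) (e.rename ρ σ)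
  | .seq p q => .seq (p.rename ρ σ) (q.rename ρ σ)
  | .ite e p q => .ite (e.rename ρ σ) (p.rename ρ σ) (q.rename ρ σ)
  | .while e p => .while (e.rename ρ σ) (p.rename ρ σ)

/-- The memory that is seen through the renaming. -/
def State.restrict (ρ σ : ℕ → ℕ) (s : State) : State where
  reg x := s.reg (ρ x)
  arr a := s.arr (σ a)

theorem Expr.eval_rename (ρ σ : ℕ → ℕ) (s : State) (e : Expr) :
    (e.rename ρ σ).eval s = e.eval (s.restrict ρ σ) := by
  induction e <;> simp_all [Expr.rename, Expr.eval, State.restrict]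

theorem Expr.cost_rename (ρ σ : ℕ → ℕ) (s : State) (e : Expr) :
    (e.rename ρ σ).cost s = e.cost (s.restrict ρ σ) := by
  induction e <;> simp_all [Expr.rename, Expr.cost, Expr.eval_rename, State.restrict]

theorem State.restrict_setReg {ρ : ℕ → ℕ} (hρ : ρ.Injective) (σ : ℕ → ℕ) (s : State) (x v : ℕ) :
    (s.setReg (ρ x) v).restrict ρ σ = (s.restrict ρ σ).setReg x v := by
  simp only [State.restrict, State.setReg, State.mk.injEq, and_true]
  funext y
  by_cases h : y = x
  · simp [h]
  · simp [h, hρ.ne h]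

theorem State.restrict_setArr (ρ : ℕ → ℕ) {σ : ℕ → ℕ} (hσ : σ.Injective) (s : State) (a i v : ℕ) :
    (s.setArr (σ a) i v).restrict ρ σ = (s.restrict ρ σ).setArr a i v := by
  simp only [State.restrict, State.setArr, State.mk.injEq, true_and]
  funext b
  by_cases h : b = a
  · simp [h]
  · simp [h, hσ.ne h]

/-- The charge depends on contents and on indices inside arrays, never on the names of registers and
arrays. So the renamed program takes exactly the same time, whatever the rest of the memory
contains. -/
theorem Exec.rename {ρ σ : ℕ → ℕ} (hρ : ρ.Injective) (hσ : σ.Injective) {p : Prog} {s s' : State}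
    {t : ℕ} (h : Exec p s s' t) : ∀ u : State, u.restrict ρ σ = s →
      ∃ u', Exec (p.rename ρ σ) u u' t ∧ u'.restrict ρ σ = s' := by
  induction h with
  | skip s => exact fun u hu => ⟨u, .skip u, hu⟩
  | assign s x e =>
    rintro u rfl
    refine ⟨_, ?_, State.restrict_setReg hρ σ u x _⟩
    rw [← Expr.eval_rename, ← Expr.cost_rename]
    exact .assign u _ _
  | store s a i e =>
    rintro u rfl
    refine ⟨_, ?_, State.restrict_setArr ρ hσ u a _ _⟩
    rw [← Expr.eval_rename, ← Expr.cost_rename, ← Expr.eval_rename, ← Expr.cost_rename]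
    exact .store u _ _ _
  | seq _ _ h₁ h₂ =>
    intro u hu
    obtain ⟨u₁, E₁, hu₁⟩ := h₁ u hu
    obtain ⟨u₂, E₂, hu₂⟩ := h₂ u₁ hu₁
    exact ⟨u₂, .seq E₁ E₂, hu₂⟩
  | ite_true he _ h =>
    rintro u rfl
    obtain ⟨u₁, E₁, hu₁⟩ := h u rfl
    rw [← Expr.eval_rename] at he
    rw [← Expr.cost_rename]
    exact ⟨u₁, .ite_true he E₁, hu₁⟩
  | ite_false he _ h =>
    rintro u rfl
    obtain ⟨u₁, E₁, hu₁⟩ := h u rfl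
    rw [← Expr.eval_rename] at he
    rw [← Expr.cost_rename]
    exact ⟨u₁, .ite_false he E₁, hu₁⟩
  | while_done he =>
    rintro u rfl
    rw [← Expr.eval_rename] at he
    rw [← Expr.cost_rename]
    exact ⟨u, .while_done he, rfl⟩
  | while_step he _ _ h₁ h₂ =>
    rintro u rfl
    obtain ⟨u₁, E₁, hu₁⟩ := h₁ u rfl
    obtain ⟨u₂, E₂, hu₂⟩ := h₂ u₁ hu₁
    rw [← Expr.eval_rename] at he
    rw [← Expr.cost_rename]
    exact ⟨u₂, .while_step he E₁ E₂, hu₂⟩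

end RAM

/-! ## Rainbow walks of tokens and tight paths -/

/-- The elements of the sets of an Exact Cover instance, listed set after set.  Token `t < T` is
labelled by the element `lab t`, and `fst t ≠ 0` if a set starts at `t`. -/
structure TokenSystem where
  d : ℕ
  n : ℕ
  T : ℕ
  lab : ℕ → ℕ
  fst : ℕ → ℕ

namespace TokenSystem

/-- Token `t'` may follow token `t`. -/
def Link (S : TokenSystem) (t t' : ℕ) : Prop :=
  (S.fst t' = 0 ∧ t' = t + 1) ∨ (S.fst t' ≠ 0 ∧ S.fst (t + 1) ≠ 0)

/-- The positions of a walk that carry tokens; the other ones are padding. -/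
def Real (S : TokenSystem) (g : ℕ) : Prop := 4 * S.d ≤ g ∧ g < 4 * S.d + S.n

/-- There is a walk of `n` tokens with distinct labels. -/
def HasWalk (S : TokenSystem) : Prop :=
  ∃ τ : ℕ → ℕ, (∀ g, S.Real g → τ g < S.T) ∧ (∀ g, ¬ S.Real g → τ g = S.T) ∧
    (∀ g, S.Link (τ g) (τ (g + 1))) ∧
    ∀ g g', S.Real g → S.Real g' → S.lab (τ g) = S.lab (τ g') → g = g'

/-- The number of state nodes of the intended path. -/
def J (S : TokenSystem) : ℕ := S.n / S.d + 8

/-- The base in which sequences of tokens are encoded; the digit `T` stands for padding. -/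
def U (S : TokenSystem) : ℕ := S.T + 1

/-- The number of element nodes. -/
def E (S : TokenSystem) : ℕ := S.n + (S.J + 1) * S.d

/-- The number of state nodes. -/
def Q (S : TokenSystem) : ℕ := S.J * S.U ^ (2 * S.d)

/-- The number of nodes of the intended path. -/
def k (S : TokenSystem) : ℕ := (S.J + 1) * (S.d + 1) - 1

/-- Digit `i` of the code `c`. -/
def dig (S : TokenSystem) (c i : ℕ) : ℕ := c / S.U ^ i % S.U

/-- The number of the block in front of state `q`. -/
def time (S : TokenSystem) (q : ℕ) : ℕ := q / S.U ^ (2 * S.d)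

/-- The code of the tokens in the two blocks around state `q`. -/
def code (S : TokenSystem) (q : ℕ) : ℕ := q % S.U ^ (2 * S.d)

/-- Token `i` of the two blocks around state `q`. -/
def tok (S : TokenSystem) (q i : ℕ) : ℕ := S.dig (S.code q) i

/-- The element node at position `g` if the token there is `t`. -/
def elem (S : TokenSystem) (g t : ℕ) : ℕ := if t < S.T then S.lab t else S.n + g

/-- Element node `i` of the two blocks around state `q`. -/
def el (S : TokenSystem) (q i : ℕ) : ℕ := S.elem (S.time q * S.d + i) (S.tok q i)

/-- The two blocks around state `q` are part of a rainbow walk. -/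
def Valid (S : TokenSystem) (q : ℕ) : Prop :=
  q < S.Q ∧ (∀ i < 2 * S.d, (S.Real (S.time q * S.d + i) ↔ S.tok q i < S.T)) ∧
    (∀ i, i + 1 < 2 * S.d → S.Link (S.tok q i) (S.tok q (i + 1))) ∧
    ∀ i < 2 * S.d, ∀ i' < i, S.el q i ≠ S.el q i'

/-- The state after `q` whose second block has the code `a`. -/
def next (S : TokenSystem) (q a : ℕ) : ℕ :=
  (S.time q + 1) * S.U ^ (2 * S.d) + (S.code q / S.U ^ S.d + a * S.U ^ S.d)

/-- The hyperedges that contain the state `q` only. -/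
def edge₁ (S : TokenSystem) (q u : ℕ) : List ℕ :=
  (S.E + q) :: (List.range (S.d + 1)).map fun i => S.el q (u + i)

/-- The hyperedges that contain two states. -/
def edge₂ (S : TokenSystem) (q a : ℕ) : List ℕ :=
  (S.E + q) :: (S.E + S.next q a) :: (List.range S.d).map fun i => S.el q (S.d + i)

open Classical in
/-- The hyperedges that belong to state `q` and the code `a` of the block after next. -/
noncomputable def edgesNext (S : TokenSystem) (q a : ℕ) : List (List ℕ) :=
  if S.Valid (S.next q a) then [S.edge₂ q a] else []

open Classical in
/-- The hyperedges that belong to state `q`. -/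
noncomputable def edgesAt (S : TokenSystem) (q : ℕ) : List (List ℕ) :=
  if S.Valid q then
    (List.range S.d).map (S.edge₁ q) ++ (List.range (S.U ^ S.d)).flatMap (S.edgesNext q)
  else []

/-- All hyperedges. -/
noncomputable def edges (S : TokenSystem) : List (List ℕ) :=
  (List.range S.Q).flatMap S.edgesAt

/-- The sequence `f 0, …, f (k - 1)` is a tight path. -/
def IsPath (S : TokenSystem) (f : ℕ → ℕ) : Prop :=
  (∀ x < S.k, ∀ y < S.k, f x = f y → x = y) ∧
    ∀ i, i + (S.d + 2) ≤ S.k → ∃ e ∈ S.edges, (Finset.Ico i (i + (S.d + 2))).image f = e.toFinset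

variable {S : TokenSystem}

theorem mem_edges {e : List ℕ} : e ∈ S.edges ↔
    (∃ q u, S.Valid q ∧ u < S.d ∧ e = S.edge₁ q u) ∨
    ∃ q a, S.Valid q ∧ a < S.U ^ S.d ∧ S.Valid (S.next q a) ∧ e = S.edge₂ q a := by
  simp only [edges, edgesAt, List.mem_flatMap, List.mem_range]
  constructor
  · rintro ⟨q, hq, he⟩
    split_ifs at he with hv
    · rcases List.mem_append.1 he with he | he
      · obtain ⟨u, hu, rfl⟩ := List.mem_map.1 he
        exact .inl ⟨q, u, hv, List.mem_range.1 hu, rfl⟩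
      · obtain ⟨a, ha, he⟩ := List.mem_flatMap.1 he
        rw [edgesNext] at he
        split_ifs at he with hv'
        · exact .inr ⟨q, a, hv, List.mem_range.1 ha, hv', List.mem_singleton.1 he⟩
        · simp at he
    · simp at he
  · rintro (⟨q, u, hv, hu, rfl⟩ | ⟨q, a, hv, ha, hv', rfl⟩)
    · refine ⟨q, hv.1, ?_⟩
      rw [if_pos hv]
      exact List.mem_append_left _ (List.mem_map_of_mem (List.mem_range.2 hu))
    · refine ⟨q, hv.1, ?_⟩
      rw [if_pos hv]
      refine List.mem_append_right _ (List.mem_flatMap.2 ⟨a, List.mem_range.2 ha, ?_⟩)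
      rw [edgesNext, if_pos hv']
      exact List.mem_singleton_self _

/-! ### Digits, codes and times of states -/

theorem U_pos : 0 < S.U := Nat.succ_pos _

theorem dig_le (c i : ℕ) : S.dig c i ≤ S.T := Nat.le_of_lt_succ (Nat.mod_lt _ U_pos)

theorem tok_le (q i : ℕ) : S.tok q i ≤ S.T := dig_le _ _

theorem code_lt (q : ℕ) : S.code q < S.U ^ (2 * S.d) := Nat.mod_lt _ (pow_pos U_pos _)

theorem time_mul_add {j c : ℕ} (hc : c < S.U ^ (2 * S.d)) :
    S.time (j * S.U ^ (2 * S.d) + c) = j := by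
  rw [time, mul_comm, Nat.mul_add_div (pow_pos U_pos _), Nat.div_eq_of_lt hc, add_zero]

theorem code_mul_add {j c : ℕ} (hc : c < S.U ^ (2 * S.d)) :
    S.code (j * S.U ^ (2 * S.d) + c) = c := by
  rw [code, mul_comm, Nat.mul_add_mod, Nat.mod_eq_of_lt hc]

theorem next_code_lt {q a : ℕ} (ha : a < S.U ^ S.d) :
    S.code q / S.U ^ S.d + a * S.U ^ S.d < S.U ^ (2 * S.d) := by
  have h1 : S.U ^ (2 * S.d) = S.U ^ S.d * S.U ^ S.d := by rw [two_mul, pow_add]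
  have h2 : S.code q / S.U ^ S.d < S.U ^ S.d := by
    rw [Nat.div_lt_iff_lt_mul (pow_pos U_pos _), ← h1]
    exact code_lt q
  rw [h1]; nlinarith

theorem time_next {q a : ℕ} (ha : a < S.U ^ S.d) : S.time (S.next q a) = S.time q + 1 :=
  time_mul_add (next_code_lt ha)

theorem dig_mod {c m i : ℕ} (hi : i < m) : S.dig (c % S.U ^ m) i = S.dig c i := by
  obtain ⟨m, rfl⟩ : ∃ l, m = i + (l + 1) := ⟨m - i - 1, by omega⟩
  rw [dig, dig, pow_add, Nat.mod_mul_right_div_self, pow_succ, Nat.mod_mul_left_mod]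

theorem dig_div {c m i : ℕ} : S.dig (c / S.U ^ m) i = S.dig c (m + i) := by
  rw [dig, dig, Nat.div_div_eq_div_mul, ← pow_add]

/-- Dividing the code by `U ^ d` drops the first block and moves the second one into its place; the
summand `a * U ^ d` affects the higher digits only. -/
theorem tok_next {q a i : ℕ} (ha : a < S.U ^ S.d) (hi : i < S.d) :
    S.tok (S.next q a) i = S.tok q (S.d + i) := by
  rw [tok, next, code_mul_add (next_code_lt ha), tok, ← dig_div, ← dig_mod hi,
    Nat.add_mul_mod_self_right, dig_mod hi]

theorem time_lt {q : ℕ} (hq : S.Valid q) : S.time q < S.J := by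
  have := hq.1
  rw [Q] at this
  exact (Nat.div_lt_iff_lt_mul (pow_pos U_pos _)).2 this

theorem elem_lt (hlab : ∀ t < S.T, S.lab t < S.n) {g t : ℕ} (hg : g < (S.J + 1) * S.d) :
    S.elem g t < S.E := by
  unfold elem E
  split_ifs with h
  · have := hlab t h; omega
  · omega

theorem el_lt (hlab : ∀ t < S.T, S.lab t < S.n) {q i : ℕ} (hq : S.Valid q) (hi : i < 2 * S.d) :
    S.el q i < S.E := by
  refine elem_lt hlab ?_
  have := time_lt hq
  calc S.time q * S.d + i < S.time q * S.d + 2 * S.d := by omega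
    _ = (S.time q + 2) * S.d := by ring
    _ ≤ _ := Nat.mul_le_mul_right _ (by omega)

theorem el_injective {q i i' : ℕ} (hq : S.Valid q) (hi : i < 2 * S.d) (hi' : i' < 2 * S.d)
    (h : S.el q i = S.el q i') : i = i' := by
  rcases lt_trichotomy i i' with h1 | h1 | h1
  · exact absurd h.symm (hq.2.2.2 i' hi' i h1)
  · exact h1
  · exact absurd h (hq.2.2.2 i hi i' h1)

/-! ### Tight paths give walks -/

/-- State `q'` may follow state `q` on a path. -/
def Succ (S : TokenSystem) (q q' : ℕ) : Prop :=
  S.Valid q ∧ S.Valid q' ∧ S.time q' = S.time q + 1 ∧ ∀ i < S.d, S.tok q' i = S.tok q (S.d + i)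

theorem Succ.el_eq {q q' i : ℕ} (h : S.Succ q q') (hi : i < S.d) :
    S.el q' i = S.el q (S.d + i) := by
  rw [el, el, h.2.2.2 i hi, h.2.2.1]; congr 1; ring

section Path

variable {f : ℕ → ℕ}

/-- The window of a path that starts at position `i`. -/
def win (S : TokenSystem) (f : ℕ → ℕ) (i : ℕ) : Finset ℕ := (Finset.Ico i (i + (S.d + 2))).image f

theorem mem_win {i y : ℕ} : y ∈ S.win f i ↔ ∃ x, i ≤ x ∧ x ≤ i + S.d + 1 ∧ f x = y := by
  simp only [win, Finset.mem_image, Finset.mem_Ico]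
  constructor
  · rintro ⟨x, ⟨h1, h2⟩, h3⟩; exact ⟨x, h1, by omega, h3⟩
  · rintro ⟨x, h1, h2, h3⟩; exact ⟨x, ⟨h1, by omega⟩, h3⟩

/-- The nodes of the second block of `q` and the states `q` and `q'`. -/
def pairSet (S : TokenSystem) (q q' : ℕ) : Finset ℕ :=
  insert (S.E + q) (insert (S.E + q') ((Finset.range S.d).image fun i => S.el q (S.d + i)))

theorem IsPath.window (hf : S.IsPath f) {i : ℕ} (hi : i + (S.d + 2) ≤ S.k) :
    (∃ q u, S.Valid q ∧ u < S.d ∧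
      S.win f i = insert (S.E + q) ((Finset.range (S.d + 1)).image fun i => S.el q (u + i))) ∨
    ∃ q q', S.Succ q q' ∧ S.win f i = S.pairSet q q' := by
  obtain ⟨e, he, hw⟩ := hf.2 i hi
  rw [← win] at hw
  rcases mem_edges.1 he with ⟨q, u, hv, hu, rfl⟩ | ⟨q, a, hv, ha, hv', rfl⟩
  · refine .inl ⟨q, u, hv, hu, hw.trans ?_⟩
    ext y; simp [edge₁]
  · refine .inr ⟨q, S.next q a, ⟨hv, hv', time_next ha, fun i hi => tok_next ha hi⟩, hw.trans ?_⟩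
    ext y; simp [edge₂, pairSet]

theorem IsPath.exists_state (hf : S.IsPath f) {i : ℕ} (hi : i + (S.d + 2) ≤ S.k) :
    ∃ x, i ≤ x ∧ x ≤ i + S.d + 1 ∧ S.E ≤ f x := by
  have : ∃ q, S.E + q ∈ S.win f i := by
    rcases hf.window hi with ⟨q, u, _, _, h⟩ | ⟨q, q', _, h⟩
    · exact ⟨q, by simp [h]⟩
    · exact ⟨q, by simp [h, pairSet]⟩
  obtain ⟨q, hq⟩ := this
  obtain ⟨x, h1, h2, h3⟩ := mem_win.1 hq
  exact ⟨x, h1, h2, by omega⟩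

/-- In both kinds of hyperedges every element node belongs to the two blocks of every state present.
With two states this is because the shared block is the second one of the earlier and the first one
of the later state. -/
theorem IsPath.exists_el (hlab : ∀ t < S.T, S.lab t < S.n) (hf : S.IsPath f) {i a b : ℕ}
    (hi : i + (S.d + 2) ≤ S.k) (ha : i ≤ a) (ha' : a ≤ i + S.d + 1) (hb : i ≤ b)
    (hb' : b ≤ i + S.d + 1) (hsa : S.E ≤ f a) (hsb : f b < S.E) :
    ∃ i' < 2 * S.d, f b = S.el (f a - S.E) i' := by
  have h1 : f a ∈ S.win f i := mem_win.2 ⟨a, ha, ha', rfl⟩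
  have h2 : f b ∈ S.win f i := mem_win.2 ⟨b, hb, hb', rfl⟩
  rcases hf.window hi with ⟨q, u, hv, hu, h⟩ | ⟨q, q', hs, h⟩
  · rw [h, Finset.mem_insert, Finset.mem_image] at h1 h2
    have hlt : ∀ l ∈ Finset.range (S.d + 1), S.el q (u + l) < S.E := fun l hl =>
      el_lt hlab hv (by have := Finset.mem_range.1 hl; omega)
    rcases h1 with h1 | ⟨l, hl, h1⟩
    · rcases h2 with h2 | ⟨l, hl, h2⟩
      · omega
      · refine ⟨u + l, by have := Finset.mem_range.1 hl; omega, ?_⟩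
        rw [← h2, h1, Nat.add_sub_cancel_left]
    · have := hlt l hl; omega
  · simp only [h, pairSet, Finset.mem_insert, Finset.mem_image, Finset.mem_range] at h1 h2
    rcases h2 with h2 | h2 | ⟨l, hl, h2⟩
    · omega
    · omega
    · rcases h1 with h1 | h1 | ⟨l', hl', h1⟩
      · exact ⟨S.d + l, by omega, by rw [← h2, h1, Nat.add_sub_cancel_left]⟩
      · exact ⟨l, by omega, by rw [← h2, h1, Nat.add_sub_cancel_left, hs.el_eq hl]⟩
      · have := el_lt hlab hs.1 (show S.d + l' < 2 * S.d by omega); omega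

/-- A window with two states can only be a hyperedge of the second kind. Hyperedges are unordered,
so time may run either way along the path. -/
theorem IsPath.pair (hlab : ∀ t < S.T, S.lab t < S.n) (hf : S.IsPath f) {i a b : ℕ}
    (hi : i + (S.d + 2) ≤ S.k) (ha : i ≤ a) (hab : a < b)
    (hb' : b ≤ i + S.d + 1) (hsa : S.E ≤ f a) (hsb : S.E ≤ f b) :
    (S.Succ (f a - S.E) (f b - S.E) ∧ S.win f i = S.pairSet (f a - S.E) (f b - S.E)) ∨
    (S.Succ (f b - S.E) (f a - S.E) ∧ S.win f i = S.pairSet (f b - S.E) (f a - S.E)) := by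
  have h1 : f a ∈ S.win f i := mem_win.2 ⟨a, ha, by omega, rfl⟩
  have h2 : f b ∈ S.win f i := mem_win.2 ⟨b, by omega, hb', rfl⟩
  have hne : f a ≠ f b := fun h => by have := hf.1 a (by omega) b (by omega) h; omega
  rcases hf.window hi with ⟨q, u, hv, hu, h⟩ | ⟨q, q', hs, h⟩
  · rw [h, Finset.mem_insert, Finset.mem_image] at h1 h2
    have hlt : ∀ l ∈ Finset.range (S.d + 1), S.el q (u + l) < S.E := fun l hl =>
      el_lt hlab hv (by have := Finset.mem_range.1 hl; omega)
    rcases h1 with h1 | ⟨l, hl, h1⟩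
    · rcases h2 with h2 | ⟨l, hl, h2⟩
      · omega
      · have := hlt l hl; omega
    · have := hlt l hl; omega
  · have hlt : ∀ l < S.d, S.el q (S.d + l) < S.E := fun l hl => el_lt hlab hs.1 (by omega)
    have key : ∀ y ∈ S.win f i, S.E ≤ y → y = S.E + q ∨ y = S.E + q' := by
      intro y hy hy'
      simp only [h, pairSet, Finset.mem_insert, Finset.mem_image, Finset.mem_range] at hy
      rcases hy with hy | hy | ⟨l, hl, hy⟩
      · exact .inl hy
      · exact .inr hy
      · have := hlt l hl; omega
    rcases key _ h1 hsa with e1 | e1 <;> rcases key _ h2 hsb with e2 | e2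
    · omega
    · left; rw [e1, e2, Nat.add_sub_cancel_left, Nat.add_sub_cancel_left]; exact ⟨hs, h⟩
    · right; rw [e1, e2, Nat.add_sub_cancel_left, Nat.add_sub_cancel_left]; exact ⟨hs, h⟩
    · omega

/-- Two close states would lie in two consecutive windows. Two states determine the hyperedge
containing both, so these windows would coincide. -/
theorem IsPath.states_far (hlab : ∀ t < S.T, S.lab t < S.n) (hf : S.IsPath f) {a b : ℕ}
    (ha : 1 ≤ a) (hab : a < b) (hb : b ≤ a + S.d) (hbk : b + 2 ≤ S.k) (hk : S.d + 3 ≤ S.k)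
    (hsa : S.E ≤ f a) : f b < S.E := by
  by_contra hsb
  push Not at hsb
  -- Windows `i` and `i + 1` both contain `a` and `b`. They exist because `a` is not the first and
  -- `b` not the last position: take `i = a - 1`, or the last admissible `i` if that is too far
  -- right.
  obtain ⟨i, h1, h2, h3⟩ : ∃ i, i + 1 ≤ a ∧ b ≤ i + S.d + 1 ∧ i + 1 + (S.d + 2) ≤ S.k := by
    rcases le_total (a - 1) (S.k - (S.d + 3)) with h | h
    · exact ⟨a - 1, by omega, by omega, by omega⟩
    · exact ⟨S.k - (S.d + 3), by omega, by omega, by omega⟩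
  have hw : S.win f i = S.win f (i + 1) := by
    rcases hf.pair hlab (i := i) (by omega) (by omega) hab (by omega) hsa hsb with
      ⟨p, h⟩ | ⟨p, h⟩ <;>
    rcases hf.pair hlab (i := i + 1) (by omega) (by omega) hab (by omega) hsa hsb with
      ⟨p', h'⟩ | ⟨p', h'⟩
    -- The order of the two states within the hyperedge is fixed by their times, so the mixed cases
    -- are impossible.
    · rw [h, h']
    · have := p.2.2.1; have := p'.2.2.1; omega
    · have := p.2.2.1; have := p'.2.2.1; omega
    · rw [h, h']
  have : f i ∈ S.win f (i + 1) := hw ▸ mem_win.2 ⟨i, le_rfl, by omega, rfl⟩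
  obtain ⟨x, h4, h5, h6⟩ := mem_win.1 this
  have := hf.1 x (by omega) i (by omega) h6
  omega

/-- By `states_far` the next state comes no earlier than `a + d + 1`, and since every window
contains a state, no later than `a + d + 2`. The latter would surround it by more element nodes than
its two blocks have. -/
theorem IsPath.next_state (hlab : ∀ t < S.T, S.lab t < S.n) (hf : S.IsPath f) {a : ℕ}
    (ha : 1 ≤ a) (hak : a + 2 * S.d + 4 ≤ S.k) (hsa : S.E ≤ f a) : S.E ≤ f (a + S.d + 1) := by
  by_contra hn
  push Not at hn
  have hfar : ∀ x, a < x → x < a + S.d + 2 → f x < S.E := by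
    intro x h1 h2
    rcases Nat.lt_or_ge x (a + S.d + 1) with h | h
    · exact hf.states_far hlab ha h1 (by omega) (by omega) (by omega) hsa
    · obtain rfl : x = a + S.d + 1 := by omega
      exact hn
  obtain ⟨b, hb1, hb2, hsb⟩ := hf.exists_state (i := a + 1) (by omega)
  obtain rfl : b = a + S.d + 2 := by
    by_contra h
    have := hfar b (by omega) (by omega); omega
  have hfar' : ∀ x, a + S.d + 2 < x → x ≤ a + S.d + 2 + S.d → f x < S.E := fun x h1 h2 =>
    hf.states_far hlab (a := a + S.d + 2) (by omega) h1 (by omega) (by omega) (by omega) hsb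
  -- The `d + 1` positions in front of the state at `a + d + 2` and the `d` positions after it. Each
  -- shares a window with that state, so `f` maps `P` injectively into its at most `2 * d` element
  -- nodes.
  set P := Finset.Ico (a + 1) (a + S.d + 2) ∪ Finset.Ico (a + S.d + 3) (a + 2 * S.d + 3) with hP
  have hcard : P.card = 2 * S.d + 1 := by
    rw [hP, Finset.card_union_of_disjoint, Nat.card_Ico, Nat.card_Ico]
    · omega
    · rw [Finset.disjoint_left]
      intro x h1 h2
      simp only [Finset.mem_Ico] at h1 h2
      omega
  have hle : P.card ≤ ((Finset.range (2 * S.d)).image (S.el (f (a + S.d + 2) - S.E))).card := by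
    refine Finset.card_le_card_of_injOn f (fun x hx => ?_) (fun x hx y hy h => ?_)
    · have hx' : x ∈ P := hx
      simp only [hP, Finset.mem_union, Finset.mem_Ico] at hx'
      have : ∃ i' < 2 * S.d, f x = S.el (f (a + S.d + 2) - S.E) i' := by
        rcases hx' with ⟨h1, h2⟩ | ⟨h1, h2⟩
        · exact hf.exists_el hlab (i := a + 1) (by omega) (by omega) (by omega) (by omega)
            (by omega) hsb (hfar x (by omega) h2)
        · exact hf.exists_el hlab (i := a + S.d + 2) (by omega) (by omega) (by omega) (by omega)
            (by omega) hsb (hfar' x (by omega) (by omega))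
      obtain ⟨i', hi', h⟩ := this
      simp only [Finset.coe_image, Set.mem_image, Finset.mem_coe, Finset.mem_range]
      exact ⟨i', hi', h.symm⟩
    · have hx' : x ∈ P := hx
      have hy' : y ∈ P := hy
      simp only [hP, Finset.mem_union, Finset.mem_Ico] at hx' hy'
      exact hf.1 x (by omega) y (by omega) h
  have := Finset.card_image_le (s := Finset.range (2 * S.d)) (f := S.el (f (a + S.d + 2) - S.E))
  rw [Finset.card_range] at this
  omega

end Path

end TokenSystem

namespace TokenSystem

variable {S : TokenSystem}

/-! ### Reading the walk off a path -/

theorem k_eq : S.k = S.n / S.d * (S.d + 1) + 9 * S.d + 8 := by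
  rw [k, J]
  have : (S.n / S.d + 8 + 1) * (S.d + 1) = S.n / S.d * (S.d + 1) + 9 * S.d + 9 := by ring
  omega

theorem real_lt (hd : 1 ≤ S.d) {g : ℕ} (hg : S.Real g) : g + 1 < (S.J - 3) * S.d := by
  have h1 : S.n < S.n / S.d * S.d + S.d := Nat.lt_div_mul_add hd
  have h2 : (S.J - 3) * S.d = S.n / S.d * S.d + 5 * S.d := by
    rw [show S.J - 3 = S.n / S.d + 5 from rfl]; ring
  have := hg.2
  omega

section Path

variable {f : ℕ → ℕ}

theorem Succ.el_lt (hlab : ∀ t < S.T, S.lab t < S.n) {q q' i : ℕ} (h : S.Succ q q')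
    (hi : i < S.d) : S.el q (S.d + i) < S.E :=
  TokenSystem.el_lt hlab h.1 (by omega)

/-- Between two consecutive states of a path there is the block that they share. -/
theorem exists_between (hlab : ∀ t < S.T, S.lab t < S.n) {a i q q' : ℕ} (hi : i < S.d)
    (h : S.Succ q q') (hw : S.win f a = S.pairSet q q') (ha : S.E ≤ f a)
    (ha' : S.E ≤ f (a + S.d + 1)) : ∃ x, a < x ∧ x < a + S.d + 1 ∧ f x = S.el q (S.d + i) := by
  have hmem : S.el q (S.d + i) ∈ S.win f a := by
    simp only [hw, pairSet, Finset.mem_insert, Finset.mem_image, Finset.mem_range]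
    exact .inr (.inr ⟨i, hi, rfl⟩)
  obtain ⟨x, h1, h2, h3⟩ := mem_win.1 hmem
  have hlt := h.el_lt hlab hi
  refine ⟨x, lt_of_le_of_ne h1 ?_, lt_of_le_of_ne h2 ?_, h3⟩
  · rintro rfl; omega
  · rintro rfl; omega

/-- The states of a path visit all times but the first and last few ones, in order or in reverse
order. -/
theorem IsPath.exists_states (hd : 1 ≤ S.d) (hlab : ∀ t < S.T, S.lab t < S.n) (hf : S.IsPath f) :
    ∃ (σ p : ℕ → ℕ), (∀ j, 3 ≤ j → j + 4 ≤ S.J → S.Valid (σ j) ∧ S.time (σ j) = j) ∧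
      (∀ j, 3 ≤ j → j + 5 ≤ S.J → S.Succ (σ j) (σ (j + 1))) ∧
      (∀ j, 3 ≤ j → j + 5 ≤ S.J → ∀ i < S.d, ∃ x < S.k, p x = j ∧ f x = S.el (σ j) (S.d + i)) := by
  have hk := k_eq (S := S)
  have hJ : 8 ≤ S.J := Nat.le_add_left _ _
  -- The search starts at position `1`, since `next_state` excludes the first node of the path.
  obtain ⟨a, ha1, ha2, hsa⟩ := hf.exists_state (i := 1)
    (by have := Nat.zero_le (S.n / S.d * (S.d + 1)); omega)
  set A : ℕ → ℕ := fun i => a + i * (S.d + 1) with hA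
  have hA1 : ∀ i, A (i + 1) = A i + S.d + 1 := fun i => by simp only [hA]; ring
  have hAle : ∀ i, i + 4 ≤ S.J → A i + 3 * S.d + 5 ≤ S.k + S.d + 1 := by
    intro i hi
    have h1 : i * (S.d + 1) ≤ (S.n / S.d + 4) * (S.d + 1) :=
      Nat.mul_le_mul_right _ (by rw [J] at hi; generalize S.n / S.d = N at hi ⊢; omega)
    have h2 : (S.n / S.d + 4) * (S.d + 1) = S.n / S.d * (S.d + 1) + 4 * S.d + 4 := by ring
    simp only [hA]; omega
  have hst : ∀ i, i + 4 ≤ S.J → S.E ≤ f (A i) := by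
    intro i
    induction i with
    | zero => intro _; simpa [hA] using hsa
    | succ i ih =>
      intro hi
      rw [hA1]
      have := hAle (i + 1) hi
      have := hA1 i
      exact hf.next_state hlab (by simp only [hA]; omega) (by omega) (ih (by omega))
  set q : ℕ → ℕ := fun i => f (A i) - S.E with hq
  have hpair : ∀ i, i + 5 ≤ S.J →
      (S.Succ (q i) (q (i + 1)) ∧ S.win f (A i) = S.pairSet (q i) (q (i + 1))) ∨
      (S.Succ (q (i + 1)) (q i) ∧ S.win f (A i) = S.pairSet (q (i + 1)) (q i)) := by
    intro i hi
    have h1 := hAle (i + 1) (by omega)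
    have h2 := hA1 i
    exact hf.pair hlab (i := A i) (by omega) le_rfl (by omega) (by omega) (hst i (by omega))
      (hst (i + 1) (by omega))
  have hbet : ∀ i, i + 5 ≤ S.J → ∀ q₁ q₂, S.Succ q₁ q₂ → S.win f (A i) = S.pairSet q₁ q₂ →
      ∀ l < S.d, ∃ x, A i < x ∧ x < A (i + 1) ∧ f x = S.el q₁ (S.d + l) := by
    intro i hi q₁ q₂ h hw l hl
    rw [hA1]
    exact exists_between hlab hl h hw (hst i (by omega)) (hA1 i ▸ hst (i + 1) (by omega))
  -- No node occurs in two consecutive gaps between states. If the direction of time changed at a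
  -- state, both gaps next to it would consist of the same block of that state.
  have hconf : ∀ i, i + 6 ≤ S.J → ∀ y, (∃ x, A i < x ∧ x < A (i + 1) ∧ f x = y) →
      (∃ x, A (i + 1) < x ∧ x < A (i + 1 + 1) ∧ f x = y) → False := by
    rintro i hi y ⟨x, h1, h2, h3⟩ ⟨x', h4, h5, h6⟩
    have h7 := hAle (i + 1 + 1) (by omega)
    have h8 := hA1 (i + 1)
    have := hf.1 x (by omega) x' (by omega) (h3.trans h6.symm)
    omega
  have hidx : ∀ i x, A i < x → x < A (i + 1) → (x - a) / (S.d + 1) = i := by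
    intro i x h1 h2
    rw [hA1] at h2
    simp only [hA] at h1 h2
    obtain ⟨y, rfl⟩ : ∃ y, x = a + y := ⟨x - a, by omega⟩
    rw [Nat.add_sub_cancel_left]
    exact Nat.div_eq_of_lt_le (by omega) (by rw [Nat.succ_mul]; omega)
  have hxk : ∀ i x, i + 5 ≤ S.J → x < A (i + 1) → x < S.k := by
    intro i x hi hx
    have := hAle (i + 1) (by omega)
    omega
  rcases hpair 0 (by omega) with h0 | h0
  · have hup : ∀ i, i + 5 ≤ S.J →
        S.Succ (q i) (q (i + 1)) ∧ S.win f (A i) = S.pairSet (q i) (q (i + 1)) := by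
      intro i
      induction i with
      | zero => exact fun _ => h0
      | succ i ih =>
        intro hi
        obtain ⟨h1, h2⟩ := ih (by omega)
        rcases hpair (i + 1) hi with h | ⟨h3, h4⟩
        · exact h
        · exfalso
          have h5 := hbet i (by omega) _ _ h1 h2 0 hd
          have h6 := hbet (i + 1) hi _ _ h3 h4 0 hd
          rw [← h1.el_eq hd] at h5
          rw [← h3.el_eq hd] at h6
          exact hconf i (by omega) _ h5 h6
    have ht : ∀ i, i + 4 ≤ S.J → S.time (q i) = S.time (q 0) + i := by
      intro i
      induction i with
      | zero => exact fun _ => rfl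
      | succ i ih =>
        intro hi
        rw [(hup i (by omega)).1.2.2.1, ih (by omega)]; ring
    have hv : ∀ i, i + 4 ≤ S.J → S.Valid (q i) := by
      intro i hi
      rcases Nat.eq_zero_or_pos i with rfl | h
      · exact (hup 0 (by omega)).1.1
      · obtain ⟨i, rfl⟩ : ∃ l, i = l + 1 := ⟨i - 1, by omega⟩
        exact (hup i (by omega)).1.2.1
    -- The `J - 3` states found have consecutive times below `J`. So the first time is at most `3`,
    -- and all times from `3` to `J - 4` occur.
    have hlast := time_lt (hv (S.J - 4) (by omega))
    rw [ht _ (by omega)] at hlast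
    refine ⟨fun j => q (j - S.time (q 0)), fun x => (x - a) / (S.d + 1) + S.time (q 0), ?_, ?_, ?_⟩
    · intro j h3 h4
      exact ⟨hv _ (by omega), by rw [ht _ (by omega)]; omega⟩
    · intro j h3 h4
      have := (hup (j - S.time (q 0)) (by omega)).1
      rwa [show j - S.time (q 0) + 1 = j + 1 - S.time (q 0) by omega] at this
    · intro j h3 h4 i hi
      obtain ⟨h5, h6⟩ := hup (j - S.time (q 0)) (by omega)
      obtain ⟨x, hx1, hx2, hx3⟩ := hbet _ (by omega) _ _ h5 h6 i hi
      refine ⟨x, hxk _ x (by omega) hx2, ?_, hx3⟩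
      simp only [hidx _ x hx1 hx2]; omega
  · have hdown : ∀ i, i + 5 ≤ S.J →
        S.Succ (q (i + 1)) (q i) ∧ S.win f (A i) = S.pairSet (q (i + 1)) (q i) := by
      intro i
      induction i with
      | zero => exact fun _ => h0
      | succ i ih =>
        intro hi
        obtain ⟨h1, h2⟩ := ih (by omega)
        rcases hpair (i + 1) hi with ⟨h3, h4⟩ | h
        · exact (hconf i (by omega) _ (hbet i (by omega) _ _ h1 h2 0 hd)
            (hbet (i + 1) hi _ _ h3 h4 0 hd)).elim
        · exact h
    have ht : ∀ i, i + 4 ≤ S.J → S.time (q i) + i = S.time (q 0) := by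
      intro i
      induction i with
      | zero => exact fun _ => rfl
      | succ i ih =>
        intro hi
        have := (hdown i (by omega)).1.2.2.1
        have := ih (by omega)
        omega
    have hv : ∀ i, i + 4 ≤ S.J → S.Valid (q i) := by
      intro i hi
      rcases Nat.eq_zero_or_pos i with rfl | h
      · exact (hdown 0 (by omega)).1.2.1
      · obtain ⟨i, rfl⟩ : ∃ l, i = l + 1 := ⟨i - 1, by omega⟩
        exact (hdown i (by omega)).1.1
    have hfirst := time_lt (hv 0 (by omega))
    have hlast := ht (S.J - 4) (by omega)
    -- Time runs backwards: gap number `i` contains the second block of the state `q (i + 1)`, whose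
    -- time is `S.time (q 0) - 1 - i`.
    refine ⟨fun j => q (S.time (q 0) - j), fun x => S.time (q 0) - 1 - (x - a) / (S.d + 1),
      ?_, ?_, ?_⟩
    · intro j h3 h4
      have := ht (S.time (q 0) - j) (by omega)
      exact ⟨hv _ (by omega), show S.time (q (S.time (q 0) - j)) = j by omega⟩
    · intro j h3 h4
      have := (hdown (S.time (q 0) - (j + 1)) (by omega)).1
      rwa [show S.time (q 0) - (j + 1) + 1 = S.time (q 0) - j by omega] at this
    · intro j h3 h4 i hi
      obtain ⟨h5, h6⟩ := hdown (S.time (q 0) - (j + 1)) (by omega)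
      obtain ⟨x, hx1, hx2, hx3⟩ := hbet _ (by omega) _ _ h5 h6 i hi
      refine ⟨x, hxk _ x (by omega) hx2, ?_, ?_⟩
      · simp only [hidx _ x hx1 hx2]; omega
      · rwa [show S.time (q 0) - (j + 1) + 1 = S.time (q 0) - j by omega] at hx3

/-- The tokens are read off the states of times `3` to `J - 4`, whose first blocks cover all real
positions. Labels do not repeat: equal labels mean the same node, hence the same position on the
path and, through `p`, the same block; inside a block validity separates the labels. -/
theorem IsPath.hasWalk (hd : 1 ≤ S.d) (hlab : ∀ t < S.T, S.lab t < S.n) (hT : S.fst S.T ≠ 0)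
    (hT' : S.fst (S.T + 1) ≠ 0) (hf : S.IsPath f) : S.HasWalk := by
  classical
  obtain ⟨σ, p, hσ, hsucc, hp⟩ := hf.exists_states hd hlab
  set τ : ℕ → ℕ := fun g => S.tok (σ (g / S.d)) (g % S.d) with hτ
  have hblock : ∀ g, 3 * S.d ≤ g → g < (S.J - 3) * S.d → 3 ≤ g / S.d ∧ g / S.d + 4 ≤ S.J := by
    intro g h1 h2
    have h3 := (Nat.le_div_iff_mul_le hd).2 h1
    have h4 := (Nat.div_lt_iff_lt_mul hd).2 h2
    omega
  have hreal : ∀ g, 3 * S.d ≤ g → g < (S.J - 3) * S.d → (S.Real g ↔ τ g < S.T) := by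
    intro g h1 h2
    obtain ⟨h3, h4⟩ := hblock g h1 h2
    obtain ⟨hv, ht⟩ := hσ _ h3 h4
    have := hv.2.1 (g % S.d) (by have := Nat.mod_lt g hd; omega)
    rwa [ht, Nat.div_add_mod'] at this
  have hlink : ∀ g, 3 * S.d ≤ g → g + 1 < (S.J - 3) * S.d → S.Link (τ g) (τ (g + 1)) := by
    intro g h1 h2
    obtain ⟨h3, h4⟩ := hblock g h1 (by omega)
    obtain ⟨h5, h6⟩ := hblock (g + 1) (by omega) h2
    obtain ⟨hv, ht⟩ := hσ _ h3 h4
    have hlt := Nat.mod_lt g hd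
    have hdm := Nat.div_add_mod' g S.d
    have hl := hv.2.2.1 (g % S.d) (by omega)
    rcases Nat.lt_or_ge (g % S.d + 1) S.d with h | h
    · have e1 : (g + 1) / S.d = g / S.d :=
        Nat.div_eq_of_lt_le (by omega) (by rw [Nat.succ_mul]; omega)
      have e2 : (g + 1) % S.d = g % S.d + 1 := by
        have := Nat.div_add_mod' (g + 1) S.d
        rw [e1] at this; omega
      simp only [hτ, e1, e2]; exact hl
    · have e1 : (g + 1) / S.d = g / S.d + 1 :=
        Nat.div_eq_of_lt_le (by rw [Nat.succ_mul]; omega) (by rw [Nat.succ_mul, Nat.succ_mul]; omega)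
      have e2 : (g + 1) % S.d = 0 := by
        have := Nat.div_add_mod' (g + 1) S.d
        rw [e1, Nat.succ_mul] at this; omega
      simp only [hτ, e1, e2]
      -- Across a block border, the first token of the next state is token `d` of the current one.
      rw [(hsucc _ h3 (by omega)).2.2.2 0 hd]
      rwa [show g % S.d + 1 = S.d + 0 by omega] at hl
  have hpos : ∀ g, S.Real g → ∃ x < S.k, p x + 1 = g / S.d ∧
      f x = S.lab (τ g) ∧ f x = S.el (σ (g / S.d)) (g % S.d) := by
    intro g hg
    have hg' := real_lt hd hg
    have h1 := hg.1
    obtain ⟨-, h4⟩ := hblock g (by omega) (by omega)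
    have h3 := (Nat.le_div_iff_mul_le hd).2 h1
    have hlt := Nat.mod_lt g hd
    -- A real position lies in block `4` or later, so its block is the second block of a state whose
    -- time is at least `3`.
    obtain ⟨x, hx, hpx, hfx⟩ := hp (g / S.d - 1) (by omega) (by omega) _ hlt
    have hs := hsucc (g / S.d - 1) (by omega) (by omega)
    rw [show g / S.d - 1 + 1 = g / S.d by omega] at hs
    rw [← hs.el_eq hlt] at hfx
    refine ⟨x, hx, by omega, ?_, hfx⟩
    rw [hfx, el, (hσ _ (by omega) h4).2, Nat.div_add_mod', elem,
      if_pos ((hreal g (by omega) (by omega)).1 hg)]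
  -- Next to the real positions the states already carry padding, so nothing is changed there.
  -- Farther away only padding follows padding, which the marks at `T` and `T + 1` allow.
  refine ⟨fun g => if S.Real g then τ g else S.T, fun g hg => ?_, fun g hg => if_neg hg,
    fun g => ?_, fun g g' hg hg' h => ?_⟩
  · have hg' := real_lt hd hg
    have h1 := hg.1
    simp only [if_pos hg]
    exact (hreal g (by omega) (by omega)).1 hg
  · by_cases hr : S.Real g ∨ S.Real (g + 1)
    · have hrange : 3 * S.d ≤ g ∧ g + 1 < (S.J - 3) * S.d := by
        rcases hr with h | h
        · have := real_lt hd h; have := h.1; omega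
        · have := real_lt hd h; have := h.1; omega
      have key : ∀ g, 3 * S.d ≤ g → g < (S.J - 3) * S.d →
          (if S.Real g then τ g else S.T) = τ g := by
        intro g h1 h2
        split_ifs with h
        · rfl
        · have := (hreal g h1 h2).not.1 h
          have : τ g ≤ S.T := tok_le _ _
          omega
      have := hlink g hrange.1 hrange.2
      rwa [← key g hrange.1 (by omega), ← key (g + 1) (by omega) hrange.2] at this
    · rw [not_or] at hr
      simp only [if_neg hr.1, if_neg hr.2]
      exact .inr ⟨hT, hT'⟩
  · simp only [if_pos hg, if_pos hg'] at h
    obtain ⟨x, hx, hpx, hfx, hex⟩ := hpos g hg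
    obtain ⟨x', hx', hpx', hfx', hex'⟩ := hpos g' hg'
    obtain rfl := hf.1 x hx x' hx' (by rw [hfx, hfx', h])
    have hdiv : g / S.d = g' / S.d := by omega
    rw [← hdiv] at hex'
    have h1 := real_lt hd hg
    have h2 := hg.1
    obtain ⟨h3, h4⟩ := hblock g (by omega) (by omega)
    have := el_injective (hσ _ h3 h4).1 (by have := Nat.mod_lt g hd; omega)
      (by have := Nat.mod_lt g' hd; omega) (hex.symm.trans hex')
    rw [← Nat.div_add_mod' g S.d, ← Nat.div_add_mod' g' S.d, hdiv, this]

end Path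

end TokenSystem

namespace TokenSystem

variable {S : TokenSystem}

/-! ### The list of hyperedges -/

theorem next_injective {q a a' : ℕ} (h : S.next q a = S.next q a') : a = a' := by
  unfold next at h
  exact Nat.eq_of_mul_eq_mul_right (pow_pos (U_pos (S := S)) S.d) (by omega)

theorem E_add_mem_edge₁ (hlab : ∀ t < S.T, S.lab t < S.n) {q u y : ℕ} (hq : S.Valid q)
    (hu : u < S.d) : S.E + y ∈ S.edge₁ q u ↔ y = q := by
  simp only [edge₁, List.mem_cons, List.mem_map, List.mem_range, add_right_inj]
  refine or_iff_left ?_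
  rintro ⟨i, hi, h⟩
  have := el_lt hlab hq (show u + i < 2 * S.d by omega)
  omega

theorem E_add_mem_edge₂ (hlab : ∀ t < S.T, S.lab t < S.n) {q a y : ℕ} (hq : S.Valid q) :
    S.E + y ∈ S.edge₂ q a ↔ y = q ∨ y = S.next q a := by
  simp only [edge₂, List.mem_cons, List.mem_map, List.mem_range, add_right_inj]
  refine or_congr_right (or_iff_left ?_)
  rintro ⟨i, hi, h⟩
  have := el_lt hlab hq (show S.d + i < 2 * S.d by omega)
  omega

theorem length_of_mem_edges {e : List ℕ} (he : e ∈ S.edges) : e.length = S.d + 2 := by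
  rcases mem_edges.1 he with ⟨q, u, hv, hu, rfl⟩ | ⟨q, a, hv, ha, hv', rfl⟩
  · simp [edge₁]
  · simp [edge₂]

theorem lt_of_mem_edges (hlab : ∀ t < S.T, S.lab t < S.n) {e : List ℕ} (he : e ∈ S.edges) {y : ℕ}
    (hy : y ∈ e) : y < S.E + S.Q := by
  rcases mem_edges.1 he with ⟨q, u, hv, hu, rfl⟩ | ⟨q, a, hv, ha, hv', rfl⟩
  · simp only [edge₁, List.mem_cons, List.mem_map, List.mem_range] at hy
    rcases hy with rfl | ⟨i, hi, rfl⟩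
    · exact Nat.add_lt_add_left hv.1 _
    · exact Nat.lt_add_right _ (el_lt hlab hv (by omega))
  · simp only [edge₂, List.mem_cons, List.mem_map, List.mem_range] at hy
    rcases hy with rfl | rfl | ⟨i, hi, rfl⟩
    · exact Nat.add_lt_add_left hv.1 _
    · exact Nat.add_lt_add_left hv'.1 _
    · exact Nat.lt_add_right _ (el_lt hlab hv (by omega))

theorem nodup_of_mem_edges (hlab : ∀ t < S.T, S.lab t < S.n) {e : List ℕ} (he : e ∈ S.edges) :
    e.Nodup := by
  rcases mem_edges.1 he with ⟨q, u, hv, hu, rfl⟩ | ⟨q, a, hv, ha, hv', rfl⟩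
  · refine List.nodup_cons.2 ⟨fun h => ?_, List.nodup_range.map_on fun x hx y hy h => ?_⟩
    · obtain ⟨i, hi, h⟩ := List.mem_map.1 h
      have := el_lt hlab hv (show u + i < 2 * S.d by have := List.mem_range.1 hi; omega)
      omega
    · have hx := List.mem_range.1 hx
      have hy := List.mem_range.1 hy
      have := el_injective hv (by omega) (by omega) h
      omega
  · refine List.nodup_cons.2 ⟨fun h => ?_, List.nodup_cons.2
      ⟨fun h => ?_, List.nodup_range.map_on fun x hx y hy h => ?_⟩⟩
    · rcases List.mem_cons.1 h with h | h
      · have h1 := time_next (q := q) ha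
        rw [← Nat.add_left_cancel h] at h1
        omega
      · obtain ⟨i, hi, h⟩ := List.mem_map.1 h
        have := el_lt hlab hv (show S.d + i < 2 * S.d by have := List.mem_range.1 hi; omega)
        omega
    · obtain ⟨i, hi, h⟩ := List.mem_map.1 h
      have := el_lt hlab hv (show S.d + i < 2 * S.d by have := List.mem_range.1 hi; omega)
      omega
    · have hx := List.mem_range.1 hx
      have hy := List.mem_range.1 hy
      have := el_injective hv (by omega) (by omega) h
      omega

/-- A presentation must list each hyperedge once as a set. The states in it reveal its kind; for one
state, `u` is recovered from the element nodes, and for two states, the times tell which comes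
first. -/
theorem toFinset_injOn_edges (hlab : ∀ t < S.T, S.lab t < S.n) {e e' : List ℕ} (he : e ∈ S.edges)
    (he' : e' ∈ S.edges) (h : e.toFinset = e'.toFinset) : e = e' := by
  have hm : ∀ y, y ∈ e ↔ y ∈ e' := fun y => by
    rw [← List.mem_toFinset, h, List.mem_toFinset]
  have hne : ∀ q a, a < S.U ^ S.d → S.next q a ≠ q := fun q a ha h => by
    have := time_next (q := q) ha
    rw [h] at this; omega
  have hmix : ∀ q u q' a, S.Valid q → u < S.d → S.Valid q' → a < S.U ^ S.d →
      (∀ y, y ∈ S.edge₁ q u ↔ y ∈ S.edge₂ q' a) → False := by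
    intro q u q' a hv hu hv' ha hm
    have h1 := (E_add_mem_edge₁ hlab hv hu).1 ((hm _).2 ((E_add_mem_edge₂ hlab hv').2 (.inl rfl)))
    have h2 := (E_add_mem_edge₁ hlab hv hu).1 ((hm _).2 ((E_add_mem_edge₂ hlab hv').2 (.inr rfl)))
    exact hne q' a ha (h2.trans h1.symm)
  have hle : ∀ q u u', S.Valid q → u < S.d → u' < S.d →
      (∀ y, y ∈ S.edge₁ q u ↔ y ∈ S.edge₁ q u') → u' ≤ u := by
    intro q u u' hv hu hu' hm
    have h1 : S.el q u ∈ S.edge₁ q u' := (hm _).1 <| List.mem_cons_of_mem _ <|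
      List.mem_map.2 ⟨0, List.mem_range.2 (by omega), rfl⟩
    rcases List.mem_cons.1 h1 with h2 | h2
    · have := el_lt hlab hv (show u < 2 * S.d by omega); omega
    · obtain ⟨i, hi, h2⟩ := List.mem_map.1 h2
      have := List.mem_range.1 hi
      have := el_injective hv (by omega) (by omega) h2
      omega
  rcases mem_edges.1 he with ⟨q, u, hv, hu, rfl⟩ | ⟨q, a, hv, ha, hn, rfl⟩ <;>
  rcases mem_edges.1 he' with ⟨q', u', hv', hu', rfl⟩ | ⟨q', a', hv', ha', hn', rfl⟩
  · obtain rfl : q = q' := (E_add_mem_edge₁ hlab hv' hu').1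
      ((hm _).1 ((E_add_mem_edge₁ hlab hv hu).2 rfl))
    rw [le_antisymm (hle q u' u hv hu' hu fun y => (hm y).symm) (hle q u u' hv hu hu' hm)]
  · exact (hmix q u q' a' hv hu hv' ha' hm).elim
  · exact (hmix q' u' q a hv' hu' hv ha fun y => (hm y).symm).elim
  · have h1 := (E_add_mem_edge₂ hlab hv').1 ((hm _).1 ((E_add_mem_edge₂ hlab hv).2 (.inl rfl)))
    have h2 := (E_add_mem_edge₂ hlab hv').1 ((hm _).1 ((E_add_mem_edge₂ hlab hv).2 (.inr rfl)))
    have t1 := time_next (q := q) ha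
    have t2 := time_next (q := q') ha'
    rcases h1 with h1 | h1
    · subst h1
      rcases h2 with h2 | h2
      · exact (hne q a ha h2).elim
      · rw [edge₂, edge₂, h2]
    · rw [← h1] at t2
      rcases h2 with h2 | h2
      · rw [h2] at t1; omega
      · exact (hne q a ha (h2.trans h1.symm)).elim

theorem nodup_edges (hlab : ∀ t < S.T, S.lab t < S.n) : S.edges.Nodup := by
  have hhead : ∀ q, ∀ e ∈ S.edgesAt q, e.head? = some (S.E + q) := by
    intro q e he
    rw [edgesAt] at he
    split_ifs at he
    · rcases List.mem_append.1 he with he | he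
      · obtain ⟨u, -, rfl⟩ := List.mem_map.1 he; rfl
      · obtain ⟨a, -, he⟩ := List.mem_flatMap.1 he
        rw [edgesNext] at he
        split_ifs at he
        · rw [List.mem_singleton.1 he]; rfl
        · simp at he
    · simp at he
  refine List.nodup_flatMap.2 ⟨fun q _ => ?_, List.nodup_range.imp fun hne => ?_⟩
  · rw [edgesAt]
    split_ifs with hv
    · refine List.nodup_append.2 ⟨List.nodup_range.map_on fun u hu u' hu' h => ?_,
        List.nodup_flatMap.2 ⟨fun a _ => ?_, List.nodup_range.imp_of_mem fun ha ha' hne => ?_⟩, ?_⟩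
      · have hu := List.mem_range.1 hu
        have hu' := List.mem_range.1 hu'
        have h1 := congrArg (fun l => l.getD 1 0) h
        simp only [edge₁, List.range_succ_eq_map, List.map_cons, List.getD_cons_succ,
          List.getD_cons_zero] at h1
        exact el_injective hv (by omega) (by omega) h1
      · rw [edgesNext]
        split_ifs
        · exact List.nodup_singleton _
        · exact List.nodup_nil
      · intro e he he'
        simp only [edgesNext] at he he'
        split_ifs at he with h1
        · split_ifs at he' with h2
          · have h3 := (List.mem_singleton.1 he).symm.trans (List.mem_singleton.1 he')
            simp only [edge₂, List.cons.injEq, add_right_inj] at h3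
            exact hne (next_injective h3.2.1)
          · simp at he'
        · simp at he
      · intro e he e' he' heq
        subst heq
        obtain ⟨u, hu, rfl⟩ := List.mem_map.1 he
        obtain ⟨a, ha, he'⟩ := List.mem_flatMap.1 he'
        rw [edgesNext] at he'
        split_ifs at he' with h1
        · have h2 : S.E + S.next q a ∈ S.edge₁ q u :=
            List.mem_singleton.1 he' ▸ (E_add_mem_edge₂ hlab hv).2 (.inr rfl)
          have h3 := (E_add_mem_edge₁ hlab hv (List.mem_range.1 hu)).1 h2
          have := time_next (q := q) (List.mem_range.1 ha)
          rw [h3] at this; omega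
        · simp at he'
    · exact List.nodup_nil
  · intro e he he'
    have := (hhead _ e he).symm.trans (hhead _ e he')
    simp only [Option.some.injEq, add_right_inj] at this
    exact hne this

theorem length_edges_le : S.edges.length ≤ S.Q * (S.d + S.U ^ S.d) := by
  have key : ∀ (l : List ℕ) (f : ℕ → List (List ℕ)) (b : ℕ), (∀ x, (f x).length ≤ b) →
      (l.flatMap f).length ≤ l.length * b := by
    intro l f b h
    induction l with
    | nil => simp
    | cons x l ih =>
      rw [List.flatMap_cons, List.length_append, List.length_cons, Nat.succ_mul]
      have := h x; omega
  have h1 : ∀ q a, (S.edgesNext q a).length ≤ 1 := fun q a => by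
    rw [edgesNext]; split_ifs <;> simp
  refine (key _ _ (S.d + S.U ^ S.d) fun q => ?_).trans_eq (by rw [List.length_range])
  rw [edgesAt]
  split_ifs
  · rw [List.length_append, List.length_map, List.length_range]
    have := key (List.range (S.U ^ S.d)) _ 1 (h1 q)
    rw [List.length_range, mul_one] at this
    omega
  · simp

/-! ### Walks give tight paths -/

/-- Existence of a number with prescribed digits in base `T + 1`; its uniqueness is `code_unique`.
-/
theorem exists_code (a : ℕ → ℕ) (ha : ∀ i, a i ≤ S.T) (m : ℕ) :
    ∃ c < S.U ^ m, ∀ i < m, S.dig c i = a i := by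
  induction m with
  | zero => exact ⟨0, by simp, fun i hi => absurd hi (Nat.not_lt_zero i)⟩
  | succ m ih =>
    obtain ⟨c, hc, h⟩ := ih
    have ham : a m < S.U := Nat.lt_succ_of_le (ha m)
    refine ⟨c + a m * S.U ^ m, ?_, fun i hi => ?_⟩
    · rw [pow_succ]; nlinarith
    · rcases Nat.lt_succ_iff_lt_or_eq.1 hi with hi | rfl
      · rw [← dig_mod hi, Nat.add_mul_mod_self_right, dig_mod hi, h i hi]
      · rw [dig, Nat.add_mul_div_right _ _ (pow_pos U_pos _), Nat.div_eq_of_lt hc, zero_add,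
          Nat.mod_eq_of_lt ham]

theorem code_unique {m : ℕ} : ∀ {c c' : ℕ}, c < S.U ^ m → c' < S.U ^ m →
    (∀ i < m, S.dig c i = S.dig c' i) → c = c' := by
  induction m with
  | zero => intro c c' h h' _; simp only [pow_zero] at h h'; omega
  | succ m ih =>
    intro c c' h h' he
    have h1 := ih (Nat.mod_lt c (pow_pos (U_pos (S := S)) m))
      (Nat.mod_lt c' (pow_pos (U_pos (S := S)) m)) fun i hi => by
        rw [dig_mod hi, dig_mod hi, he i (by omega)]
    have h2 := he m (by omega)
    rw [pow_succ, mul_comm] at h h'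
    rw [dig, dig, Nat.mod_eq_of_lt (Nat.div_lt_of_lt_mul (by rwa [mul_comm])),
      Nat.mod_eq_of_lt (Nat.div_lt_of_lt_mul (by rwa [mul_comm]))] at h2
    rw [← Nat.div_add_mod c (S.U ^ m), ← Nat.div_add_mod c' (S.U ^ m), h1, h2]

/-- The nodes are distinct because real positions have distinct labels, padding nodes carry their
own position, and states carry their time. -/
theorem HasWalk.exists_isPath (hd : 1 ≤ S.d) (hlab : ∀ t < S.T, S.lab t < S.n) (h : S.HasWalk) :
    ∃ f, S.IsPath f ∧ ∀ x < S.k, f x < S.E + S.Q := by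
  obtain ⟨τ, hreal, hpad, hlink, hinj⟩ := h
  have hτ : ∀ g, τ g ≤ S.T := fun g => by
    by_cases hg : S.Real g
    · exact (hreal g hg).le
    · exact (hpad g hg).le
  have hreal' : ∀ g, S.Real g ↔ τ g < S.T := fun g =>
    ⟨hreal g, fun hlt => by by_contra hg; have := hpad g hg; omega⟩
  choose C hC hCd using fun m g => S.exists_code (fun i => τ (g + i)) (fun i => hτ _) m
  set η : ℕ → ℕ := fun g => S.elem g (τ g) with hη
  have hηlt : ∀ g, g < (S.J + 1) * S.d → η g < S.E := fun g hg => elem_lt hlab hg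
  have hηinj : ∀ g g', η g = η g' → g = g' := by
    intro g g' h
    simp only [hη, elem] at h
    split_ifs at h with h1 h2 h2
    · exact hinj g g' ((hreal' g).2 h1) ((hreal' g').2 h2) h
    · have := hlab _ h1; omega
    · have := hlab _ h2; omega
    · omega
  set q : ℕ → ℕ := fun j => j * S.U ^ (2 * S.d) + C (2 * S.d) (j * S.d) with hq
  have htime : ∀ j, S.time (q j) = j := fun j => time_mul_add (hC _ _)
  have hcode : ∀ j, S.code (q j) = C (2 * S.d) (j * S.d) := fun j => code_mul_add (hC _ _)
  have htok : ∀ j, ∀ i < 2 * S.d, S.tok (q j) i = τ (j * S.d + i) := fun j i hi => by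
    rw [tok, hcode, hCd _ _ i hi]
  have hel : ∀ j, ∀ i < 2 * S.d, S.el (q j) i = η (j * S.d + i) := fun j i hi => by
    rw [el, htime, htok j i hi]
  have hqQ : ∀ j < S.J, q j < S.Q := fun j hj => by
    have h1 := hC (2 * S.d) (j * S.d)
    have h2 := Nat.mul_le_mul_right (S.U ^ (2 * S.d)) (Nat.succ_le_of_lt hj)
    rw [Nat.succ_mul] at h2
    simp only [hq, Q]; omega
  have hvalid : ∀ j < S.J, S.Valid (q j) := by
    refine fun j hj => ⟨hqQ j hj, fun i hi => ?_, fun i hi => ?_, fun i hi i' hi' he => ?_⟩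
    · rw [htime, htok j i hi, hreal']
    · rw [htok j i (by omega), htok j (i + 1) hi]; exact hlink _
    · rw [hel j i hi, hel j i' (by omega)] at he
      have := hηinj _ _ he; omega
  -- Both codes are compared digit by digit: the low half is block `j + 1`, the high half block `j +
  -- 2`.
  have hnext : ∀ j, S.next (q j) (C S.d ((j + 2) * S.d)) = q (j + 1) := by
    intro j
    have ha : C S.d ((j + 2) * S.d) < S.U ^ S.d := hC _ _
    have hlt := next_code_lt (q := q j) ha
    rw [next, htime]
    simp only [hq]
    congr 1
    refine code_unique hlt (hC _ _) fun i hi => ?_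
    rw [hCd _ _ i hi]
    rcases Nat.lt_or_ge i S.d with h | h
    · rw [← dig_mod h, Nat.add_mul_mod_self_right, dig_mod h, dig_div, ← tok,
        htok j _ (by omega)]
      congr 1; ring
    · obtain ⟨i, rfl⟩ : ∃ l, i = S.d + l := ⟨i - S.d, by omega⟩
      have h0 : S.code (q j) / S.U ^ S.d < S.U ^ S.d := by
        rw [Nat.div_lt_iff_lt_mul (pow_pos U_pos _), ← pow_add, ← two_mul]
        exact code_lt _
      rw [← dig_div, Nat.add_mul_div_right _ _ (pow_pos U_pos _), Nat.div_eq_of_lt h0, zero_add,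
        hCd _ _ i (by omega)]
      congr 1; ring
  -- The path has period `d + 1`: the `d` element nodes of a block, then a state. It ends with block
  -- `J`, which has no state behind it.
  set f : ℕ → ℕ := fun x => if x % (S.d + 1) < S.d then η (x / (S.d + 1) * S.d + x % (S.d + 1))
    else S.E + q (x / (S.d + 1)) with hf
  have hdiv : ∀ j i, i < S.d + 1 → (j * (S.d + 1) + i) / (S.d + 1) = j ∧
      (j * (S.d + 1) + i) % (S.d + 1) = i := fun j i hi => by
    rw [mul_comm, Nat.mul_add_div (Nat.succ_pos _), Nat.mul_add_mod, Nat.div_eq_of_lt hi,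
      Nat.mod_eq_of_lt hi]
    exact ⟨rfl, rfl⟩
  have hfη : ∀ j, ∀ i < S.d, f (j * (S.d + 1) + i) = η (j * S.d + i) := fun j i hi => by
    obtain ⟨h1, h2⟩ := hdiv j i (by omega)
    simp only [hf, h1, h2, if_pos hi]
  have hfq : ∀ j, f (j * (S.d + 1) + S.d) = S.E + q j := fun j => by
    obtain ⟨h1, h2⟩ := hdiv j S.d (by omega)
    simp only [hf, h1, h2, lt_irrefl, if_false]
  have hsplit : ∀ x, ∃ j i, i ≤ S.d ∧ x = j * (S.d + 1) + i := fun x =>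
    ⟨x / (S.d + 1), x % (S.d + 1), Nat.lt_succ_iff.1 (Nat.mod_lt _ (Nat.succ_pos _)),
      (Nat.div_add_mod' _ _).symm⟩
  have hkJ : S.k + 1 = (S.J + 1) * (S.d + 1) := Nat.sub_add_cancel (Nat.mul_pos (by omega) (by omega))
  have hjlt : ∀ j i, i ≤ S.d → j * (S.d + 1) + i < S.k →
      j ≤ S.J ∧ (i = S.d → j < S.J) ∧ j * S.d + S.d ≤ (S.J + 1) * S.d := by
    intro j i hi h
    have h1 : j ≤ S.J := by
      by_contra h'
      have := Nat.mul_le_mul_right (S.d + 1) (show S.J + 1 ≤ j by omega)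
      omega
    refine ⟨h1, fun hid => lt_of_le_of_ne h1 fun hjJ => ?_, ?_⟩
    · rw [hjJ, hid] at h
      rw [Nat.succ_mul] at hkJ
      omega
    · rw [← Nat.succ_mul]; exact Nat.mul_le_mul_right _ (by omega)
  refine ⟨f, ⟨fun x hx y hy he => ?_, fun x hx => ?_⟩, fun x hx => ?_⟩
  · obtain ⟨j, i, hi, rfl⟩ := hsplit x
    obtain ⟨j', i', hi', rfl⟩ := hsplit y
    obtain ⟨-, -, h1⟩ := hjlt j i hi hx
    obtain ⟨-, -, h2⟩ := hjlt j' i' hi' hy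
    rcases hi.lt_or_eq with hi | rfl <;> rcases hi'.lt_or_eq with hi' | rfl
    · rw [hfη j i hi, hfη j' i' hi'] at he
      have he := hηinj _ _ he
      have h3 : j = j' := by
        have := congrArg (· / S.d) he
        simpa [mul_comm _ S.d, Nat.mul_add_div hd, Nat.div_eq_of_lt hi, Nat.div_eq_of_lt hi']
          using this
      subst h3; omega
    · rw [hfη j i hi, hfq] at he
      have := hηlt (j * S.d + i) (by omega); omega
    · rw [hfη j' i' hi', hfq] at he
      have := hηlt (j' * S.d + i') (by omega); omega
    · rw [hfq, hfq] at he
      rw [← htime j, ← htime j', Nat.add_left_cancel he]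
  · obtain ⟨j, u, hu, rfl⟩ := hsplit x
    have e1 : (j + 1) * (S.d + 1) = j * (S.d + 1) + (S.d + 1) := Nat.succ_mul _ _
    have e2 : (j + 1) * S.d = j * S.d + S.d := Nat.succ_mul _ _
    have hA : ∀ i < S.d, f (j * (S.d + 1) + i) = S.el (q j) i := fun i hi => by
      rw [hfη j i hi, hel j i (by omega)]
    have hB : ∀ i < S.d, f (j * (S.d + 1) + S.d + 1 + i) = S.el (q j) (S.d + i) := fun i hi => by
      rw [hel j _ (by omega), show j * (S.d + 1) + S.d + 1 + i = (j + 1) * (S.d + 1) + i by omega,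
        hfη _ i hi]
      congr 1; omega
    -- A window that starts inside a block contains one state; a window that starts at a state ends
    -- at the next state.
    rcases hu.lt_or_eq with hu | rfl
    · have hj : j < S.J := by
        by_contra h'
        have := Nat.mul_le_mul_right (S.d + 1) (show S.J + 1 ≤ j + 1 by omega)
        omega
      refine ⟨S.edge₁ (q j) u, mem_edges.2 (.inl ⟨_, u, hvalid j hj, hu, rfl⟩), ?_⟩
      ext y
      simp only [edge₁, List.toFinset_cons, Finset.mem_insert, List.mem_toFinset, List.mem_map,
        List.mem_range, Finset.mem_image, Finset.mem_Ico]
      constructor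
      · rintro ⟨z, ⟨h1, h2⟩, rfl⟩
        obtain ⟨l, rfl⟩ : ∃ l, z = j * (S.d + 1) + l := ⟨z - j * (S.d + 1), by omega⟩
        rcases lt_trichotomy l S.d with h3 | rfl | h3
        · exact .inr ⟨l - u, by omega, by rw [hA l h3]; congr 1; omega⟩
        · exact .inl (hfq j)
        · obtain ⟨m, rfl⟩ : ∃ m, l = S.d + 1 + m := ⟨l - (S.d + 1), by omega⟩
          refine .inr ⟨S.d + m - u, by omega, ?_⟩
          rw [show j * (S.d + 1) + (S.d + 1 + m) = j * (S.d + 1) + S.d + 1 + m by ring,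
            hB m (by omega)]
          congr 1; omega
      · rintro (rfl | ⟨i, hi, rfl⟩)
        · exact ⟨_, ⟨by omega, by omega⟩, hfq j⟩
        · rcases Nat.lt_or_ge (u + i) S.d with h3 | h3
          · exact ⟨j * (S.d + 1) + (u + i), ⟨by omega, by omega⟩, hA _ h3⟩
          · refine ⟨j * (S.d + 1) + S.d + 1 + (u + i - S.d), ⟨by omega, by omega⟩, ?_⟩
            rw [hB _ (by omega)]; congr 1; omega
    · have hj : j + 1 < S.J := by
        by_contra h'
        have := Nat.mul_le_mul_right (S.d + 1) (show S.J + 1 ≤ j + 2 by omega)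
        rw [show (j + 2) * (S.d + 1) = j * (S.d + 1) + 2 * (S.d + 1) by ring] at this
        omega
      refine ⟨S.edge₂ (q j) (C S.d ((j + 2) * S.d)), mem_edges.2 (.inr ⟨_, _, hvalid j (by omega),
        hC _ _, by rw [hnext]; exact hvalid _ hj, rfl⟩), ?_⟩
      have hlast : f (j * (S.d + 1) + S.d + 1 + S.d) = S.E + q (j + 1) := by
        rw [← hfq]; congr 1; omega
      ext y
      simp only [edge₂, hnext, List.toFinset_cons, Finset.mem_insert, List.mem_toFinset,
        List.mem_map, List.mem_range, Finset.mem_image, Finset.mem_Ico]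
      constructor
      · rintro ⟨z, ⟨h1, h2⟩, rfl⟩
        obtain ⟨l, rfl⟩ : ∃ l, z = j * (S.d + 1) + S.d + l :=
          ⟨z - (j * (S.d + 1) + S.d), by omega⟩
        rcases Nat.eq_zero_or_pos l with rfl | hl
        · exact .inl (hfq j)
        · obtain ⟨m, rfl⟩ : ∃ m, l = 1 + m := ⟨l - 1, by omega⟩
          rw [← add_assoc]
          rcases Nat.lt_or_ge m S.d with hm | hm
          · exact .inr (.inr ⟨m, hm, (hB m hm).symm⟩)
          · obtain rfl : m = S.d := by omega
            exact .inr (.inl hlast)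
      · rintro (rfl | rfl | ⟨i, hi, rfl⟩)
        · exact ⟨_, ⟨le_rfl, by omega⟩, hfq j⟩
        · exact ⟨_, ⟨by omega, by omega⟩, hlast⟩
        · exact ⟨_, ⟨by omega, by omega⟩, hB i hi⟩
  · obtain ⟨j, i, hi, rfl⟩ := hsplit x
    obtain ⟨-, h1, h2⟩ := hjlt j i hi hx
    rcases hi.lt_or_eq with hi | rfl
    · rw [hfη j i hi]
      exact Nat.lt_add_right _ (hηlt _ (by omega))
    · rw [hfq]
      exact Nat.add_lt_add_left (hqQ j (h1 rfl)) _

end TokenSystem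

/-! ## Exact covers and walks -/

/-- The number of tokens in front of set number `i`. -/
def tokenOffset (ls : List (List ℕ)) (i : ℕ) : ℕ := (ls.take i).flatten.length

theorem tokenOffset_zero (ls : List (List ℕ)) : tokenOffset ls 0 = 0 := rfl

theorem tokenOffset_succ (ls : List (List ℕ)) {i : ℕ} (hi : i < ls.length) :
    tokenOffset ls (i + 1) = tokenOffset ls i + ls[i].length := by
  rw [tokenOffset, tokenOffset, ← List.take_append_getElem hi, List.flatten_append,
    List.length_append]
  simp

theorem tokenOffset_length (ls : List (List ℕ)) :
    tokenOffset ls ls.length = ls.flatten.length := by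
  rw [tokenOffset, List.take_length]

theorem tokenOffset_mono (ls : List (List ℕ)) : Monotone (tokenOffset ls) := by
  refine monotone_nat_of_le_succ fun i => ?_
  rcases Nat.lt_or_ge i ls.length with h | h
  · rw [tokenOffset_succ ls h]; omega
  · rw [tokenOffset, tokenOffset, List.take_of_length_le h, List.take_of_length_le (by omega)]

theorem tokenOffset_le (ls : List (List ℕ)) (i : ℕ) : tokenOffset ls i ≤ ls.flatten.length := by
  rw [← tokenOffset_length]
  rcases le_total i ls.length with h | h
  · exact tokenOffset_mono ls h
  · rw [tokenOffset, tokenOffset, List.take_of_length_le h, List.take_length]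

theorem flatten_getD_tokenOffset (ls : List (List ℕ)) {i j : ℕ} (hi : i < ls.length)
    (hj : j < ls[i].length) : ls.flatten.getD (tokenOffset ls i + j) 0 = ls[i][j] := by
  have h : ls.flatten = (ls.take i).flatten ++ (ls[i] ++ (ls.drop (i + 1)).flatten) := by
    rw [← List.flatten_cons, ← List.drop_eq_getElem_cons hi, ← List.flatten_append,
      List.take_append_drop]
  rw [h, tokenOffset, List.getD_append_right _ _ _ _ (Nat.le_add_right _ _),
    Nat.add_sub_cancel_left, List.getD_append _ _ _ _ hj, List.getD_eq_getElem _ _ hj]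

theorem exists_tokenOffset_le (ls : List (List ℕ)) {t : ℕ} (ht : t < ls.flatten.length) :
    ∃ i, ∃ hi : i < ls.length, ∃ j, j < ls[i].length ∧ t = tokenOffset ls i + j := by
  have hex : ∃ i, t < tokenOffset ls (i + 1) := by
    refine ⟨ls.length, lt_of_lt_of_le ht ?_⟩
    rw [← tokenOffset_length]
    exact tokenOffset_mono ls (Nat.le_succ _)
  classical
  obtain ⟨i, h1, h2⟩ : ∃ i, t < tokenOffset ls (i + 1) ∧ tokenOffset ls i ≤ t := by
    -- The least such index; empty sets, whose token intervals are empty, are thereby never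
    -- selected.
    refine ⟨Nat.find hex, Nat.find_spec hex, ?_⟩
    rcases Nat.eq_zero_or_pos (Nat.find hex) with h | h
    · rw [h, tokenOffset_zero]; exact Nat.zero_le _
    · have := Nat.find_min hex (show Nat.find hex - 1 < Nat.find hex by omega)
      rw [Nat.sub_add_cancel h] at this
      omega
  have hi : i < ls.length := by
    by_contra h
    push Not at h
    have : tokenOffset ls (i + 1) = tokenOffset ls i := by
      rw [tokenOffset, tokenOffset, List.take_of_length_le h, List.take_of_length_le (by omega)]
    omega
  refine ⟨i, hi, t - tokenOffset ls i, ?_, by omega⟩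
  rw [tokenOffset_succ ls hi] at h1
  omega

theorem tokenOffset_add_inj (ls : List (List ℕ)) {i i' j j' : ℕ} (hi : i < ls.length)
    (hi' : i' < ls.length) (hj : j < ls[i].length) (hj' : j' < ls[i'].length)
    (h : tokenOffset ls i + j = tokenOffset ls i' + j') : i = i' := by
  have h1 := tokenOffset_succ ls hi
  have h2 := tokenOffset_succ ls hi'
  rcases lt_trichotomy i i' with h3 | h3 | h3
  · have := tokenOffset_mono ls (show i + 1 ≤ i' from h3); omega
  · exact h3
  · have := tokenOffset_mono ls (show i' + 1 ≤ i from h3); omega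

/-- The marks of the tokens at which a set starts. -/
def startMark (ls : List (List ℕ)) (t : ℕ) : ℕ :=
  if (∃ i ≤ ls.length, t = tokenOffset ls i) ∨ t = ls.flatten.length + 1 then 1 else 0

theorem startMark_tokenOffset (ls : List (List ℕ)) {i : ℕ} (hi : i ≤ ls.length) :
    startMark ls (tokenOffset ls i) ≠ 0 := by
  rw [startMark, if_pos (.inl ⟨i, hi, rfl⟩)]; exact one_ne_zero

theorem startMark_between (ls : List (List ℕ)) {i j : ℕ} (hi : i < ls.length) (h0 : 1 ≤ j)
    (hj : j < ls[i].length) : startMark ls (tokenOffset ls i + j) = 0 := by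
  have h1 := tokenOffset_succ ls hi
  rw [startMark, if_neg]
  rintro (⟨i', -, h⟩ | h)
  · rcases Nat.lt_or_ge i i' with h2 | h2
    · have := tokenOffset_mono ls (show i + 1 ≤ i' from h2); omega
    · have := tokenOffset_mono ls h2; omega
  · have := tokenOffset_le ls (i + 1); omega

/-- The tokens of a list of sets. -/
def TokenSystem.ofSets (d n : ℕ) (ls : List (List ℕ)) : TokenSystem where
  d := d
  n := n
  T := ls.flatten.length
  lab t := ls.flatten.getD t 0
  fst := startMark ls

/-- Some of the sets in the list `ls` partition `{0, …, n - 1}`. -/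
def HasExactCover (n : ℕ) (ls : List (List ℕ)) : Prop :=
  ∃ D : Set ℕ, (∀ i ∈ D, ∀ j ∈ D, ∀ (hi : i < ls.length) (hj : j < ls.length), i ≠ j →
    ls[i].Disjoint ls[j]) ∧ ∀ x < n, ∃ i ∈ D, ∃ hi : i < ls.length, x ∈ ls[i]

theorem TokenSystem.lab_ofSets_lt {d n : ℕ} {ls : List (List ℕ)} (hn : ∀ l ∈ ls, ∀ x ∈ l, x < n) :
    ∀ t < (ofSets d n ls).T, (ofSets d n ls).lab t < (ofSets d n ls).n := by
  intro t ht
  have ht' : t < ls.flatten.length := ht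
  change ls.flatten.getD t 0 < n
  rw [List.getD_eq_getElem _ _ ht']
  obtain ⟨l, hl, hx⟩ := List.mem_flatten.1 (List.getElem_mem ht')
  exact hn l hl _ hx

/-- The chosen sets are those with a token on the walk. A token that does not start a set can only
be entered from the preceding one, and a token that does not end a set can only be left to the next
one, so each chosen set is visited entirely. Distinct labels then make the sets disjoint. -/
theorem TokenSystem.HasWalk.hasExactCover {d n : ℕ} {ls : List (List ℕ)} (hd : 1 ≤ d)
    (hn : ∀ l ∈ ls, ∀ x ∈ l, x < n) (h : (ofSets d n ls).HasWalk) : HasExactCover n ls := by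
  obtain ⟨τ, hreal, hpad, hlink, hinj⟩ := h
  set S := ofSets d n ls with hS
  have hfst : ∀ t, S.fst t = startMark ls t := fun _ => rfl
  have hreal' : ∀ g, τ g < S.T → S.Real g := fun g hlt => by
    by_contra hg; have := hpad g hg; omega
  have hltT : ∀ i (hi : i < ls.length), ∀ j < ls[i].length, tokenOffset ls i + j < S.T := by
    intro i hi j hj
    have h1 := tokenOffset_succ ls hi
    have h2 := tokenOffset_le ls (i + 1)
    change _ < ls.flatten.length
    omega
  have hup : ∀ i (hi : i < ls.length), ∀ m, ∀ j g, j + m < ls[i].length → S.Real g →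
      τ g = tokenOffset ls i + j → ∃ g', S.Real g' ∧ τ g' = tokenOffset ls i + (j + m) := by
    intro i hi m
    induction m with
    | zero => exact fun j g _ hg h => ⟨g, hg, h⟩
    | succ m ih =>
      intro j g hj hg h
      obtain ⟨g', hg', h'⟩ := ih j g (by omega) hg h
      have h0 := startMark_between ls hi (show 1 ≤ j + m + 1 by omega) (by omega)
      rw [← add_assoc, ← h'] at h0
      rcases hlink g' with ⟨-, h1⟩ | ⟨-, h1⟩
      · refine ⟨g' + 1, hreal' _ ?_, by rw [h1, h']; ring⟩
        rw [h1, h', add_assoc]; exact hltT i hi _ (by omega)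
      · exact (h1 h0).elim
  have hdown : ∀ i (hi : i < ls.length), ∀ j g, j < ls[i].length → S.Real g →
      τ g = tokenOffset ls i + j → ∃ g', S.Real g' ∧ τ g' = tokenOffset ls i := by
    intro i hi j
    induction j with
    | zero => exact fun g _ hg h => ⟨g, hg, h⟩
    | succ j ih =>
      intro g hj hg h
      have h0 := startMark_between ls hi (show 1 ≤ j + 1 by omega) hj
      rw [← h] at h0
      have hg1 : 1 ≤ g := by have : 4 * d ≤ g := hg.1; omega
      obtain ⟨g, rfl⟩ : ∃ l, g = l + 1 := ⟨g - 1, by omega⟩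
      rcases hlink g with ⟨-, h1⟩ | ⟨h1, -⟩
      · have h2 : τ g = tokenOffset ls i + j := by omega
        exact ih g (by omega) (hreal' g (h2 ▸ hltT i hi j (by omega))) h2
      · exact (h1 h0).elim
  refine ⟨{i | ∃ hi : i < ls.length, ∃ g j, j < ls[i].length ∧ S.Real g ∧
    τ g = tokenOffset ls i + j}, ?_, fun x hx => ?_⟩
  · rintro i ⟨hi, g, j, hj, hg, h⟩ i' ⟨hi', g', j', hj', hg', h'⟩ - - hne
    rw [List.disjoint_left]
    intro x hx hx'
    obtain ⟨a, ha, rfl⟩ := List.getElem_of_mem hx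
    obtain ⟨b, hb, hab⟩ := List.getElem_of_mem hx'
    obtain ⟨g₁, hg₁, e₁⟩ := hdown i hi j g hj hg h
    obtain ⟨g₂, hg₂, e₂⟩ := hup i hi a 0 g₁ (by omega) hg₁ e₁
    obtain ⟨g₁', hg₁', e₁'⟩ := hdown i' hi' j' g' hj' hg' h'
    obtain ⟨g₂', hg₂', e₂'⟩ := hup i' hi' b 0 g₁' (by omega) hg₁' e₁'
    rw [zero_add] at e₂ e₂'
    have hlab : S.lab (τ g₂) = S.lab (τ g₂') := by
      rw [e₂, e₂']
      change ls.flatten.getD _ 0 = ls.flatten.getD _ 0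
      rw [flatten_getD_tokenOffset ls hi ha, flatten_getD_tokenOffset ls hi' hb, hab]
    obtain rfl := hinj _ _ hg₂ hg₂' hlab
    exact hne (tokenOffset_add_inj ls hi hi' ha hb (e₂.symm.trans e₂'))
  -- There are exactly `n` real positions, so `n` distinct labels below `n` exhaust the ground set.
  · have hr : ∀ y : Fin n, S.Real (4 * d + y) := fun y =>
      ⟨Nat.le_add_right _ _, Nat.add_lt_add_left y.2 _⟩
    let F : Fin n → Fin n := fun y =>
      ⟨S.lab (τ (4 * d + y)), lab_ofSets_lt hn _ (hreal _ (hr y))⟩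
    have hF : Function.Injective F := fun y y' h => by
      have := hinj _ _ (hr y) (hr y') (congrArg Fin.val h)
      exact Fin.ext (by omega)
    obtain ⟨y, hy⟩ := Finite.injective_iff_surjective.1 hF ⟨x, hx⟩
    have hy' : ls.flatten.getD (τ (4 * d + y)) 0 = x := congrArg Fin.val hy
    obtain ⟨i, hi, j, hj, h⟩ := exists_tokenOffset_le ls (hreal _ (hr y))
    refine ⟨i, ⟨hi, _, j, hj, hr y, h⟩, hi, ?_⟩
    rw [h, flatten_getD_tokenOffset ls hi hj] at hy'
    exact hy' ▸ List.getElem_mem hj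

/-- One set with first token `s` and `l + 1` elements is run through, and then the walk goes on with
`rest`. -/
theorem TokenSystem.isChain_range' {S : TokenSystem} {rest : List ℕ}
    (hrest : ∀ t, S.fst (t + 1) ≠ 0 → (t :: rest).IsChain S.Link) (l : ℕ) : ∀ s,
    (∀ i, 1 ≤ i → i ≤ l → S.fst (s + i) = 0) → S.fst (s + l + 1) ≠ 0 →
      (s :: (List.range' (s + 1) l ++ rest)).IsChain S.Link := by
  induction l with
  | zero => exact fun s _ h => hrest s h
  | succ l ih =>
    intro s h1 h2
    rw [List.range'_succ, List.cons_append, List.isChain_cons_cons]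
    refine ⟨.inl ⟨h1 1 le_rfl (by omega), rfl⟩, ih (s + 1) (fun i hi hi' => ?_) ?_⟩
    · rw [add_assoc]; exact h1 _ (by omega) (by omega)
    · rwa [show s + 1 + l + 1 = s + (l + 1) + 1 by ring]

/-- The tokens of the chosen sets are concatenated in the order of the list. Their labels are
distinct by disjointness and exhaust the ground set, so there are exactly `n` of them. -/
theorem HasExactCover.hasWalk {d n : ℕ} {ls : List (List ℕ)}
    (hn : ∀ l ∈ ls, ∀ x ∈ l, x < n) (hnd : ∀ l ∈ ls, l.Nodup) (h : HasExactCover n ls) :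
    (TokenSystem.ofSets d n ls).HasWalk := by
  classical
  obtain ⟨D, hdisj, hcov⟩ := h
  set S := TokenSystem.ofSets d n ls with hS
  set idx := (List.range ls.length).filter (· ∈ D) with hidx
  have hidx_mem : ∀ i ∈ idx, i ∈ D ∧ i < ls.length := fun i hi => by
    simp only [hidx, List.mem_filter, List.mem_range, decide_eq_true_eq] at hi
    exact ⟨hi.2, hi.1⟩
  set tl := idx.flatMap fun i => List.range' (tokenOffset ls i) (ls.getD i []).length with htl
  have hT : S.fst S.T ≠ 0 := by
    have := startMark_tokenOffset ls (le_refl ls.length)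
    rwa [tokenOffset_length] at this
  have hT' : S.fst (S.T + 1) ≠ 0 := by
    change startMark ls (ls.flatten.length + 1) ≠ 0
    rw [startMark, if_pos (.inr rfl)]; exact one_ne_zero
  have hgetD : ∀ i (hi : i < ls.length), ls.getD i [] = ls[i] := fun i hi =>
    List.getD_eq_getElem _ _ hi
  have hmem : ∀ t, t ∈ tl ↔ ∃ i ∈ idx, ∃ hi : i < ls.length, ∃ j < ls[i].length,
      t = tokenOffset ls i + j := by
    intro t
    simp only [htl, List.mem_flatMap, List.mem_range'_1]
    constructor
    · rintro ⟨i, hi, h1, h2⟩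
      have hil := (hidx_mem i hi).2
      rw [hgetD i hil] at h2
      exact ⟨i, hi, hil, t - tokenOffset ls i, by omega, by omega⟩
    · rintro ⟨i, hi, hil, j, hj, rfl⟩
      refine ⟨i, hi, by omega, ?_⟩
      rw [hgetD i hil]; omega
  have hlt : ∀ t ∈ tl, t < S.T := by
    intro t ht
    obtain ⟨i, -, hi, j, hj, rfl⟩ := (hmem t).1 ht
    have h1 := tokenOffset_succ ls hi
    have h2 := tokenOffset_le ls (i + 1)
    change _ < ls.flatten.length
    omega
  have hlabinj : ∀ t ∈ tl, ∀ t' ∈ tl, S.lab t = S.lab t' → t = t' := by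
    intro t ht t' ht' h
    obtain ⟨i, hi, hil, j, hj, rfl⟩ := (hmem t).1 ht
    obtain ⟨i', hi', hil', j', hj', rfl⟩ := (hmem t').1 ht'
    change ls.flatten.getD _ 0 = ls.flatten.getD _ 0 at h
    rw [flatten_getD_tokenOffset ls hil hj, flatten_getD_tokenOffset ls hil' hj'] at h
    have hii : i = i' := by
      by_contra hne
      exact List.disjoint_left.1 (hdisj i (hidx_mem i hi).1 i' (hidx_mem i' hi').1 hil hil' hne)
        (List.getElem_mem hj) (h ▸ List.getElem_mem hj')
    subst hii
    rw [(List.Nodup.getElem_inj_iff (hnd _ (List.getElem_mem hil))).1 h]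
  have hnodup : tl.Nodup := by
    refine List.nodup_flatMap.2 ⟨fun i _ => List.nodup_range', ?_⟩
    refine (List.nodup_range.filter _).imp_of_mem fun {i i'} hi hi' hne t ht ht' => ?_
    have hil := (hidx_mem i hi).2
    have hil' := (hidx_mem i' hi').2
    simp only [List.mem_range'_1, hgetD i hil, hgetD i' hil'] at ht ht'
    exact hne (tokenOffset_add_inj ls hil hil' (j := t - tokenOffset ls i)
      (j' := t - tokenOffset ls i') (by omega) (by omega) (by omega))
  have hlen : tl.length = n := by
    have h1 : (tl.map S.lab).toFinset = Finset.range n := by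
      ext x
      rw [List.mem_toFinset, List.mem_map, Finset.mem_range]
      constructor
      · rintro ⟨t, ht, rfl⟩
        exact TokenSystem.lab_ofSets_lt hn t (hlt t ht)
      · intro hx
        obtain ⟨i, hiD, hi, hxi⟩ := hcov x hx
        obtain ⟨j, hj, rfl⟩ := List.getElem_of_mem hxi
        refine ⟨tokenOffset ls i + j, (hmem _).2 ⟨i, ?_, hi, j, hj, rfl⟩,
          flatten_getD_tokenOffset ls hi hj⟩
        simp only [hidx, List.mem_filter, List.mem_range, decide_eq_true_eq]
        exact ⟨hi, hiD⟩
    have h2 := List.toFinset_card_of_nodup (hnodup.map_on hlabinj)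
    rw [h1, Finset.card_range, List.length_map] at h2
    exact h2.symm
  have hchain : (S.T :: (tl ++ [S.T])).IsChain S.Link := by
    have key : ∀ l : List ℕ, (∀ i ∈ l, i < ls.length) → ∀ t, S.fst (t + 1) ≠ 0 →
        (t :: ((l.flatMap fun i => List.range' (tokenOffset ls i) (ls.getD i []).length) ++
          [S.T])).IsChain S.Link := by
      intro l
      induction l with
      | nil =>
        intro _ t ht
        rw [List.flatMap_nil, List.nil_append, List.isChain_cons_cons]
        exact ⟨.inr ⟨hT, ht⟩, List.isChain_singleton _⟩
      | cons i l ih =>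
        intro hl t ht
        have hi := hl i List.mem_cons_self
        rw [List.flatMap_cons, List.append_assoc, hgetD i hi]
        have ih' := ih fun i' h => hl i' (List.mem_cons_of_mem _ h)
        rcases Nat.eq_zero_or_pos ls[i].length with h0 | h0
        · rw [h0]; exact ih' t ht
        · obtain ⟨m, hm⟩ : ∃ m, ls[i].length = m + 1 := ⟨ls[i].length - 1, by omega⟩
          rw [hm, List.range'_succ, List.cons_append, List.isChain_cons_cons]
          refine ⟨.inr ⟨startMark_tokenOffset ls hi.le, ht⟩,
            TokenSystem.isChain_range' ih' m _ (fun j h1 h2 => ?_) ?_⟩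
          · exact startMark_between ls hi h1 (by omega)
          · rw [add_assoc, ← hm, ← tokenOffset_succ ls hi]
            exact startMark_tokenOffset ls hi
    exact key idx (fun i hi => (hidx_mem i hi).2) S.T hT'
  set c := S.T :: (tl ++ [S.T]) with hc
  have hclen : c.length = n + 2 := by simp [hc, hlen]
  have hcmid : ∀ i (hi : i < n), c.getD (i + 1) S.T = tl[i]'(by omega) := by
    intro i hi
    rw [hc, List.getD_cons_succ, List.getD_append _ _ _ _ (by omega), List.getD_eq_getElem]
  have hcend : ∀ i, n < i → c.getD i S.T = S.T := by
    intro i hi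
    rcases Nat.lt_or_ge i (n + 2) with h | h
    · obtain rfl : i = n + 1 := by omega
      rw [hc, List.getD_cons_succ, List.getD_append_right _ _ _ _ (by omega), hlen]
      simp
    · exact List.getD_eq_default _ _ (by omega)
  have hcl : ∀ i, S.Link (c.getD i S.T) (c.getD (i + 1) S.T) := by
    intro i
    rcases Nat.lt_or_ge (i + 1) (n + 2) with h | h
    · rw [List.getD_eq_getElem _ _ (by omega), List.getD_eq_getElem _ _ (by omega)]
      exact List.isChain_iff_getElem.1 hchain i (by omega)
    · rw [hcend i (by omega), hcend (i + 1) (by omega)]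
      exact .inr ⟨hT, hT'⟩
  have hrealτ : ∀ g (hg : S.Real g), c.getD (g + 1 - 4 * d) S.T =
      tl[g - 4 * d]'(by have h1 : 4 * d ≤ g := hg.1; have h2 : g < 4 * d + n := hg.2; omega) := by
    intro g hg
    have h1 : 4 * d ≤ g := hg.1
    have h2 : g < 4 * d + n := hg.2
    rw [show g + 1 - 4 * d = g - 4 * d + 1 by omega]
    exact hcmid _ (by omega)
  -- Truncated subtraction gives index `0`, the leading `T`, before the real positions; behind them
  -- comes the trailing `T` and then the default value `T`.
  refine ⟨fun g => c.getD (g + 1 - 4 * d) S.T, fun g hg => ?_, fun g hg => ?_, fun g => ?_,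
    fun g g' hg hg' h => ?_⟩
  · simp only [hrealτ g hg]
    exact hlt _ (List.getElem_mem _)
  · rcases Nat.lt_or_ge g (4 * d) with h | h
    · simp only [show g + 1 - 4 * d = 0 by omega]; rfl
    · have : 4 * d + n ≤ g := by by_contra h'; exact hg ⟨h, by change g < 4 * d + n; omega⟩
      exact hcend _ (by omega)
  · rcases Nat.lt_or_ge (g + 1) (4 * d) with h | h
    · simp only [show g + 1 - 4 * d = 0 by omega, show g + 1 + 1 - 4 * d = 0 by omega]
      exact .inr ⟨hT, hT'⟩
    · simp only [show g + 1 + 1 - 4 * d = g + 1 - 4 * d + 1 by omega]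
      exact hcl _
  · simp only [hrealτ g hg, hrealτ g' hg'] at h
    have h1 := hlabinj _ (List.getElem_mem _) _ (List.getElem_mem _) h
    have h2 := (List.Nodup.getElem_inj_iff hnodup).1 h1
    have h3 : 4 * d ≤ g := hg.1
    have h4 : 4 * d ≤ g' := hg'.1
    omega

/-- The sets of the presentation are pairwise different, so indices into the list may replace
members of the family. -/
theorem ExactCoverInstance.yes_iff_hasExactCover (I : ExactCoverInstance) (L : List (List (Fin I.n)))
    (hL : (L.map List.toFinset).Nodup) (hfam : (L.map List.toFinset).toFinset = I.family) :
    I.Yes ↔ HasExactCover I.n (L.map (List.map Fin.val)) := by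
  classical
  have hfam' : ∀ A, A ∈ I.family ↔ ∃ l ∈ L, l.toFinset = A := fun A => by
    rw [← hfam, List.mem_toFinset, List.mem_map]
  constructor
  · rintro ⟨T, hT, hdisj, hcov⟩
    refine ⟨{i | ∃ hi : i < L.length, L[i].toFinset ∈ T}, ?_, fun x hx => ?_⟩
    · rintro i ⟨hi, hiT⟩ j ⟨hj, hjT⟩ hi' hj' hne
      have h1 : L[i].toFinset ≠ L[j].toFinset := fun h => hne <| by
        have := (List.Nodup.getElem_inj_iff hL (i := i) (j := j) (hi := by simpa using hi)
          (hj := by simpa using hj)).1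
        simp only [List.getElem_map] at this
        exact this h
      have h2 := Finset.disjoint_left.1 (hdisj _ hiT _ hjT h1)
      rw [List.getElem_map, List.getElem_map, List.disjoint_left]
      intro x hx hx'
      obtain ⟨a, ha, rfl⟩ := List.mem_map.1 hx
      obtain ⟨b, hb, hab⟩ := List.mem_map.1 hx'
      obtain rfl := Fin.ext hab
      exact h2 (List.mem_toFinset.2 ha) (List.mem_toFinset.2 hb)
    · obtain ⟨A, hA, hxA⟩ := hcov ⟨x, hx⟩
      obtain ⟨l, hl, rfl⟩ := (hfam' A).1 (hT hA)
      obtain ⟨i, hi, rfl⟩ := List.getElem_of_mem hl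
      refine ⟨i, ⟨hi, hA⟩, by simpa using hi, ?_⟩
      rw [List.getElem_map]
      exact List.mem_map.2 ⟨_, List.mem_toFinset.1 hxA, rfl⟩
  · rintro ⟨D, hdisj, hcov⟩
    refine ⟨I.family.filter fun A => ∃ i ∈ D, ∃ hi : i < L.length, L[i].toFinset = A,
      Finset.filter_subset _ _, ?_, fun x => ?_⟩
    · intro A hA B hB hne
      obtain ⟨-, i, hiD, hi, rfl⟩ := Finset.mem_filter.1 hA
      obtain ⟨-, j, hjD, hj, rfl⟩ := Finset.mem_filter.1 hB
      have hij : i ≠ j := fun h => hne (by subst h; rfl)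
      have h1 := hdisj i hiD j hjD (by simpa using hi) (by simpa using hj) hij
      rw [List.getElem_map, List.getElem_map, List.disjoint_left] at h1
      rw [Finset.disjoint_left]
      intro x hx hx'
      exact h1 (List.mem_map.2 ⟨x, List.mem_toFinset.1 hx, rfl⟩)
        (List.mem_map.2 ⟨x, List.mem_toFinset.1 hx', rfl⟩)
    · obtain ⟨i, hiD, hi, hx⟩ := hcov x x.2
      have hi' : i < L.length := by simpa using hi
      rw [List.getElem_map] at hx
      obtain ⟨y, hy, hyx⟩ := List.mem_map.1 hx
      obtain rfl := Fin.ext hyx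
      refine ⟨L[i].toFinset, Finset.mem_filter.2 ⟨(hfam' _).2 ⟨_, List.getElem_mem hi', rfl⟩,
        i, hiD, hi', rfl⟩, List.mem_toFinset.2 hy⟩

/-! ## The instance of `k`-HyperPath -/

namespace TokenSystem

variable {S : TokenSystem}

/-- The word that is handed to an algorithm for `k`-HyperPath. -/
noncomputable def word (S : TokenSystem) : List ℕ :=
  [S.E + S.Q, S.edges.length, S.k] ++ S.edges.flatten

/-- This transfers lists of numbers to a hypergraph on a `Fin` type; all nodes of hyperedges are in
range, so the default value in `F` never matters for them. -/
theorem exists_instance (hd : 1 ≤ S.d) (hlab : ∀ t < S.T, S.lab t < S.n) :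
    ∃ I : HyperPathInstance (S.d + 2), I.k = S.k ∧
      I.size = S.E + S.Q + S.edges.length + S.k ∧ HyperPathInstance.Enc S.word I ∧
      (I.Yes ↔ ∃ f, S.IsPath f ∧ ∀ x < S.k, f x < S.E + S.Q) := by
  have hV : 0 < S.E + S.Q := by
    have : 0 < (S.J + 1) * S.d := Nat.mul_pos (Nat.succ_pos _) hd
    rw [E]; omega
  let F : ℕ → Fin (S.E + S.Q) := fun x => if h : x < S.E + S.Q then ⟨x, h⟩ else ⟨0, hV⟩
  have hF : ∀ x (h : x < S.E + S.Q), F x = ⟨x, h⟩ := fun x h => dif_pos h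
  have hFval : ∀ e ∈ S.edges, (e.map F).map Fin.val = e := by
    intro e he
    rw [List.map_map]
    refine (List.map_congr_left fun x hx => ?_).trans (List.map_id e)
    rw [Function.comp, hF x (lt_of_mem_edges hlab he hx), id]
  have hFimage : ∀ e ∈ S.edges, (e.map F).toFinset.image Fin.val = e.toFinset := by
    intro e he
    conv_rhs => rw [← hFval e he]
    ext y; simp
  have hnd : ∀ e ∈ S.edges, (e.map F).Nodup := fun e he =>
    List.Nodup.of_map Fin.val (by rw [hFval e he]; exact nodup_of_mem_edges hlab he)
  have hLnd : ((S.edges.map (List.map F)).map List.toFinset).Nodup := by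
    rw [List.map_map]
    refine (nodup_edges hlab).map_on fun e he e' he' h => toFinset_injOn_edges hlab he he' ?_
    rw [← hFimage e he, ← hFimage e' he']
    exact congrArg _ h
  let H : UniformHypergraph (Fin (S.E + S.Q)) (S.d + 2) :=
    { edges := ((S.edges.map (List.map F)).map List.toFinset).toFinset
      card_eq := fun A hA => by
        rw [List.mem_toFinset, List.map_map] at hA
        obtain ⟨e, he, rfl⟩ := List.mem_map.1 hA
        rw [Function.comp, List.toFinset_card_of_nodup (hnd e he), List.length_map,
          length_of_mem_edges he] }
  have hH : ∀ A, A ∈ H.edges ↔ ∃ e ∈ S.edges, (e.map F).toFinset = A := fun A => by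
    change A ∈ ((S.edges.map (List.map F)).map List.toFinset).toFinset ↔ _
    rw [List.mem_toFinset, List.map_map, List.mem_map]
    rfl
  refine ⟨⟨S.E + S.Q, H, S.k⟩, rfl, ?_, ⟨S.edges.map (List.map F), ?_, hLnd, rfl, ?_⟩, ?_⟩
  · change S.E + S.Q + H.edges.card + S.k = _
    have : H.edges.card = S.edges.length := by
      rw [List.toFinset_card_of_nodup hLnd, List.length_map, List.length_map]
    rw [this]
  · intro l hl
    obtain ⟨e, he, rfl⟩ := List.mem_map.1 hl
    exact hnd e he
  · rw [word, List.length_map, List.map_flatten, List.map_map]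
    congr 2
    exact ((List.map_congr_left fun e he => hFval e he).trans (List.map_id _)).symm
  · have hwin : ∀ (f : ℕ → ℕ) (v : Fin S.k → Fin (S.E + S.Q)), (∀ x : Fin S.k, f x = v x) →
        ∀ i (hi : i + (S.d + 2) ≤ S.k),
        (Finset.univ.image fun j : Fin (S.d + 2) => v ⟨i + j, by have := j.isLt; omega⟩).image
          Fin.val = (Finset.Ico i (i + (S.d + 2))).image f := by
      intro f v hv i hi
      ext y
      simp only [Finset.mem_image, Finset.mem_univ, true_and, Finset.mem_Ico,
        exists_exists_eq_and]
      constructor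
      · rintro ⟨j, rfl⟩
        exact ⟨i + j, ⟨by omega, by omega⟩, hv ⟨i + j, by omega⟩⟩
      · rintro ⟨x, ⟨h1, h2⟩, rfl⟩
        refine ⟨⟨x - i, by omega⟩, ?_⟩
        rw [← hv]
        exact congrArg f (show i + (x - i) = x by omega)
    constructor
    · rintro ⟨v, hinj, hv⟩
      change Function.Injective (α := Fin S.k) v at hinj
      let f : ℕ → ℕ := fun x => if h : x < S.k then v ⟨x, h⟩ else 0
      have hf : ∀ x (h : x < S.k), f x = v ⟨x, h⟩ := fun x h => dif_pos h
      refine ⟨f, ⟨fun x hx y hy h => ?_, fun i hi => ?_⟩, fun x hx => ?_⟩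
      · rw [hf x hx, hf y hy] at h
        exact congrArg Fin.val (hinj (Fin.ext h))
      · obtain ⟨e, he, h⟩ := (hH _).1 (hv i hi)
        refine ⟨e, he, ?_⟩
        rw [← hFimage e he, h]
        exact (hwin f v (fun x => hf x x.2) i hi).symm
      · rw [hf x hx]; exact (v ⟨x, hx⟩).2
    · rintro ⟨f, ⟨hinj, hf⟩, hlt⟩
      refine ⟨fun x : Fin S.k => ⟨f x, hlt x x.2⟩, fun x y h => ?_, fun i hi => ?_⟩
      · exact Fin.ext (hinj x x.2 y y.2 (congrArg Fin.val h))
      · obtain ⟨e, he, h⟩ := hf i hi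
        refine (hH _).2 ⟨e, he, Finset.image_injective Fin.val_injective ?_⟩
        rw [hFimage e he, ← h]
        exact (hwin f (fun x => ⟨f x, hlt x x.2⟩) (fun x => rfl) i hi).symm

end TokenSystem

/-! ## Expressions for the reduction -/

namespace RAM

namespace Expr

/-- The power `e ^ i`. -/
def pow (e : Expr) : ℕ → Expr
  | 0 => .const 1
  | i + 1 => .mul (e.pow i) e

/-- The remainder of `e` modulo `f`. -/
def mod (e f : Expr) : Expr := .sub e (.mul (.div e f) f)

/-- Whether `e` is nonzero. -/
def sgn (e : Expr) : Expr := .sub (.const 1) (.sub (.const 1) e)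

/-- Whether `e` and `f` are equal. -/
def eq (e f : Expr) : Expr := .sub (.const 1) (.add (.sub e f) (.sub f e))

/-- Whether all expressions of a list are nonzero. -/
def all : List Expr → Expr
  | [] => .const 1
  | e :: l => .mul e (all l)

variable {s : State} {e f : Expr}

theorem eval_pow (i : ℕ) : (e.pow i).eval s = e.eval s ^ i := by
  induction i with
  | zero => rfl
  | succ i ih => rw [pow, eval, ih, pow_succ]

theorem eval_mod : (e.mod f).eval s = e.eval s % f.eval s := by
  simp only [mod, eval]
  have := Nat.div_add_mod' (e.eval s) (f.eval s)
  omega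

/-- Normalizing to `0` and `1` turns an equivalence of conditions into an equality of numbers. -/
theorem eval_sgn_eq_iff : (e.sgn.eval s = f.sgn.eval s) ↔ (e.eval s ≠ 0 ↔ f.eval s ≠ 0) := by
  simp only [sgn, eval]; omega

theorem eval_eq_ne_zero : (e.eq f).eval s ≠ 0 ↔ e.eval s = f.eval s := by
  simp only [eq, eval]; omega

theorem eval_mul_ne_zero : (e.mul f).eval s ≠ 0 ↔ e.eval s ≠ 0 ∧ f.eval s ≠ 0 :=
  Nat.mul_ne_zero_iff

theorem eval_all_ne_zero {l : List Expr} : (all l).eval s ≠ 0 ↔ ∀ e ∈ l, e.eval s ≠ 0 := by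
  induction l with
  | nil => simp [all, eval]
  | cons e l ih => simp only [all, eval, Nat.mul_ne_zero_iff, ih, List.forall_mem_cons]

end Expr

end RAM

/-! ### Arithmetic expressions that decide validity -/

namespace TokenSystem

open RAM

variable {S : TokenSystem}

/-- The memory holds the token system: the parameters in registers and the tokens in arrays. -/
structure Loaded (S : TokenSystem) (s : State) : Prop where
  n : s.reg 1 = S.n
  T : s.reg 3 = S.T
  U : s.reg 8 = S.U
  E : s.reg 10 = S.E
  Q : s.reg 11 = S.Q
  pow_d : s.reg 21 = S.U ^ S.d
  pow_two_d : s.reg 22 = S.U ^ (2 * S.d)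
  lab : s.arr 1 = S.lab
  fst : s.arr 2 = S.fst

/-- The position of token `i` of a state whose time is in register `j`. -/
def posExpr (d j i : ℕ) : Expr := .add (.mul (.var j) (.const d)) (.const i)

/-- Token `i` of a state whose code is in register `c`. -/
def tokExpr (c i : ℕ) : Expr := ((Expr.var c).div ((Expr.var 8).pow i)).mod (.var 8)

/-- Nonzero if the position is real. -/
def realExpr (d j i : ℕ) : Expr :=
  .mul (.sub (.add (posExpr d j i) (.const 1)) (.const (4 * d)))
    (.sub (.add (.const (4 * d)) (.var 1)) (posExpr d j i))

/-- Element node `i` of a state whose time is in register `j` and whose code is in register `c`. -/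
def elExpr (d j c i : ℕ) : Expr :=
  .add (.load 1 (tokExpr c i))
    (.mul (.sub (.const 1) (.sub (.var 3) (tokExpr c i))) (.add (.var 1) (posExpr d j i)))

/-- Nonzero if token `i + 1` may follow token `i`. -/
def linkExpr (c i : ℕ) : Expr :=
  .add (.mul ((Expr.load 2 (tokExpr c (i + 1))).eq (.const 0))
      ((tokExpr c (i + 1)).eq (.add (tokExpr c i) (.const 1))))
    (.mul (.load 2 (tokExpr c (i + 1))) (.load 2 (.add (tokExpr c i) (.const 1))))

/-- Nonzero if the state in register `q` with time and code in registers `j` and `c` is valid. -/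
def validExpr (d q j c : ℕ) : Expr :=
  .mul (.sub (.var 11) (.var q)) <|
  .mul (Expr.all ((List.range (2 * d)).map fun i =>
    (realExpr d j i).sgn.eq (Expr.sub (.var 3) (tokExpr c i)).sgn)) <|
  .mul (Expr.all ((List.range (2 * d - 1)).map (linkExpr c)))
    (Expr.all ((List.range (2 * d)).flatMap fun i => (List.range i).map fun i' =>
      .sub (.const 1) ((elExpr d j c i).eq (elExpr d j c i'))))

section Eval

variable {s : State} {q rq j c i : ℕ}

theorem eval_posExpr (hj : s.reg j = S.time q) :
    (posExpr S.d j i).eval s = S.time q * S.d + i := by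
  simp only [posExpr, Expr.eval, hj]

theorem eval_tokExpr (h : S.Loaded s) (hc : s.reg c = S.code q) :
    (tokExpr c i).eval s = S.tok q i := by
  simp only [tokExpr, Expr.eval_mod, Expr.eval, Expr.eval_pow, hc, h.U, tok, dig]

theorem eval_realExpr (h : S.Loaded s) (hj : s.reg j = S.time q) :
    (realExpr S.d j i).eval s ≠ 0 ↔ S.Real (S.time q * S.d + i) := by
  simp only [realExpr, Expr.eval, eval_posExpr hj, h.n, Nat.mul_ne_zero_iff, Real]
  omega

/-- The case distinction in `elem` becomes a sum: for padding the looked-up label is `0` by `hlabT`,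
and for a token the second summand is multiplied by `0`. -/
theorem eval_elExpr (hlabT : S.lab S.T = 0) (h : S.Loaded s) (hj : s.reg j = S.time q)
    (hc : s.reg c = S.code q) : (elExpr S.d j c i).eval s = S.el q i := by
  simp only [elExpr, Expr.eval, eval_posExpr hj, eval_tokExpr h hc, h.n, h.T, h.lab, el, elem]
  have := tok_le (S := S) q i
  split_ifs with h1
  · rw [show 1 - (S.T - S.tok q i) = 0 by omega, zero_mul, add_zero]
  · rw [show S.tok q i = S.T by omega, hlabT, Nat.sub_self]; simp

theorem eval_linkExpr (h : S.Loaded s) (hc : s.reg c = S.code q) :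
    (linkExpr c i).eval s ≠ 0 ↔ S.Link (S.tok q i) (S.tok q (i + 1)) := by
  have hadd : ∀ a b : ℕ, a + b ≠ 0 ↔ a ≠ 0 ∨ b ≠ 0 := by omega
  rw [linkExpr, Expr.eval, hadd, Expr.eval, Expr.eval, Nat.mul_ne_zero_iff, Nat.mul_ne_zero_iff,
    Expr.eval_eq_ne_zero, Expr.eval_eq_ne_zero]
  simp only [Expr.eval, eval_tokExpr h hc, h.fst, Link]

/-- As `d` is a constant of the program, all checks unfold into a single expression without loops.
-/
theorem eval_validExpr (hlabT : S.lab S.T = 0) (h : S.Loaded s) (hq : s.reg rq = q)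
    (hj : s.reg j = S.time q) (hc : s.reg c = S.code q) :
    (validExpr S.d rq j c).eval s ≠ 0 ↔ S.Valid q := by
  rw [validExpr, Expr.eval_mul_ne_zero, Expr.eval_mul_ne_zero, Expr.eval_mul_ne_zero, Expr.eval_all_ne_zero, Expr.eval_all_ne_zero, Expr.eval_all_ne_zero, Valid]
  refine and_congr ?_ (and_congr ?_ (and_congr ?_ ?_))
  · simp only [Expr.eval, h.Q, hq]; omega
  · simp only [List.forall_mem_map, List.mem_range]
    refine forall₂_congr fun i _ => ?_
    rw [Expr.eval_eq_ne_zero, Expr.eval_sgn_eq_iff, eval_realExpr h hj]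
    simp only [Expr.eval, eval_tokExpr h hc, h.T]
    exact iff_congr Iff.rfl (by omega)
  · simp only [List.forall_mem_map, List.mem_range, eval_linkExpr h hc]
    exact forall_congr' fun i => imp_congr_left (by omega)
  · simp only [List.forall_mem_flatMap, List.forall_mem_map, List.mem_range]
    refine forall₂_congr fun i _ => forall₂_congr fun i' _ => ?_
    rw [← eval_elExpr (i := i) hlabT h hj hc, ← eval_elExpr (i := i') hlabT h hj hc, Ne, Ne,
      ← Expr.eval_eq_ne_zero (s := s), Expr.eval, Expr.eval]
    omega

end Eval

end TokenSystem

/-! ## Listing the hyperedges -/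

namespace RAM

theorem State.reg_setReg (s : State) (x v y : ℕ) :
    (s.setReg x v).reg y = if y = x then v else s.reg y := by
  simp only [State.setReg, Function.update_apply]

theorem State.arr_setReg (s : State) (x v : ℕ) : (s.setReg x v).arr = s.arr := rfl

theorem State.reg_setArr (s : State) (a i v : ℕ) : (s.setArr a i v).reg = s.reg := rfl

theorem State.arr_setArr (s : State) (a i v b : ℕ) :
    (s.setArr a i v).arr b = if b = a then Function.update (s.arr a) i v else s.arr b := by
  simp only [State.setArr, Function.update_apply]

/-- Run the programs of a list one after the other. -/
def Prog.seqAll : List Prog → Prog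
  | [] => .skip
  | p :: l => .seq p (seqAll l)

/-- Append the values of the expressions to array `3`, whose length is in register `19`, and
increase register `20` and cell `1` of array `3`. -/
def emit : List Expr → Prog
  | [] => .seq (.assign 20 (.add (.var 20) (.const 1))) (.store 3 (.const 1) (.var 20))
  | e :: l => .seq (.store 3 (.var 19) e)
      (.seq (.assign 19 (.add (.var 19) (.const 1))) (emit l))

theorem update_getD_length (l : List ℕ) (v : ℕ) :
    Function.update (fun i => l.getD i 0) l.length v = fun i => (l ++ [v]).getD i 0 := by
  funext i
  rw [Function.update_apply]
  split_ifs with h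
  · subst h; simp
  · rcases Nat.lt_or_ge i l.length with h1 | h1
    · rw [List.getD_append _ _ _ _ h1]
    · rw [List.getD_eq_default _ _ h1, List.getD_eq_default _ _ (by simp; omega)]

/-- Array `3` holds a header, the flattening of `l` and `pre`. -/
structure Written (V k : ℕ) (l : List (List ℕ)) (pre : List ℕ) (s : State) : Prop where
  ptr : s.reg 19 = ([V, l.length, k] ++ l.flatten ++ pre).length
  cnt : s.reg 20 = l.length
  out : s.arr 3 = fun i => ([V, l.length, k] ++ l.flatten ++ pre).getD i 0

theorem Written.congr {V k : ℕ} {l : List (List ℕ)} {pre : List ℕ} {s s' : State}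
    (h : Written V k l pre s) (h1 : s'.reg 19 = s.reg 19) (h2 : s'.reg 20 = s.reg 20)
    (h3 : s'.arr 3 = s.arr 3) : Written V k l pre s' :=
  ⟨h1.trans h.ptr, h2.trans h.cnt, h3.trans h.out⟩

theorem Prog.WP.seq {B : ℕ} {p q : Prog} {R Q : State → Prop} {s : State}
    (hp : p.WP B R s) (hq : ∀ s, R s → q.WP B Q s) : (Prog.seq p q).WP B Q s :=
  Prog.WP.mono p hq hp

theorem Prog.WP.assign_seq {B x v : ℕ} {e : Expr} {p : Prog} {Q : State → Prop} {s : State}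
    (he : e.eval s = v) (hv : v ≤ B) (hp : p.WP B Q (s.setReg x v)) :
    (Prog.seq (.assign x e) p).WP B Q s := by
  subst he; exact ⟨hv, hp⟩

/-- A property of the memory that does not depend on the output. -/
def OutputFree (F : State → Prop) : Prop :=
  ∀ s s' : State, (∀ x, x ≠ 19 → x ≠ 20 → s'.reg x = s.reg x) →
    (∀ a, a ≠ 3 → s'.arr a = s.arr a) → F s → F s'

/-- Here `pre` is the part of the current hyperedge already written. The values are determined by
`F`, which survives the output, so they do not change while they are written. -/
theorem wp_emit {B V k : ℕ} {F : State → Prop} (hF : OutputFree F) {l : List (List ℕ)}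
    (hl : l.length + 1 ≤ B) {es : List Expr} : ∀ {vals pre : List ℕ} {s : State},
    (∀ s, F s → es.map (Expr.eval s) = vals) → (∀ v ∈ vals, v ≤ B) →
    3 + (l ++ [pre ++ vals]).flatten.length ≤ B → F s → Written V k l pre s →
    (emit es).WP B (fun s' => F s' ∧ Written V k (l ++ [pre ++ vals]) [] s') s := by
  induction es with
  | nil =>
    intro vals pre s hes _ _ hs hw
    obtain rfl : vals = [] := (hes s hs).symm
    simp only [emit, Prog.WP, Expr.eval, hw.cnt, State.reg_setReg, if_true]
    refine ⟨hl, hl, hF _ _ (fun x _ h => ?_) (fun a h => ?_) hs, ?_, ?_, ?_⟩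
    · simp [State.reg_setArr, State.reg_setReg, h]
    · simp [State.arr_setArr, State.arr_setReg, h]
    · simp [State.reg_setArr, State.reg_setReg, hw.ptr]
    · simp [State.reg_setArr, State.reg_setReg]
    · rw [State.arr_setArr, if_pos rfl, State.arr_setReg, hw.out]
      funext i
      rw [Function.update_apply]
      rcases i with _ | _ | i <;> simp
  | cons e es ih =>
    intro vals pre s hes hv hB hs hw
    obtain ⟨v, vals, rfl⟩ : ∃ v vs, vals = v :: vs := ⟨_, _, (hes s hs).symm⟩
    have hev : ∀ s, F s → e.eval s = v := fun s hs => (List.cons.inj (hes s hs)).1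
    have hw' := hw.ptr
    simp only [emit, Prog.WP, Expr.eval]
    have hlen : ([V, l.length, k] ++ l.flatten ++ pre).length + 1 ≤ B := by
      simp only [List.flatten_append, List.length_append, List.flatten_cons, List.flatten_nil,
        List.length_cons, List.length_nil] at hB ⊢
      omega
    rw [show pre ++ v :: vals = (pre ++ [v]) ++ vals by simp] at hB ⊢
    refine ⟨by rw [hev s hs]; exact hv v List.mem_cons_self, ?_, ih (fun s hs => ?_)
      (fun v' h => hv v' (List.mem_cons_of_mem _ h)) hB ?_ ?_⟩
    · rw [State.reg_setArr, hw']; exact hlen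
    · exact (List.cons.inj (hes s hs)).2
    · refine hF _ _ (fun x h _ => ?_) (fun a h => ?_) hs
      · simp [State.reg_setArr, State.reg_setReg, h]
      · simp [State.arr_setArr, State.arr_setReg, h]
    · refine ⟨?_, ?_, ?_⟩
      · rw [State.reg_setReg, if_pos rfl, State.reg_setArr, hw']
        simp only [List.length_append, List.length_cons, List.length_nil]; omega
      · rw [State.reg_setReg, if_neg (by omega), State.reg_setArr]; exact hw.cnt
      · rw [State.arr_setReg, State.arr_setArr, if_pos rfl, hev s hs, hw', hw.out,
          update_getD_length, List.append_assoc _ pre]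

theorem wp_seqAll_emit {B V k : ℕ} {F : State → Prop} (hF : OutputFree F) :
    ∀ {ess : List (List Expr)} {valss l : List (List ℕ)} {s : State},
    (∀ s, F s → ess.map (List.map (Expr.eval s)) = valss) → (∀ vals ∈ valss, ∀ v ∈ vals, v ≤ B) →
    (l ++ valss).length ≤ B → 3 + (l ++ valss).flatten.length ≤ B → F s → Written V k l [] s →
    (Prog.seqAll (ess.map emit)).WP B (fun s' => F s' ∧ Written V k (l ++ valss) [] s') s := by
  intro ess
  induction ess with
  | nil =>
    intro valss l s hes _ _ _ hs hw
    obtain rfl : valss = [] := (hes s hs).symm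
    rw [List.append_nil]
    exact ⟨hs, hw⟩
  | cons es ess ih =>
    intro valss l s hes hv hB hB' hs hw
    obtain ⟨vals, valss, rfl⟩ : ∃ v vs, valss = v :: vs := ⟨_, _, (hes s hs).symm⟩
    rw [show l ++ vals :: valss = (l ++ [vals]) ++ valss by simp] at hB hB' ⊢
    simp only [List.map_cons, Prog.seqAll, Prog.WP]
    refine Prog.WP.mono _ (fun s' h => ?_) (wp_emit hF (vals := vals) (pre := [])
      (by simp only [List.length_append, List.length_cons, List.length_nil] at hB; omega)
      (fun s hs => (List.cons.inj (hes s hs)).1) (hv vals List.mem_cons_self) ?_ hs hw)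
    · exact ih (fun s hs => (List.cons.inj (hes s hs)).2)
        (fun v h => hv v (List.mem_cons_of_mem _ h)) hB hB' h.1 h.2
    · rw [List.flatten_append, List.length_append] at hB'
      simp only [List.nil_append]; omega

end RAM

/-! ### The program that lists the hyperedges -/

namespace TokenSystem

open RAM

variable {S : TokenSystem}

/-- The nodes of the hyperedge number `u` at the state in register `12`. -/
def edgeExprs₁ (d u : ℕ) : List Expr :=
  .add (.var 10) (.var 12) :: (List.range (d + 1)).map fun i => elExpr d 13 14 (u + i)

/-- The nodes of the hyperedge that contains the states in registers `12` and `16`. -/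
def edgeExprs₂ (d : ℕ) : List Expr :=
  .add (.var 10) (.var 12) :: .add (.var 10) (.var 16) ::
    (List.range d).map fun i => elExpr d 13 14 (d + i)

/-- List the hyperedges that contain the state in register `12` and a following state. -/
def nextProg (d : ℕ) : Prog :=
  .for 15 (.var 21) <|
    .seq (.assign 16 (.add (.mul (.add (.var 13) (.const 1)) (.var 22))
      (.add (.div (.var 14) (.var 21)) (.mul (.var 15) (.var 21))))) <|
    .seq (.assign 17 (.div (.var 16) (.var 22))) <|
    .seq (.assign 18 ((Expr.var 16).mod (.var 22))) <|
    .ite (validExpr d 16 17 18) (emit (edgeExprs₂ d)) .skip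

/-- List all hyperedges. -/
def edgesProg (d : ℕ) : Prog :=
  .for 12 (.var 11) <|
    .seq (.assign 13 (.div (.var 12) (.var 22))) <|
    .seq (.assign 14 ((Expr.var 12).mod (.var 22))) <|
    .ite (validExpr d 12 13 14)
      (.seq (.seqAll (((List.range d).map (edgeExprs₁ d)).map emit)) (nextProg d)) .skip

theorem Loaded.congr {s s' : State} (h : S.Loaded s)
    (hr : ∀ x, x ≤ 11 ∨ 21 ≤ x → s'.reg x = s.reg x) (ha : ∀ a, a ≠ 3 → s'.arr a = s.arr a) :
    S.Loaded s' :=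
  ⟨(hr 1 (by omega)).trans h.n, (hr 3 (by omega)).trans h.T, (hr 8 (by omega)).trans h.U,
    (hr 10 (by omega)).trans h.E, (hr 11 (by omega)).trans h.Q,
    (hr 21 (by omega)).trans h.pow_d, (hr 22 (by omega)).trans h.pow_two_d,
    (ha 1 (by omega)).trans h.lab, (ha 2 (by omega)).trans h.fst⟩

/-- The token system is loaded, and registers `12` to `14` describe the state `q`. -/
structure AtState (S : TokenSystem) (q : ℕ) (s : State) : Prop where
  loaded : S.Loaded s
  state : s.reg 12 = q
  time : s.reg 13 = S.time q
  code : s.reg 14 = S.code q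

theorem AtState.congr {q : ℕ} {s s' : State} (h : S.AtState q s)
    (hr : ∀ x, x ≤ 14 ∨ 21 ≤ x → s'.reg x = s.reg x) (ha : ∀ a, a ≠ 3 → s'.arr a = s.arr a) :
    S.AtState q s' :=
  ⟨h.loaded.congr (fun x hx => hr x (by omega)) ha, (hr 12 (by omega)).trans h.state,
    (hr 13 (by omega)).trans h.time, (hr 14 (by omega)).trans h.code⟩

theorem outputFree_atState (q : ℕ) : OutputFree (S.AtState q) := fun _ _ hr ha h =>
  h.congr (fun x hx => hr x (by omega) (by omega)) ha

theorem length_le_of_prefix {l l' : List (List ℕ)} (h : l <+: l') :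
    l.length ≤ l'.length ∧ l.flatten.length ≤ l'.flatten.length := by
  obtain ⟨t, rfl⟩ := h
  simp

theorem flatMap_range_prefix (f : ℕ → List (List ℕ)) {i N : ℕ} (h : i ≤ N) :
    (List.range i).flatMap f <+: (List.range N).flatMap f := by
  obtain ⟨m, rfl⟩ := Nat.exists_eq_add_of_le h
  rw [List.range_add, List.flatMap_append]
  exact List.prefix_append _ _

theorem flatMap_range_succ (f : ℕ → List (List ℕ)) (i : ℕ) :
    (List.range (i + 1)).flatMap f = (List.range i).flatMap f ++ f i := by
  rw [List.range_succ, List.flatMap_append]; simp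

/-- The output is always a prefix of `S.edges`, and this is how the bounds for the complete list
control every intermediate pointer and counter. -/
theorem wp_nextProg {B q : ℕ} {l : List (List ℕ)} {s : State} (hlabT : S.lab S.T = 0)
    (hlab : ∀ t < S.T, S.lab t < S.n) (hBE : S.E + S.Q ≤ B)
    (hBlen : S.edges.length ≤ B) (hBflat : 3 + S.edges.flatten.length ≤ B)
    (hBnext : S.Q + S.U ^ (2 * S.d) ≤ B) (hBU : S.U ^ S.d ≤ B) (hq : S.Valid q)
    (hl : l ++ (List.range (S.U ^ S.d)).flatMap (S.edgesNext q) <+: S.edges)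
    (hs : S.AtState q s) (hw : Written (S.E + S.Q) S.k l [] s) :
    (nextProg S.d).WP B (fun s' => S.Loaded s' ∧ s'.reg 12 = q ∧ Written (S.E + S.Q) S.k
      (l ++ (List.range (S.U ^ S.d)).flatMap (S.edgesNext q)) [] s') s := by
  refine Prog.WP.for (N := S.U ^ S.d) (fun a s => S.AtState q s ∧ s.reg 15 = a ∧
    Written (S.E + S.Q) S.k (l ++ (List.range a).flatMap (S.edgesNext q)) [] s) hBU ?_ ?_ ?_ ?_
  · refine ⟨hs.congr (fun x hx => ?_) fun _ _ => rfl, ?_, ?_⟩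
    · rw [State.reg_setReg, if_neg (by omega)]
    · rw [State.reg_setReg, if_pos rfl]
    · simpa using hw.congr (s' := s.setReg 15 0) rfl rfl rfl
  · exact fun a s h => ⟨h.2.1, h.1.loaded.pow_d⟩
  · rintro a ha s ⟨hs, h15, hw⟩
    -- The candidate may have time `J` and then exceed all states; its validity is tested only after
    -- it has been written, so `B` has to allow for one extra layer of codes.
    have hnB : S.next q a ≤ B := by
      have h1 := next_code_lt (S := S) (q := q) ha
      have h2 := Nat.mul_le_mul_right (S.U ^ (2 * S.d)) (Nat.succ_le_of_lt (time_lt hq))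
      rw [Nat.succ_eq_add_one] at h2
      rw [next]
      rw [Q] at hBnext
      omega
    refine Prog.WP.assign_seq (v := S.next q a) ?_ hnB <|
      Prog.WP.assign_seq (v := S.next q a / S.U ^ (2 * S.d)) ?_ ((Nat.div_le_self _ _).trans hnB) <|
      Prog.WP.assign_seq (v := S.next q a % S.U ^ (2 * S.d)) ?_ ((Nat.mod_le _ _).trans hnB) ?_
    · simp only [Expr.eval, hs.time, hs.code, hs.loaded.pow_two_d, hs.loaded.pow_d, h15, next]
    · simp [Expr.eval, State.reg_setReg, hs.loaded.pow_two_d]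
    · simp [Expr.eval_mod, Expr.eval, State.reg_setReg, hs.loaded.pow_two_d]
    set s₁ := ((s.setReg 16 (S.next q a)).setReg 17 (S.next q a / S.U ^ (2 * S.d))).setReg 18
      (S.next q a % S.U ^ (2 * S.d)) with hs₁
    have hs₁q : S.AtState q s₁ := hs.congr (fun x hx => by
      simp only [hs₁, State.reg_setReg]
      rw [if_neg (by omega), if_neg (by omega), if_neg (by omega)]) fun _ _ => rfl
    have h₁15 : s₁.reg 15 = a := by simp [hs₁, State.reg_setReg, h15]
    have h₁16 : s₁.reg 16 = S.next q a := by simp [hs₁, State.reg_setReg]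
    have h₁w : Written (S.E + S.Q) S.k (l ++ (List.range a).flatMap (S.edgesNext q)) [] s₁ :=
      hw.congr (by simp [hs₁, State.reg_setReg]) (by simp [hs₁, State.reg_setReg]) rfl
    have hvalid := eval_validExpr (rq := 16) (j := 17) (c := 18) (q := S.next q a) hlabT
      hs₁q.loaded h₁16 (by simp [hs₁, State.reg_setReg, TokenSystem.time])
      (by simp [hs₁, State.reg_setReg, TokenSystem.code])
    have hfin : ∀ l' s', l' = l ++ (List.range a).flatMap (S.edgesNext q) ++ S.edgesNext q a →
        S.AtState q s' → s'.reg 15 = a → Written (S.E + S.Q) S.k l' [] s' →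
        s'.reg 15 = a ∧ S.AtState q (s'.setReg 15 (a + 1)) ∧
          (s'.setReg 15 (a + 1)).reg 15 = a + 1 ∧ Written (S.E + S.Q) S.k
          (l ++ (List.range (a + 1)).flatMap (S.edgesNext q)) [] (s'.setReg 15 (a + 1)) := by
      rintro l' s' rfl h1 h2 h3
      rw [List.append_assoc, ← flatMap_range_succ] at h3
      refine ⟨h2, h1.congr (fun x hx => ?_) fun _ _ => rfl, ?_, h3.congr rfl rfl rfl⟩
      · rw [State.reg_setReg, if_neg (by omega)]
      · rw [State.reg_setReg, if_pos rfl]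
    have hpre := (List.prefix_append_right_inj l).2
      (flatMap_range_prefix (S.edgesNext q) (Nat.succ_le_of_lt ha))
    rw [Nat.succ_eq_add_one, flatMap_range_succ, ← List.append_assoc] at hpre
    have hpre := hpre.trans hl
    have hpl := length_le_of_prefix hpre
    refine ⟨fun he => ?_, fun he => ?_⟩
    · have hv := hvalid.1 he
      have hedge : S.edgesNext q a = [S.edge₂ q a] := if_pos hv
      rw [hedge] at hpre hpl
      have hmem : S.edge₂ q a ∈ S.edges := hpre.subset (by simp)
      refine Prog.WP.mono _ (fun s' h => ?_) (wp_emit (B := B)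
        (F := fun s => S.AtState q s ∧ s.reg 15 = a ∧ s.reg 16 = S.next q a) ?_
        (l := l ++ (List.range a).flatMap (S.edgesNext q)) (pre := []) (vals := S.edge₂ q a)
        ?_ ?_ ?_ ?_ ⟨hs₁q, h₁15, h₁16⟩ h₁w)
      · exact hfin _ s' (by rw [hedge]; rfl) h.1.1 h.1.2.1 h.2
      · rintro s s' hr ha ⟨h1, h2, h3⟩
        exact ⟨outputFree_atState q s s' hr ha h1, (hr 15 (by omega) (by omega)).trans h2,
          (hr 16 (by omega) (by omega)).trans h3⟩
      · have := hpl.1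
        rw [List.length_append, List.length_singleton] at this
        omega
      · rintro s ⟨h1, h2, h3⟩
        simp only [edgeExprs₂, edge₂, List.map_cons, Expr.eval, h1.loaded.E, h1.state, h3,
          List.map_map]
        congr 2
        exact List.map_congr_left fun i _ => eval_elExpr hlabT h1.loaded h1.time h1.code
      · exact fun v hv => (lt_of_mem_edges hlab hmem hv).le.trans hBE
      · simp only [List.nil_append]
        have := hpl.2
        omega
    · have hv : ¬ S.Valid (S.next q a) := fun h => hvalid.2 h he
      have hedge : S.edgesNext q a = [] := if_neg hv
      exact hfin _ s₁ (by rw [hedge, List.append_nil]) hs₁q h₁15 h₁w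
  · rintro s ⟨h1, -, h3⟩
    exact ⟨h1.loaded, h1.state, h3⟩

theorem wp_edgesProg {B : ℕ} {s : State} (hlabT : S.lab S.T = 0)
    (hlab : ∀ t < S.T, S.lab t < S.n) (hBE : S.E + S.Q ≤ B)
    (hBlen : S.edges.length ≤ B) (hBflat : 3 + S.edges.flatten.length ≤ B)
    (hBnext : S.Q + S.U ^ (2 * S.d) ≤ B) (hBU : S.U ^ S.d ≤ B)
    (hs : S.Loaded s) (hw : Written (S.E + S.Q) S.k [] [] s) :
    (edgesProg S.d).WP B (fun s' => Written (S.E + S.Q) S.k S.edges [] s') s := by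
  refine Prog.WP.for (N := S.Q) (fun q s => S.Loaded s ∧ s.reg 12 = q ∧
    Written (S.E + S.Q) S.k ((List.range q).flatMap S.edgesAt) [] s) (by omega) ?_ ?_ ?_ ?_
  · refine ⟨hs.congr (fun x hx => ?_) fun _ _ => rfl, ?_, hw.congr rfl rfl rfl⟩
    · rw [State.reg_setReg, if_neg (by omega)]
    · rw [State.reg_setReg, if_pos rfl]
  · exact fun q s h => ⟨h.2.1, h.1.Q⟩
  · rintro q hq s ⟨hs, h12, hw⟩
    have hqB : q ≤ B := by omega
    refine Prog.WP.assign_seq (v := q / S.U ^ (2 * S.d)) ?_ ((Nat.div_le_self _ _).trans hqB) <|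
      Prog.WP.assign_seq (v := q % S.U ^ (2 * S.d)) ?_ ((Nat.mod_le _ _).trans hqB) ?_
    · simp [Expr.eval, h12, hs.pow_two_d]
    · simp [Expr.eval_mod, Expr.eval, State.reg_setReg, h12, hs.pow_two_d]
    set s₁ := (s.setReg 13 (q / S.U ^ (2 * S.d))).setReg 14 (q % S.U ^ (2 * S.d)) with hs₁
    have hs₁q : S.AtState q s₁ := by
      refine ⟨hs.congr (fun x hx => ?_) fun _ _ => rfl, ?_, ?_, ?_⟩
      · simp only [hs₁, State.reg_setReg]
        rw [if_neg (by omega), if_neg (by omega)]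
      · simp [hs₁, State.reg_setReg, h12]
      · simp [hs₁, State.reg_setReg, TokenSystem.time]
      · simp [hs₁, State.reg_setReg, TokenSystem.code]
    have h₁w : Written (S.E + S.Q) S.k ((List.range q).flatMap S.edgesAt) [] s₁ :=
      hw.congr (by simp [hs₁, State.reg_setReg]) (by simp [hs₁, State.reg_setReg]) rfl
    have hvalid := eval_validExpr (rq := 12) (j := 13) (c := 14) hlabT hs₁q.loaded hs₁q.state
      hs₁q.time hs₁q.code
    have hfin : ∀ l', l' = (List.range q).flatMap S.edgesAt ++ S.edgesAt q →
        ∀ s', S.Loaded s' ∧ s'.reg 12 = q ∧ Written (S.E + S.Q) S.k l' [] s' →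
        s'.reg 12 = q ∧ S.Loaded (s'.setReg 12 (q + 1)) ∧
          (s'.setReg 12 (q + 1)).reg 12 = q + 1 ∧ Written (S.E + S.Q) S.k
          ((List.range (q + 1)).flatMap S.edgesAt) [] (s'.setReg 12 (q + 1)) := by
      rintro l' rfl s' ⟨h1, h2, h3⟩
      rw [← flatMap_range_succ] at h3
      refine ⟨h2, h1.congr (fun x hx => ?_) fun _ _ => rfl, ?_, h3.congr rfl rfl rfl⟩
      · rw [State.reg_setReg, if_neg (by omega)]
      · rw [State.reg_setReg, if_pos rfl]
    have hpre := flatMap_range_prefix S.edgesAt (Nat.succ_le_of_lt hq)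
    rw [Nat.succ_eq_add_one, flatMap_range_succ] at hpre
    change _ <+: S.edges at hpre
    refine ⟨fun he => ?_, fun he => ?_⟩
    · have hv := hvalid.1 he
      have hedge : S.edgesAt q = (List.range S.d).map (S.edge₁ q) ++
          (List.range (S.U ^ S.d)).flatMap (S.edgesNext q) := if_pos hv
      rw [hedge, ← List.append_assoc] at hpre
      have hpre' := (List.prefix_append _ _).trans hpre
      have hpl := length_le_of_prefix hpre'
      refine Prog.WP.seq (wp_seqAll_emit (B := B) (outputFree_atState q)
        (valss := (List.range S.d).map (S.edge₁ q)) ?_ ?_ (by omega) (by omega) hs₁q h₁w)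
        (fun s' h => ?_)
      rotate_left 2
      · exact Prog.WP.mono _ (hfin _ (by rw [hedge, List.append_assoc])) (wp_nextProg hlabT hlab hBE hBlen hBflat hBnext hBU hv hpre
          h.1 h.2)
      · intro s h1
        rw [List.map_map]
        refine List.map_congr_left fun u _ => ?_
        simp only [Function.comp, edgeExprs₁, edge₁, List.map_cons, Expr.eval, h1.loaded.E, h1.state,
          List.map_map]
        congr 1
        exact List.map_congr_left fun i _ => eval_elExpr hlabT h1.loaded h1.time h1.code
      · intro e he v hv
        exact (lt_of_mem_edges hlab (hpre'.subset (List.mem_append_right _ he)) hv).le.trans hBE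
    · have hv : ¬ S.Valid q := fun h => hvalid.2 h he
      have hedge : S.edgesAt q = [] := if_neg hv
      exact hfin _ (by rw [hedge, List.append_nil]) s₁ ⟨hs₁q.loaded, hs₁q.state, h₁w⟩
  · exact fun s h => h.2.2

end TokenSystem

/-! ## Reading the input -/

/-- The presentation of the sets `ls` over the ground set of `n` elements. -/
def setWord (n : ℕ) (ls : List (List ℕ)) : List ℕ :=
  [n, ls.length] ++ (ls.map fun l => l.length :: l).flatten

theorem tokenOffset_map_cons (ls : List (List ℕ)) {i : ℕ} (hi : i ≤ ls.length) :
    tokenOffset (ls.map fun l => l.length :: l) i = i + tokenOffset ls i := by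
  induction i with
  | zero => rfl
  | succ i ih =>
    rw [tokenOffset_succ _ (by simpa using hi), tokenOffset_succ ls hi, ih (by omega)]
    simp only [List.getElem_map, List.length_cons]
    omega

/-- In front of set number `i` there are two header cells, `i` cardinalities and all earlier
elements. -/
theorem setWord_getD_length (n : ℕ) (ls : List (List ℕ)) {i : ℕ} (hi : i < ls.length) :
    (setWord n ls).getD (2 + i + tokenOffset ls i) 0 = ls[i].length := by
  have h := flatten_getD_tokenOffset (ls.map fun l => l.length :: l) (i := i) (j := 0)
    (by simpa using hi) (by simp)
  rw [tokenOffset_map_cons ls hi.le] at h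
  rw [setWord, List.getD_append_right _ _ _ _ (by simp; omega)]
  simpa [show 2 + i + tokenOffset ls i - 2 = i + tokenOffset ls i by omega] using h

theorem setWord_getD_elem (n : ℕ) (ls : List (List ℕ)) {i j : ℕ} (hi : i < ls.length)
    (hj : j < ls[i].length) :
    (setWord n ls).getD (2 + i + tokenOffset ls i + 1 + j) 0 =
      ls.flatten.getD (tokenOffset ls i + j) 0 := by
  have h := flatten_getD_tokenOffset (ls.map fun l => l.length :: l) (i := i) (j := j + 1)
    (by simpa using hi) (by simpa using hj)
  rw [tokenOffset_map_cons ls hi.le] at h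
  rw [flatten_getD_tokenOffset ls hi hj, setWord,
    List.getD_append_right _ _ _ _ (by simp; omega)]
  simpa [show 2 + i + tokenOffset ls i + 1 + j - 2 = i + tokenOffset ls i + (j + 1) by omega]
    using h

namespace RAM

theorem Prog.WP.store_seq {B a x v : ℕ} {i e : Expr} {p : Prog} {Q : State → Prop} {s : State}
    (hi : i.eval s = x) (he : e.eval s = v) (hv : v ≤ B) (hp : p.WP B Q (s.setArr a x v)) :
    (Prog.seq (.store a i e) p).WP B Q s := by
  subst hi he; exact ⟨hv, hp⟩

/-- Read the elements of one set. -/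
def readSet : Prog :=
  .for 7 (.var 6) <|
    .seq (.store 1 (.var 3) (.load 0 (.var 4))) <|
    .seq (.assign 3 (.add (.var 3) (.const 1))) (.assign 4 (.add (.var 4) (.const 1)))

/-- Read all sets. -/
def readSets : Prog :=
  .for 5 (.var 2) <|
    .seq (.store 2 (.var 3) (.const 1)) <|
    .seq (.assign 6 (.load 0 (.var 4))) <|
    .seq (.assign 4 (.add (.var 4) (.const 1))) readSet

/-- The memory after the headers of `c` sets and `x` of their elements have been read. -/
structure HasRead (n : ℕ) (ls : List (List ℕ)) (c x : ℕ) (s : State) : Prop where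
  num : s.reg 1 = n
  m : s.reg 2 = ls.length
  T : s.reg 3 = x
  pos : s.reg 4 = 2 + c + x
  cnt : s.reg 20 = 0
  input : s.arr 0 = fun i => (setWord n ls).getD i 0
  lab : s.arr 1 = fun t => if t < x then ls.flatten.getD t 0 else 0
  fst : s.arr 2 = fun t => if ∃ i < c, t = tokenOffset ls i then 1 else 0
  out : s.arr 3 = fun _ => 0

theorem HasRead.congr {n : ℕ} {ls : List (List ℕ)} {c x : ℕ} {s s' : State}
    (h : HasRead n ls c x s) (hr : ∀ y, y ≤ 4 ∨ 8 ≤ y → s'.reg y = s.reg y) (ha : s'.arr = s.arr) :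
    HasRead n ls c x s' :=
  ⟨(hr 1 (by omega)).trans h.num, (hr 2 (by omega)).trans h.m, (hr 3 (by omega)).trans h.T,
    (hr 4 (by omega)).trans h.pos, (hr 20 (by omega)).trans h.cnt, ha ▸ h.input, ha ▸ h.lab,
    ha ▸ h.fst, ha ▸ h.out⟩

theorem wp_readSet {B n i : ℕ} {ls : List (List ℕ)} {s : State} (hn : ∀ l ∈ ls, ∀ x ∈ l, x < n)
    (hnB : n ≤ B) (hB : 2 + ls.length + ls.flatten.length ≤ B) (hi : i < ls.length)
    (hs : HasRead n ls (i + 1) (tokenOffset ls i) s) (h5 : s.reg 5 = i)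
    (h6 : s.reg 6 = ls[i].length) :
    readSet.WP B (fun s' => HasRead n ls (i + 1) (tokenOffset ls (i + 1)) s' ∧ s'.reg 5 = i) s := by
  have hoff := tokenOffset_succ ls hi
  have hle := tokenOffset_le ls (i + 1)
  refine Prog.WP.for (N := ls[i].length) (fun j s => HasRead n ls (i + 1) (tokenOffset ls i + j) s ∧
    s.reg 5 = i ∧ s.reg 6 = ls[i].length ∧ s.reg 7 = j) (by omega) ?_ ?_ ?_ ?_
  · refine ⟨hs.congr (fun y hy => ?_) rfl, ?_, ?_, ?_⟩
    · rw [State.reg_setReg, if_neg (by omega)]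
    all_goals simp [State.reg_setReg, h5, h6]
  · exact fun j s h => ⟨h.2.2.2, h.2.2.1⟩
  · rintro j hj s ⟨h, h5, h6, h7⟩
    have hread : (Expr.load 0 (.var 4)).eval s = ls.flatten.getD (tokenOffset ls i + j) 0 := by
      simp only [Expr.eval, h.input, h.pos]
      rw [← setWord_getD_elem n ls hi hj]
      congr 1; omega
    refine Prog.WP.store_seq h.T hread ?_ <|
      Prog.WP.assign_seq (v := tokenOffset ls i + j + 1) ?_ (by omega) ?_
    · rw [flatten_getD_tokenOffset ls hi hj]
      exact (hn _ (List.getElem_mem hi) _ (List.getElem_mem hj)).le.trans hnB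
    · simp [Expr.eval, State.reg_setArr, h.T]
    · refine ⟨?_, ?_⟩
      · simp only [Expr.eval, State.reg_setReg, State.reg_setArr, h.pos, Nat.reduceEqDiff,
          if_false]
        omega
      · simp only [Expr.eval, State.reg_setReg, State.reg_setArr, h.pos, Nat.reduceEqDiff,
          if_false]
        refine ⟨by simp [h7], ⟨?_, ?_, ?_, ?_, ?_, ?_, ?_, ?_, ?_⟩, ?_, ?_, ?_⟩
        all_goals simp only [State.reg_setReg, State.reg_setArr, State.arr_setReg,
          State.arr_setArr, Nat.reduceEqDiff, if_false, if_true, h.num, h.m, h.cnt, h.input, h.fst,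
          h.out, h5, h6]
        · rfl
        · omega
        · rw [h.lab]
          funext t
          rw [Function.update_apply]
          rcases lt_trichotomy t (tokenOffset ls i + j) with h1 | h1 | h1
          · rw [if_neg (by omega), if_pos h1, if_pos (by omega)]
          · subst h1; rw [if_pos rfl, if_pos (by omega)]
          · rw [if_neg (by omega), if_neg (by omega), if_neg (by omega)]
  · rintro s ⟨h, h5, -, -⟩
    rw [← hoff] at h
    exact ⟨h, h5⟩

/-- With `c = ls.length` this also covers the mark behind the last set. -/
theorem HasRead.mark {n c x : ℕ} {ls : List (List ℕ)} {s : State} (h : HasRead n ls c x s)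
    (hx : x = tokenOffset ls c) :
    (s.setArr 2 x 1).arr 2 = fun t => if ∃ i < c + 1, t = tokenOffset ls i then 1 else 0 := by
  rw [State.arr_setArr, if_pos rfl, h.fst]
  funext t
  rw [Function.update_apply]
  by_cases h1 : ∃ i < c, t = tokenOffset ls i
  · have h2 : ∃ i < c + 1, t = tokenOffset ls i := by
      obtain ⟨i, hi, ht⟩ := h1; exact ⟨i, by omega, ht⟩
    rw [if_pos h1, if_pos h2, ite_self]
  · rw [if_neg h1]
    refine if_congr ⟨fun ht => ⟨c, by omega, ht.trans hx⟩, ?_⟩ rfl rfl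
    rintro ⟨i, hi, ht⟩
    rcases Nat.lt_succ_iff_lt_or_eq.1 hi with h3 | rfl
    · exact (h1 ⟨i, h3, ht⟩).elim
    · exact ht.trans hx.symm

theorem wp_readSets {B n : ℕ} {ls : List (List ℕ)} {s : State} (hn : ∀ l ∈ ls, ∀ x ∈ l, x < n)
    (hnB : n ≤ B) (hB : 2 + ls.length + ls.flatten.length ≤ B) (hs : HasRead n ls 0 0 s) :
    readSets.WP B (fun s' => HasRead n ls ls.length ls.flatten.length s') s := by
  refine Prog.WP.for (N := ls.length) (fun i s => HasRead n ls i (tokenOffset ls i) s ∧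
    s.reg 5 = i) (by omega) ?_ ?_ ?_ ?_
  · refine ⟨hs.congr (fun y hy => ?_) rfl, ?_⟩
    · rw [State.reg_setReg, if_neg (by omega)]
    · simp [State.reg_setReg]
  · exact fun j s h => ⟨h.2, h.1.m⟩
  · rintro i hi s ⟨h, h5⟩
    have hle := tokenOffset_le ls (i + 1)
    have hoff := tokenOffset_succ ls hi
    refine Prog.WP.store_seq (v := 1) h.T rfl (by omega) <|
      Prog.WP.assign_seq (v := ls[i].length) ?_ (by omega) <|
      Prog.WP.assign_seq (v := 2 + i + tokenOffset ls i + 1) ?_ (by omega) <|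
      Prog.WP.mono _ ?_ (wp_readSet hn hnB hB hi (s := _) ?_ ?_ ?_)
    · simp only [Expr.eval, State.reg_setArr, State.arr_setArr, h.pos, h.input]
      simp only [OfNat.zero_ne_ofNat, if_false]
      exact setWord_getD_length n ls hi
    · simp [Expr.eval, State.reg_setReg, State.reg_setArr, h.pos]
    · rintro s' ⟨h1, h2⟩
      refine ⟨h2, h1.congr (fun y hy => ?_) rfl, ?_⟩
      · rw [State.reg_setReg, if_neg (by omega)]
      · simp [State.reg_setReg]
    · refine ⟨?_, ?_, ?_, ?_, ?_, ?_, ?_, h.mark rfl, ?_⟩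
      all_goals simp only [State.reg_setReg, State.reg_setArr, State.arr_setReg,
        State.arr_setArr, Nat.reduceEqDiff, if_false, if_true, h.num, h.m, h.T, h.cnt, h.input,
        h.lab, h.out]
      · omega
    · simp [State.reg_setReg, State.reg_setArr, h5]
    · simp [State.reg_setReg]
  · rintro s ⟨h, -⟩
    rwa [tokenOffset_length] at h

end RAM

/-! ### The complete reduction program -/

namespace TokenSystem

open RAM

/-- The program that turns a presentation of an Exact Cover instance into a presentation of an
instance of `k`-HyperPath. -/
def reduction (d : ℕ) : Prog :=
  .seq (.assign 1 (.load 0 (.const 0))) <|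
  .seq (.assign 2 (.load 0 (.const 1))) <|
  .seq (.assign 4 (.const 2)) <|
  .seq readSets <|
  .seq (.store 2 (.var 3) (.const 1)) <|
  .seq (.store 2 (.add (.var 3) (.const 1)) (.const 1)) <|
  .seq (.assign 8 (.add (.var 3) (.const 1))) <|
  .seq (.assign 9 (.add (.div (.var 1) (.const d)) (.const 8))) <|
  .seq (.assign 10 (.add (.var 1) (.mul (.add (.var 9) (.const 1)) (.const d)))) <|
  .seq (.assign 21 ((Expr.var 8).pow d)) <|
  .seq (.assign 22 ((Expr.var 8).pow (2 * d))) <|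
  .seq (.assign 11 (.mul (.var 9) (.var 22))) <|
  .seq (.store 3 (.const 0) (.add (.var 10) (.var 11))) <|
  .seq (.store 3 (.const 2)
    (.sub (.mul (.add (.var 9) (.const 1)) (.const (d + 1))) (.const 1))) <|
  .seq (.assign 19 (.const 3)) (edgesProg d)

theorem wp_reduction {B d n : ℕ} {ls : List (List ℕ)} (S : TokenSystem) (hS : S = ofSets d n ls)
    (hn : ∀ l ∈ ls, ∀ x ∈ l, x < n) (hB : 2 + n + ls.length + ls.flatten.length ≤ B)
    (hBJ : S.J ≤ B) (hBk : S.k ≤ B) (hBE : S.E + S.Q ≤ B)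
    (hBlen : S.edges.length ≤ B) (hBflat : 3 + S.edges.flatten.length ≤ B)
    (hBnext : S.Q + S.U ^ (2 * S.d) ≤ B) (hBU : S.U ^ S.d ≤ B) :
    (reduction d).WP B (fun s => s.arr 3 = fun i => S.word.getD i 0)
      (State.init (setWord n ls)) := by
  have hSd : S.d = d := by rw [hS]; rfl
  have hSn : S.n = n := by rw [hS]; rfl
  have hST : S.T = ls.flatten.length := by rw [hS]; rfl
  have hSlab : S.lab = fun t => ls.flatten.getD t 0 := by rw [hS]; rfl
  have hSfst : S.fst = startMark ls := by rw [hS]; rfl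
  refine Prog.WP.assign_seq (v := n) rfl (by omega) <|
    Prog.WP.assign_seq (v := ls.length) rfl (by omega) <|
    Prog.WP.assign_seq (v := 2) rfl (by omega) <|
    Prog.WP.seq (wp_readSets hn (by omega) (by omega) ?_) (fun s h => ?_)
  rotate_left
  · refine Prog.WP.store_seq (v := 1) h.T rfl (by omega) <|
      Prog.WP.store_seq (x := S.T + 1) (v := 1) ?_ rfl (by omega) <|
      Prog.WP.assign_seq (v := S.U) ?_ (by rw [U]; omega) <|
      Prog.WP.assign_seq (v := S.J) ?_ hBJ <|
      Prog.WP.assign_seq (v := S.E) ?_ (by omega) <|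
      Prog.WP.assign_seq (v := S.U ^ S.d) ?_ (by omega) <|
      Prog.WP.assign_seq (v := S.U ^ (2 * S.d)) ?_ (by omega) <|
      Prog.WP.assign_seq (v := S.Q) ?_ (by omega) <|
      Prog.WP.store_seq (x := 0) (v := S.E + S.Q) rfl ?_ hBE <|
      Prog.WP.store_seq (x := 2) (v := S.k) rfl ?_ hBk <|
      Prog.WP.assign_seq (v := 3) rfl (by omega) ?_
    · simp [Expr.eval, State.reg_setArr, h.T, hST]
    · simp [Expr.eval, State.reg_setArr, h.T, U, hST]
    · simp [Expr.eval, State.reg_setReg, State.reg_setArr, h.num, J, hSn, hSd]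
    · simp [Expr.eval, State.reg_setReg, State.reg_setArr, h.num, E, hSn, hSd]
    · simp [Expr.eval, Expr.eval_pow, State.reg_setReg, hSd]
    · simp [Expr.eval, Expr.eval_pow, State.reg_setReg, hSd]
    · simp [Expr.eval, State.reg_setReg, Q]
    · simp [Expr.eval, State.reg_setReg]
    · simp [Expr.eval, State.reg_setReg, State.reg_setArr, k, hSd]
    · rw [← hSd]
      refine Prog.WP.mono _ (fun s h => ?_) (wp_edgesProg (S := S) ?_ ?_ hBE hBlen hBflat hBnext hBU
        ⟨?_, ?_, ?_, ?_, ?_, ?_, ?_, ?_, ?_⟩ ⟨?_, ?_, ?_⟩)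
      · rw [h.out, word, List.append_nil]
      · rw [hSlab, hST]; exact List.getD_eq_default _ _ le_rfl
      · subst hS; exact lab_ofSets_lt hn
      · simp [State.reg_setReg, State.reg_setArr, h.num, hSn]
      · simp [State.reg_setReg, State.reg_setArr, h.T, hST]
      · simp [State.reg_setReg, State.reg_setArr]
      · simp [State.reg_setReg, State.reg_setArr]
      · simp [State.reg_setReg, State.reg_setArr]
      · simp [State.reg_setReg, State.reg_setArr]
      · simp [State.reg_setReg, State.reg_setArr]
      · simp only [State.arr_setReg, State.arr_setArr, Nat.reduceEqDiff, if_false, h.lab, hSlab]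
        funext t
        split_ifs with ht
        · rfl
        · exact (List.getD_eq_default _ _ (by omega)).symm
      · have hm := h.mark (tokenOffset_length ls).symm
        simp only [State.arr_setReg, State.arr_setArr, Nat.reduceEqDiff, if_false, if_true] at hm ⊢
        rw [hm, hSfst, hST]
        funext t
        rw [Function.update_apply, startMark]
        simp only [Nat.lt_succ_iff]
        by_cases h1 : t = ls.flatten.length + 1
        · rw [if_pos h1, if_pos (.inr h1)]
        · rw [if_neg h1]
          exact if_congr (or_iff_left h1).symm rfl rfl
      · simp [State.reg_setReg]
      · simp [State.reg_setReg, State.reg_setArr, h.cnt]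
      · simp only [State.arr_setReg, State.arr_setArr, Nat.reduceEqDiff, if_false, if_true, h.out]
        funext i
        simp only [Function.update_apply]
        -- The header: cells `0` and `2` have been stored, and cell `1`, the number of hyperedges,
        -- is still `0`.
        rcases i with _ | _ | _ | i <;> simp
  · refine ⟨rfl, rfl, rfl, rfl, rfl, rfl, ?_, ?_, rfl⟩
    · funext t; simp [State.setReg, State.init]
    · funext t; simp [State.setReg, State.init]

/-! ### The memory that the reduction does not use -/

theorem writesOnly_emit (l : List Expr) :
    (emit l).WritesOnly (fun x => x % 40 ≠ 0) (· < 4) := by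
  induction l with
  | nil => simp [emit, Prog.WritesOnly]
  | cons e l ih => simpa [emit, Prog.WritesOnly] using ih

theorem writesOnly_seqAll_emit (l : List (List Expr)) :
    (Prog.seqAll (l.map emit)).WritesOnly (fun x => x % 40 ≠ 0) (· < 4) := by
  induction l with
  | nil => trivial
  | cons e l ih => exact ⟨writesOnly_emit e, ih⟩

/-- The registers `40 * x` and the arrays from `4` on keep their initial value `0`. With array `3`
as its input, a program renamed along `40 * ·` and `· + 3` therefore sees a fresh memory. -/
theorem writesOnly_reduction (d : ℕ) :
    (reduction d).WritesOnly (fun x => x % 40 ≠ 0) (· < 4) := by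
  simp [reduction, readSets, readSet, edgesProg, nextProg, Prog.for, Prog.WritesOnly,
    writesOnly_emit, writesOnly_seqAll_emit, -List.map_map]

end TokenSystem

/-! ## The running time of the reduction -/

/-- Lists of sets over a ground set, with at most as many entries as there are elements. -/
def SetList : Type := {p : ℕ × List (List ℕ) // ∀ l ∈ p.2, l.length ≤ p.1}

namespace SetList

/-- Number of elements plus number of sets. -/
def size (p : SetList) : ℕ := p.1.1 + p.1.2.length

/-- The token system of a list of sets. -/
def tokens (d : ℕ) (p : SetList) : TokenSystem := .ofSets d p.1.1 p.1.2

theorem length_flatten_le (p : SetList) : p.1.2.flatten.length ≤ p.1.1 * p.1.2.length := by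
  have key : ∀ (n : ℕ) (ls : List (List ℕ)), (∀ l ∈ ls, l.length ≤ n) →
      ls.flatten.length ≤ n * ls.length := by
    intro n ls h
    induction ls with
    | nil => simp
    | cons l ls ih =>
      rw [List.flatten_cons, List.length_append, List.length_cons, Nat.mul_succ]
      have h1 := h l List.mem_cons_self
      have h2 := ih fun l' h' => h l' (List.mem_cons_of_mem _ h')
      omega
  exact key _ _ p.2

variable (d : ℕ)

theorem polyBounded_n : PolyBounded size fun p => p.1.1 :=
  (PolyBounded.self _).mono fun _ => Nat.le_add_right _ _

theorem polyBounded_T : PolyBounded size fun p => (tokens d p).T :=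
  (polyBounded_n.mul ((PolyBounded.self _).mono fun _ => Nat.le_add_left _ _)).mono
    length_flatten_le

theorem polyBounded_U : PolyBounded size fun p => (tokens d p).U :=
  (polyBounded_T d).add (.const _ 1)

theorem polyBounded_J : PolyBounded size fun p => (tokens d p).J :=
  (polyBounded_n.add (.const _ 8)).mono fun _ => Nat.add_le_add_right (Nat.div_le_self _ _) 8

theorem polyBounded_E : PolyBounded size fun p => (tokens d p).E :=
  polyBounded_n.add (((polyBounded_J d).add (.const _ 1)).mul (.const _ d))

theorem polyBounded_Q : PolyBounded size fun p => (tokens d p).Q :=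
  (polyBounded_J d).mul ((polyBounded_U d).pow (2 * d))

theorem polyBounded_k : PolyBounded size fun p => (tokens d p).k :=
  (((polyBounded_J d).add (.const _ 1)).mul (.const _ (d + 1))).mono fun _ => Nat.sub_le _ _

theorem polyBounded_length_edges : PolyBounded size fun p => (tokens d p).edges.length :=
  ((polyBounded_Q d).mul ((PolyBounded.const _ d).add ((polyBounded_U d).pow d))).mono
    fun _ => TokenSystem.length_edges_le

theorem length_flatten_edges (S : TokenSystem) :
    S.edges.flatten.length = S.edges.length * (S.d + 2) := by
  have key : ∀ (n : ℕ) (ls : List (List ℕ)), (∀ l ∈ ls, l.length = n) →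
      ls.flatten.length = ls.length * n := by
    intro n ls h
    induction ls with
    | nil => simp
    | cons l ls ih =>
      rw [List.flatten_cons, List.length_append, List.length_cons, Nat.succ_mul,
        h l List.mem_cons_self, ih fun l' h' => h l' (List.mem_cons_of_mem _ h'), add_comm]
  exact key _ _ fun _ => TokenSystem.length_of_mem_edges

/-- A bound for all numbers that occur in the reduction. -/
noncomputable def bound (p : SetList) : ℕ :=
  (2 + p.size + (tokens d p).T) + (tokens d p).J + (tokens d p).k +
    ((tokens d p).E + (tokens d p).Q) + (3 + (tokens d p).edges.length * (d + 2)) +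
    ((tokens d p).Q + (tokens d p).U ^ (2 * d)) + (tokens d p).U ^ d

theorem polyBounded_bound : PolyBounded size (bound d) :=
  (((((((PolyBounded.const _ 2).add (.self _)).add (polyBounded_T d)).add (polyBounded_J d)).add
    (polyBounded_k d)).add ((polyBounded_E d).add (polyBounded_Q d))).add
    ((PolyBounded.const _ 3).add ((polyBounded_length_edges d).mul (.const _ (d + 2))))).add
    ((polyBounded_Q d).add ((polyBounded_U d).pow (2 * d))) |>.add ((polyBounded_U d).pow d)

end SetList

/-! ### Composition of the reduction with the given algorithm -/

open RAM in
/-- Reading the input and writing the instance of `k`-HyperPath. -/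
theorem RAM.exec_reduction (d n : ℕ) (ls : List (List ℕ)) (hn : ∀ l ∈ ls, ∀ x ∈ l, x < n)
    (hlen : ∀ l ∈ ls, l.length ≤ n) :
    ∃ s t, Exec (TokenSystem.reduction d) (State.init (setWord n ls)) s t ∧
      s.restrict (40 * ·) (· + 3) = State.init (TokenSystem.ofSets d n ls).word ∧
      t ≤ (TokenSystem.reduction d).timeBound (SetList.bound d ⟨(n, ls), hlen⟩) := by
  set S := TokenSystem.ofSets d n ls with hS
  set B := SetList.bound d ⟨(n, ls), hlen⟩ with hB
  have hB' : B = (2 + (n + ls.length) + ls.flatten.length) + S.J + S.k + (S.E + S.Q) +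
    (3 + S.edges.length * (d + 2)) + (S.Q + S.U ^ (2 * d)) + S.U ^ d := rfl
  have hmul : S.edges.length ≤ S.edges.length * (d + 2) := Nat.le_mul_of_pos_right _ (by omega)
  have hflat : S.edges.flatten.length = S.edges.length * (d + 2) :=
    SetList.length_flatten_edges S
  have hinit : (State.init (setWord n ls)).BoundedBy B := by
    refine ⟨fun x => Nat.zero_le _, fun a i => ?_⟩
    have hmem : ∀ v ∈ setWord n ls, v ≤ B := by
      intro v hv
      simp only [setWord, List.cons_append, List.nil_append, List.mem_cons, List.mem_flatten,
        List.mem_map, exists_exists_and_eq_and] at hv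
      rcases hv with rfl | rfl | ⟨l, hl, hv⟩
      · omega
      · omega
      · have h1 := hlen l hl
        rcases hv with rfl | hv
        · omega
        · have := hn l hl v hv
          omega
    simp only [State.init]
    split_ifs
    · rcases Nat.lt_or_ge i (setWord n ls).length with h | h
      · rw [List.getD_eq_getElem _ _ h]; exact hmem _ (List.getElem_mem h)
      · rw [List.getD_eq_default _ _ h]; exact Nat.zero_le _
    · exact Nat.zero_le _
  obtain ⟨s, t, hE, hout, -, ht⟩ := Prog.WP.exec _ hinit
    (TokenSystem.wp_reduction (d := d) S hS hn (by omega) (by omega) (by omega) (by omega)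
      (by omega) (by omega) (by change S.Q + S.U ^ (2 * d) ≤ B; omega)
      (by change S.U ^ d ≤ B; omega))
  obtain ⟨hreg, harr⟩ := hE.frame (TokenSystem.writesOnly_reduction d)
  refine ⟨s, t, hE, ?_, ht⟩
  simp only [State.restrict, State.init, State.mk.injEq]
  constructor
  · funext x
    exact hreg (40 * x) (by simp)
  · funext a i
    split_ifs with h
    · subst h; exact congrFun hout i
    · rw [harr (a + 3) (by omega)]
      simp [State.init]

/-- This makes the saving `γ * k` at least `γ * n`, uniformly in `d`. -/
theorem TokenSystem.le_k (S : TokenSystem) (hd : 1 ≤ S.d) : S.n ≤ S.k := by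
  have h1 : S.n < S.n / S.d * S.d + S.d := Nat.lt_div_mul_add hd
  rw [k_eq, Nat.mul_succ]
  have := Nat.zero_le (S.n / S.d)
  omega

/-- The state nodes lengthen the path by the factor `(d + 1) / d`, which the exponent cancels;
padding and rounding cost only the constant `9 * d`. -/
theorem TokenSystem.exponent_le (S : TokenSystem) (hd : 1 ≤ S.d) :
    (1 - 1 / ((S.d : ℝ) + 1)) * S.k ≤ S.n + 9 * S.d := by
  have hd' : (0 : ℝ) < S.d := by exact_mod_cast hd
  have h1 : S.n / S.d * S.d ≤ S.n := Nat.div_mul_le_self _ _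
  have h2 : S.d * S.k ≤ (S.n + 9 * S.d) * (S.d + 1) := by
    rw [k_eq]; nlinarith
  have h3 : (S.d : ℝ) * S.k ≤ (S.n + 9 * S.d) * (S.d + 1) := by exact_mod_cast h2
  rw [show 1 - 1 / ((S.d : ℝ) + 1) = S.d / (S.d + 1) by field_simp; ring, div_mul_eq_mul_div,
    div_le_iff₀ (by positivity)]
  exact h3

/-- The time for the reduction and for solving the new instance. -/
theorem add_time_le {K₁ K₂ C D c₁ c₂ : ℕ} {x y P t₁ t₂ : ℝ} (hP : 1 ≤ P) (hx : 0 ≤ x)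
    (h₁ : t₁ ≤ K₁ * (x + 1) ^ c₁) (hy : y ≤ K₂ * (x + 1) ^ c₂) (h₂ : t₂ ≤ C * y * (2 ^ D * P)) :
    t₁ + t₂ ≤ ((K₁ + C * K₂ * 2 ^ D : ℕ) : ℝ) * (x + 1) ^ (c₁ + c₂) * P := by
  have e₁ : (x + 1) ^ c₁ ≤ (x + 1) ^ (c₁ + c₂) := pow_le_pow_right₀ (by linarith) (by omega)
  have e₂ : (x + 1) ^ c₂ ≤ (x + 1) ^ (c₁ + c₂) := pow_le_pow_right₀ (by linarith) (by omega)
  have b₁ : t₁ ≤ K₁ * (x + 1) ^ (c₁ + c₂) * P :=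
    calc t₁ ≤ K₁ * (x + 1) ^ c₁ := h₁
      _ ≤ K₁ * (x + 1) ^ (c₁ + c₂) := by gcongr
      _ ≤ _ := le_mul_of_one_le_right (by positivity) hP
  have b₂ : t₂ ≤ C * (K₂ * (x + 1) ^ (c₁ + c₂)) * (2 ^ D * P) := by
    have b₃ : y ≤ K₂ * (x + 1) ^ (c₁ + c₂) := hy.trans (by gcongr)
    exact h₂.trans (by gcongr)
  push_cast
  calc t₁ + t₂ ≤ _ := add_le_add b₁ b₂
    _ = _ := by ring

open RAM in
theorem exactCoverSolvable_of_hyperPathSolvable {d : ℕ} (hd : 1 ≤ d) {γ δ : ℝ} (hγ : 0 < γ)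
    (hδγ : δ ≤ γ) (hδ : δ ≤ 1)
    (h : HyperPathSolvable (d + 2) (1 - 1 / ((d : ℝ) + 1) - γ)) : ExactCoverSolvable (1 - δ) := by
  obtain ⟨p, C, c, hp⟩ := h
  obtain ⟨K₁, c₁, h₁⟩ := (TokenSystem.reduction d).polyBounded_timeBound.comp
    (SetList.polyBounded_bound d)
  obtain ⟨K₂, c₂, h₂⟩ := ((((SetList.polyBounded_E d).add (SetList.polyBounded_Q d)).add
    (SetList.polyBounded_length_edges d)).add (SetList.polyBounded_k d)).add
      (.const _ 1) |>.pow c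
  refine ⟨.seq (TokenSystem.reduction d) (p.rename (40 * ·) (· + 3)),
    K₁ + C * K₂ * 2 ^ (9 * d), c₁ + c₂, fun I w hw => ?_⟩
  obtain ⟨L, hLnd, hLnd', hfam, rfl⟩ := hw
  set ls := L.map (List.map Fin.val) with hls
  have hword : [I.n, L.length] ++ (L.map fun l => l.length :: l.map Fin.val).flatten =
      setWord I.n ls := by
    simp [setWord, hls, List.map_map, Function.comp_def]
  have hn : ∀ l ∈ ls, ∀ x ∈ l, x < I.n := by
    intro l hl x hx
    obtain ⟨l, -, rfl⟩ := List.mem_map.1 hl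
    obtain ⟨y, -, rfl⟩ := List.mem_map.1 hx
    exact y.2
  have hnd : ∀ l ∈ ls, l.Nodup := by
    intro l hl
    obtain ⟨l, hl', rfl⟩ := List.mem_map.1 hl
    exact (hLnd l hl').map Fin.val_injective
  have hlen : ∀ l ∈ ls, l.length ≤ I.n := by
    intro l hl
    obtain ⟨l, hl', rfl⟩ := List.mem_map.1 hl
    rw [List.length_map]
    simpa using (hLnd l hl').length_le_card
  have hcard : I.family.card = ls.length := by
    rw [← hfam, List.toFinset_card_of_nodup hLnd', List.length_map, hls, List.length_map]
  set S := TokenSystem.ofSets d I.n ls with hS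
  have hlab := TokenSystem.lab_ofSets_lt (d := d) hn
  obtain ⟨I', hk, hsize, henc, hyes⟩ : ∃ I : HyperPathInstance (d + 2), I.k = S.k ∧
      I.size = S.E + S.Q + S.edges.length + S.k ∧ HyperPathInstance.Enc S.word I ∧
      (I.Yes ↔ ∃ f, S.IsPath f ∧ ∀ x < S.k, f x < S.E + S.Q) :=
    TokenSystem.exists_instance (S := S) hd hlab
  obtain ⟨s₁, t₁, E₁, hres, ht₁⟩ := exec_reduction d I.n ls hn hlen
  obtain ⟨s₂, t₂, E₂, hans, ht₂⟩ := hp I' S.word henc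
  obtain ⟨s₃, E₃, hres'⟩ := E₂.rename (ρ := (40 * ·)) (σ := (· + 3))
    (fun x y h => by simpa using h) (fun x y h => by simpa using h) s₁ hres
  refine ⟨s₃, t₁ + t₂, hword ▸ .seq E₁ E₃, ?_, ?_⟩
  -- The renaming of registers fixes `0`, so the answer is already in the right place.
  · have h0 : s₃.reg 0 = s₂.reg 0 := congrFun (congrArg State.reg hres') 0
    have hT : S.fst S.T ≠ 0 := by
      have := startMark_tokenOffset ls (le_refl ls.length)
      rwa [tokenOffset_length] at this
    have hT' : S.fst (S.T + 1) ≠ 0 := by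
      change startMark ls (ls.flatten.length + 1) ≠ 0
      rw [startMark, if_pos (.inr rfl)]; exact one_ne_zero
    rw [h0, I.yes_iff_hasExactCover L hLnd' hfam]
    refine (hans.trans hyes).trans ?_
    constructor
    · rintro ⟨f, hf, -⟩
      exact (hf.hasWalk hd hlab hT hT').hasExactCover hd hn
    · exact fun h => (h.hasWalk hn hnd).exists_isPath hd hlab
  · have hsz : SetList.size ⟨(I.n, ls), hlen⟩ = I.size := by
      change I.n + ls.length = I.n + I.family.card
      rw [hcard]
    have ht₁' : t₁ ≤ K₁ * (I.size + 1) ^ c₁ := by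
      rw [← hsz]; exact ht₁.trans (h₁ ⟨(I.n, ls), hlen⟩)
    have hsize' : (I'.size + 1) ^ c ≤ K₂ * (I.size + 1) ^ c₂ := by
      rw [hsize, ← hsz]; exact h₂ ⟨(I.n, ls), hlen⟩
    have hkn : (I.n : ℝ) ≤ S.k := by exact_mod_cast S.le_k hd
    have hexp := S.exponent_le hd
    have hSd : S.d = d := rfl
    have hSn : S.n = I.n := rfl
    rw [hSd, hSn] at hexp
    have hexp' : (1 - 1 / ((d : ℝ) + 1) - γ) * (I'.k : ℝ) ≤
        ((9 * d : ℕ) : ℝ) + (1 - δ) * I.n := by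
      rw [hk]
      have h1 : δ * I.n ≤ γ * S.k :=
        (mul_le_mul_of_nonneg_right hδγ (Nat.cast_nonneg _)).trans
          (mul_le_mul_of_nonneg_left hkn hγ.le)
      push_cast
      linarith
    set P : ℝ := (2 : ℝ) ^ ((1 - δ) * (I.n : ℝ)) with hP
    -- This is where `δ ≤ 1` enters: the polynomial time of the reduction must be absorbed by `P`.
    have hP1 : 1 ≤ P := Real.one_le_rpow one_le_two
      (mul_nonneg (by linarith) (Nat.cast_nonneg _))
    have hpow : (2 : ℝ) ^ ((1 - 1 / ((d : ℝ) + 1) - γ) * (I'.k : ℝ)) ≤ 2 ^ (9 * d) * P := by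
      refine (Real.rpow_le_rpow_of_exponent_le one_le_two hexp').trans_eq ?_
      rw [Real.rpow_add two_pos, Real.rpow_natCast]
    have b₁ : (t₁ : ℝ) ≤ K₁ * ((I.size : ℝ) + 1) ^ c₁ := by exact_mod_cast ht₁'
    have b₂ : ((I'.size : ℝ) + 1) ^ c ≤ K₂ * ((I.size : ℝ) + 1) ^ c₂ := by exact_mod_cast hsize'
    have hnonneg : (0 : ℝ) ≤ C * ((I'.size : ℝ) + 1) ^ c :=
      mul_nonneg (Nat.cast_nonneg _) (pow_nonneg (add_nonneg (Nat.cast_nonneg _) zero_le_one) _)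
    have b₃ := (show (t₂ : ℝ) ≤ C * ((I'.size : ℝ) + 1) ^ c *
      (2 : ℝ) ^ ((1 - 1 / ((d : ℝ) + 1) - γ) * (I'.k : ℝ)) from ht₂).trans
      (mul_le_mul_of_nonneg_left hpow hnonneg)
    rw [Nat.cast_add]
    exact add_time_le (C := C) (D := 9 * d) (x := (I.size : ℝ)) (P := P) hP1 (Nat.cast_nonneg _)
      b₁ b₂ b₃

theorem lemma3 (γ : ℝ) (hγ : 0 < γ) :
    ∃ δ : ℝ, 0 < δ ∧ ∀ r : ℕ, 3 ≤ r →
      HyperPathSolvable r (1 - 1 / ((r : ℝ) - 1) - γ) → ExactCoverSolvable (1 - δ) := by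
  refine ⟨min γ 1, lt_min hγ one_pos, fun r hr h => ?_⟩
  obtain ⟨d, rfl⟩ : ∃ d, r = d + 2 := ⟨r - 2, by omega⟩
  refine exactCoverSolvable_of_hyperPathSolvable (d := d) (by omega) hγ (min_le_left _ _)
    (min_le_right _ _) ?_
  rwa [show ((d + 2 : ℕ) : ℝ) - 1 = d + 1 by push_cast; ring] at h
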